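/- Consider the uplink of an impulse-radio network with $K$ users, $N_f$ frames per symbol, $N_c$ pulse positions per frame, processing gain $N=N_fN_c$, and channels with $L$ paths. The path gains $\alpha^{(k)}_l$ ($1\le k\le K$, $1\le l\le L$) are independent circularly symmetric complex Gaussian variables with mean $0$ and variance $\sigma_k^2\,\Psi^{-(l-1)/(L-1)}$, where $\sigma_k^2>0$ and $\Psi>0$. A partial-Rake (PRake) receiver with $L_P\le L$ fingers combines with weights $\beta^{(k)}_l=\alpha^{(k)}_l$ for $l\le L_P$ and $\beta^{(k)}_l=0$ for $l>L_P$; $L_P=L$ is the all-Rake (ARake) receiver. For a vector $x$ of length $L$ let $T(x)$ be the $L\times(L-1)$ matrix with entries $T(x)_{rc}=x_{L-c+r}$ for $r\le c$ and $0$ otherwise, let $\Phi=\mathrm{diag}\big(\sqrt{\min\{L-l,N_c\}/N_c}\big)_{1\le l\le L-1}$, $A_k=T(\alpha^{(k)})$, $B_k=T(\beta^{(k)})$, and $$h^{SP}_k=\beta^{(k)H}\alpha^{(k)},\qquad h^{SI}_k=\frac{\|\Phi(B_k^H\alpha^{(k)}+A_k^H\beta^{(k)})\|^2}{N\,h^{SP}_k},\qquad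 h^{MAI}_{kj}=\frac{\|B_k^H\alpha^{(j)}\|^2+\|A_j^H\beta^{(k)}\|^2+|\beta^{(k)H}\alpha^{(j)}|^2}{N\,h^{SP}_k}.$$ For transmit powers $p\in[0,p_{\max}]^K$ (with $p_{\max}>0$) the SINR of user $k$ is $\gamma_k=h^{SP}_kp_k/(h^{SI}_kp_k+\sum_{j\ne k}h^{MAI}_{kj}p_j+\sigma^2)$ with noise variance $\sigma^2>0$, and its utility is $u_k(p)=\frac{D}{M}R\,f(\gamma_k)/p_k$ (read as its limit $0$ when $p_k=0$), with constants $D,M,R>0$. The efficiency function $f$ is continuously differentiable on $[0,\infty)$, increasing and S-shaped, with $f(0)=f'(0)=0$ and $f(+\infty)=1$; $\gamma^*$ denotes the unique positive solution of $f'(\gamma)\gamma=f(\gamma)$. Put $$\mu(\Psi,\rho)=\frac{(\Psi-1)\Psi^{\rho-1}}{\Psi^\rho-1}$$ and let $\nu(\Psi,\rho,\beta)$ equal $$\begin{cases} \frac{\Psi(\Psi^\beta-1)(4\Psi^{2\rho}+3\Psi^\beta-1)-2\Psi^{\rho+\beta}(\Psi^\rho+3\Psi-1)\beta\log\Psi}{2(\Psi^\rho-1)^2\beta\Psi^{1+\beta}\log\Psi},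 & 0<\beta\le\min(\rho,1-\rho),\\[4pt] \frac{\Psi(4\Psi^\beta-1)(\Psi^{2\rho}-1)-2\Psi^{\rho+\beta}(3\Psi\rho-\beta+\Psi^\rho\beta)\log\Psi}{2(\Psi^\rho-1)^2\beta\Psi^{1+\beta}\log\Psi}, & \rho\le\beta\le1-\rho,\\[4pt] \frac{-4\Psi^{2+2\rho}-4\Psi^{2+\beta}+\Psi^{2(\rho+\beta)}+4\Psi^{2+2\rho+\beta}+3\Psi^{2+2\beta}-2\Psi^{1+\rho+\beta}(\rho+3\Psi\beta+\Psi^\rho\beta-1)\log\Psi}{2(\Psi^\rho-1)^2\beta\Psi^{2+\beta}\log\Psi}, & 1-\rho\le\beta\le\rho,\\[4pt] \frac{-\Psi^{2+2\rho}-4\Psi^{2+\beta}+\Psi^{2(\rho+\beta)}+4\Psi^{2+2\rho+\beta}-2\Psi^{1+\rho+\beta}(\rho+3\Psi\rho+\Psi^\rho\beta-1)\log\Psi}{2(\Psi^\rho-1)^2\beta\Psi^{2+\beta}\log\Psi}, & \max(\rho,1-\rho)\le\beta\le1,\\[4pt] \frac{2\Psi(\Psi^{2\rho}-1)-(\Psi^\rho+\rho+3\Psi\rho-1)\Psi^\rho\log\Psi}{(\Psi^\rho-1)^2\beta\Psi\log\Psi},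 & \beta\ge1, \end{cases}$$ let $\mu_A(\Psi)=1$, and let $\nu_A(\Psi,\beta)$ equal $\frac{2(\Psi^2-1+\Psi^\beta-\Psi^{2-\beta}-2\Psi\beta\log\Psi)}{(\Psi-1)^2\beta\log\Psi}$ for $\beta\le1$ and $\frac{2(\Psi^2-1-2\Psi\log\Psi)}{(\Psi-1)^2\beta\log\Psi}$ for $\beta\ge1$. At $\Psi=1$ all these functions are extended by their limits as $\Psi\to1$. Then $\mu_A(\Psi)=\lim_{\rho\to1^-}\mu(\Psi,\rho)$ and $\nu_A(\Psi,\beta)=\lim_{\rho\to1^-}\nu(\Psi,\rho,\beta)$. Let $L\to\infty$ with $K$ and $N_f\ge1$ fixed and with $\rho=L_P/L\in(0,1]$ and $\beta=N_c/L\in(0,\infty)$ held constant. Almost surely, for all sufficiently large systems Nash equilibria exist, both with PRake and with ARake receivers, and, for any choice of such equilibria, with utilities $u_k^*$ (all users with PRake) and $u_{k_A}^*$ (all users with ARake, same channel), the loss satisfies, for every user $k$, $$\frac{u_{k_A}^*}{u_k^*}-\mu(\Psi,\rho)\,F_N\to0,\qquad F_N=\frac{N-\gamma^*[(K-1)\mu_A(\Psi)+\nu_A(\Psi,\beta)]}{N-\gamma^*[(K-1)\mu(\Psi,\rho)+\nu(\Psi,\rho,\beta)]}.$$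 More precisely, the ratio $h^{SP}_{k_A}/h^{SP}_k$ of the ARake and PRake signal gains converges almost surely to $\mu(\Psi,\rho)$, and $\dfrac{u_{k_A}^*}{u_k^*}=\dfrac{h^{SP}_{k_A}}{h^{SP}_k}\,F_N\,(1+\varepsilon_N)$ with $N\varepsilon_N\to0$ almost surely. -/

import Mathlib

open Filter Topology MeasureTheory ProbabilityTheory

namespace UWB

noncomputable section

/-! ### Uplink with `K` users, `L` channel paths and partial-Rake receivers -/

/-- A realization of the network: `frames` is the number `N_f` of frames (pulses) per symbol,
`pulses` the number `N_c` of pulse positions per frame, `fingers` the number `L_P` of fingers of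
every Rake receiver, and `gain k l` the fading coefficient of path `l + 1` of user `k`. -/
structure Network (K L : ℕ) where
  frames : ℕ
  pulses : ℕ
  fingers : ℕ
  gain : Fin K → Fin L → ℂ

/-- Squared Euclidean norm of a complex vector. -/
def vecNormSq {n : ℕ} (x : Fin n → ℂ) : ℝ := ∑ i, ‖x i‖ ^ 2

/-- The `L × (L - 1)` upper triangular Toeplitz matrix
`[x_L ⋯ x_2; 0 x_L ⋯ x_3; ⋯; 0 ⋯ 0 x_L; 0 ⋯ 0]` of a vector `x = (x_1, …, x_L)`.
(Indices of `Fin` start at `0`.) -/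
def shiftMatrix {L : ℕ} (x : Fin L → ℂ) : Matrix (Fin L) (Fin (L - 1)) ℂ :=
  Matrix.of fun r c =>
    if h : (r : ℕ) ≤ (c : ℕ) then x ⟨L - 1 - (c : ℕ) + (r : ℕ), by omega⟩ else 0

/-- The diagonal matrix with entries `√(min (L - l, N_c) / N_c)`, `l = 1, …, L - 1`. -/
def phiMatrix (L Nc : ℕ) : Matrix (Fin (L - 1)) (Fin (L - 1)) ℂ :=
  Matrix.diagonal fun l =>
    ((Real.sqrt (((min (L - ((l : ℕ) + 1)) Nc : ℕ) : ℝ) / (Nc : ℝ)) : ℝ) : ℂ)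

namespace Network

variable {K L : ℕ} (W : Network K L)

/-- The processing gain `N = N_f N_c`. -/
def procGain : ℝ := (W.frames : ℝ) * (W.pulses : ℝ)

/-- The maximal-ratio combining weights: the processing matrix keeps the first `L_P` paths. -/
def rake (k : Fin K) : Fin L → ℂ :=
  (Matrix.diagonal fun l : Fin L => if (l : ℕ) < W.fingers then (1 : ℂ) else 0).mulVec (W.gain k)

/-- Signal gain `β_kᴴ α_k` (a real number, since the weights are a truncation of `α_k`). -/
def hSP (k : Fin K) : ℝ := (star (W.rake k) ⬝ᵥ W.gain k).re

/-- Self-interference gain. -/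
def hSI (k : Fin K) : ℝ :=
  1 / W.procGain *
    (vecNormSq ((phiMatrix L W.pulses).mulVec
        ((shiftMatrix (W.rake k)).conjTranspose.mulVec (W.gain k) +
          (shiftMatrix (W.gain k)).conjTranspose.mulVec (W.rake k))) /
      W.hSP k)

/-- Multiple-access interference gain of user `j` at the receiver of user `k`. -/
def hMAI (k j : Fin K) : ℝ :=
  1 / W.procGain *
    ((vecNormSq ((shiftMatrix (W.rake k)).conjTranspose.mulVec (W.gain j)) +
        vecNormSq ((shiftMatrix (W.gain j)).conjTranspose.mulVec (W.rake k)) +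
        ‖star (W.rake k) ⬝ᵥ W.gain j‖ ^ 2) /
      W.hSP k)

/-- The same network with all-Rake receivers (`L_P = L`). -/
def allRake : Network K L := { W with fingers := L }

end Network

/-! ### The power control game -/

/-- Parameters of the game: information bits and total bits per packet, transmission rate, noise
variance, maximum transmit power, and efficiency function (packet success rate). -/
structure Game where
  infoBits : ℕ
  totalBits : ℕ
  rate : ℝ
  noise : ℝ
  pmax : ℝ
  eff : ℝ → ℝ

/-- Efficiency functions: continuously differentiable on `[0, ∞)`, increasing, S-shaped (convex up
to some point and concave from there on), with `f 0 = 0`, `f' 0 = 0` and `f (+∞) = 1`. -/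
structure IsEfficiency (f : ℝ → ℝ) : Prop where
  contDiffOn : ContDiffOn ℝ 1 f (Set.Ici 0)
  monotoneOn : MonotoneOn f (Set.Ici 0)
  sShaped : ∃ x₀ : ℝ, 0 < x₀ ∧ ConvexOn ℝ (Set.Icc 0 x₀) f ∧ ConcaveOn ℝ (Set.Ici x₀) f
  map_zero : f 0 = 0
  deriv_zero : derivWithin f (Set.Ici 0) 0 = 0
  tendsto_one : Tendsto f atTop (𝓝 1)

/-- `Γ` is the (unique positive) solution of `f' (γ) γ = f (γ)`: the SINR at the equilibrium in
the absence of self-interference. -/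
def IsTargetSINR (f : ℝ → ℝ) (Γ : ℝ) : Prop :=
  0 < Γ ∧ ∀ x : ℝ, 0 < x → (deriv f x * x = f x ↔ x = Γ)

namespace Network

variable {K L : ℕ} (W : Network K L) (G : Game)

/-- Signal-to-interference-plus-noise ratio of user `k` for the transmit powers `p`. -/
def sinr (p : Fin K → ℝ) (k : Fin K) : ℝ :=
  W.hSP k * p k /
    (W.hSI k * p k + ∑ j ∈ Finset.univ.erase k, W.hMAI k j * p j + G.noise)

/-- Utility of user `k`. At `p k = 0` the value is `0`, which is also the limit as `p k → 0`. -/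
def utility (p : Fin K → ℝ) (k : Fin K) : ℝ :=
  (G.infoBits : ℝ) / (G.totalBits : ℝ) * G.rate * (G.eff (W.sinr G p k) / p k)

/-- `p` is a Nash equilibrium of the game with strategy sets `[0, pmax]`. -/
def IsNash (p : Fin K → ℝ) : Prop :=
  (∀ k, p k ∈ Set.Icc 0 G.pmax) ∧
    ∀ k, ∀ x ∈ Set.Icc 0 G.pmax, W.utility G (Function.update p k x) k ≤ W.utility G p k

end Network

/-! ### The channel model -/

/-- The circularly symmetric complex Gaussian law with mean `0` and variance `s`: independent real
and imaginary parts of variance `s / 2`. -/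
def circGaussian (s : ℝ) : Measure ℂ :=
  ((gaussianReal 0 (s / 2).toNNReal).prod (gaussianReal 0 (s / 2).toNNReal)).map
    fun z : ℝ × ℝ => (⟨z.1, z.2⟩ : ℂ)

/-- For every number `L` of paths the channel gains are independent, and the gain of path `l + 1`
of user `k` is circularly symmetric complex Gaussian with variance
`v k * Ψ ^ (-l / (L - 1))`. Nothing is assumed on the joint law for different `L`. -/
structure IsChannel {Ω : Type*} [MeasurableSpace Ω] (P : Measure Ω) {K : ℕ} (v : Fin K → ℝ)
    (Ψ : ℝ) (α : (L : ℕ) → Fin K → Fin L → Ω → ℂ) : Prop where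
  indep : ∀ L, iIndepFun (fun i : Fin K × Fin L => α L i.1 i.2) P
  law : ∀ L k (l : Fin L),
    HasLaw (α L k l) (circGaussian (v k * Ψ ^ (-((l : ℕ) : ℝ) / ((L : ℝ) - 1)))) P

/-- The `n`-th network of the asymptotic regime, at the outcome `ω`: `L n` paths, `N_f` frames,
`Nc n` pulse positions and Rake receivers with `LP n` fingers. -/
def networkAt {Ω : Type*} {K : ℕ} (Nf : ℕ) (L Nc LP : ℕ → ℕ)
    (α : (L : ℕ) → Fin K → Fin L → Ω → ℂ) (ω : Ω) (n : ℕ) : Network K (L n) where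
  frames := Nf
  pulses := Nc n
  fingers := LP n
  gain := fun k l => α (L n) k l ω

/-! ### The limiting functions -/

/-- Extension of a function of `Ψ` to `Ψ = 1` (flat power delay profile) by its limit. -/
def extendOne (g : ℝ → ℝ) (Ψ : ℝ) : ℝ := if Ψ = 1 then limUnder (𝓝[≠] (1 : ℝ)) g else g Ψ

/-- `μ(Ψ, ρ)`. -/
def mu (Ψ ρ : ℝ) : ℝ := extendOne (fun ψ => (ψ - 1) * ψ ^ (ρ - 1) / (ψ ^ ρ - 1)) Ψ

/-- The expression of `ν(Ψ, ρ, β)` for `Ψ ≠ 1`. -/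
def nuFormula (Ψ ρ β : ℝ) : ℝ :=
  if β ≤ min ρ (1 - ρ) then
    (Ψ * (Ψ ^ β - 1) * (4 * Ψ ^ (2 * ρ) + 3 * Ψ ^ β - 1)
        - 2 * Ψ ^ (ρ + β) * (Ψ ^ ρ + 3 * Ψ - 1) * β * Real.log Ψ)
      / (2 * (Ψ ^ ρ - 1) ^ 2 * β * Ψ ^ (1 + β) * Real.log Ψ)
  else if ρ ≤ β ∧ β ≤ 1 - ρ then
    (Ψ * (4 * Ψ ^ β - 1) * (Ψ ^ (2 * ρ) - 1)
        - 2 * Ψ ^ (ρ + β) * (3 * Ψ * ρ - β + Ψ ^ ρ * β) * Real.log Ψ)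
      / (2 * (Ψ ^ ρ - 1) ^ 2 * β * Ψ ^ (1 + β) * Real.log Ψ)
  else if 1 - ρ ≤ β ∧ β ≤ ρ then
    (-4 * Ψ ^ (2 + 2 * ρ) - 4 * Ψ ^ (2 + β) + Ψ ^ (2 * (ρ + β)) + 4 * Ψ ^ (2 + 2 * ρ + β)
        + 3 * Ψ ^ (2 + 2 * β)
        - 2 * Ψ ^ (1 + ρ + β) * (ρ + 3 * Ψ * β + Ψ ^ ρ * β - 1) * Real.log Ψ)
      / (2 * (Ψ ^ ρ - 1) ^ 2 * β * Ψ ^ (2 + β) * Real.log Ψ)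
  else if β ≤ 1 then
    (-Ψ ^ (2 + 2 * ρ) - 4 * Ψ ^ (2 + β) + Ψ ^ (2 * (ρ + β)) + 4 * Ψ ^ (2 + 2 * ρ + β)
        - 2 * Ψ ^ (1 + ρ + β) * (ρ + 3 * Ψ * ρ + Ψ ^ ρ * β - 1) * Real.log Ψ)
      / (2 * (Ψ ^ ρ - 1) ^ 2 * β * Ψ ^ (2 + β) * Real.log Ψ)
  else
    (2 * Ψ * (Ψ ^ (2 * ρ) - 1) - (Ψ ^ ρ + ρ + 3 * Ψ * ρ - 1) * Ψ ^ ρ * Real.log Ψ)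
      / ((Ψ ^ ρ - 1) ^ 2 * β * Ψ * Real.log Ψ)

/-- `ν(Ψ, ρ, β)`. -/
def nu (Ψ ρ β : ℝ) : ℝ := extendOne (fun ψ => nuFormula ψ ρ β) Ψ

/-- `μ_A(Ψ) = 1`, the limit of `μ(Ψ, ρ)` as `ρ → 1`. -/
def muA (_Ψ : ℝ) : ℝ := 1

/-- The expression of `ν_A(Ψ, β)` for `Ψ ≠ 1`. -/
def nuAFormula (Ψ β : ℝ) : ℝ :=
  if β ≤ 1 then
    2 * (Ψ ^ 2 - 1 + Ψ ^ β - Ψ ^ (2 - β) - 2 * Ψ * β * Real.log Ψ)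
      / ((Ψ - 1) ^ 2 * β * Real.log Ψ)
  else
    2 * (Ψ ^ 2 - 1 - 2 * Ψ * Real.log Ψ) / ((Ψ - 1) ^ 2 * β * Real.log Ψ)

/-- `ν_A(Ψ, β)`, the limit of `ν(Ψ, ρ, β)` as `ρ → 1`. -/
def nuA (Ψ β : ℝ) : ℝ := extendOne (fun ψ => nuAFormula ψ β) Ψ

/-- The interference factor
`(N - Γ [(K-1) μ_A + ν_A]) / (N - Γ [(K-1) μ + ν])` for the processing gain `N`. -/
def interferenceFactor (K : ℕ) (Γ Ψ ρ β N : ℝ) : ℝ :=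
  (N - Γ * (((K : ℝ) - 1) * muA Ψ + nuA Ψ β)) / (N - Γ * (((K : ℝ) - 1) * mu Ψ ρ + nu Ψ ρ β))

end

end UWB

/-! Let ε = hSI / hSP for a user whose multiple-access interference plus noise is I. In terms of its
SINR y, its inverse power is (hSP / I)(1/y - ε), so its utility is a constant times (hSP / I) ·
f(y)(1/y - ε). Since I does not depend on the user's own power, a best response maximises f(y)(1/y -
ε) whenever the power limit does not bind, and this problem involves ε alone. The powers that meet
given SINR targets increase with the powers of the other users, so an equilibrium exists by the
Knaster–Tarski theorem.

In a large system hSP grows like N, N ε tends to ν, and N hMAI k j / hSP j tends to μ. An envelope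
argument (`IsEfficiency.tendsto_value`) shows that the maximum of f(y)(1/y - ε) is (f(Γ)/Γ)(1 - Γν/N
+ o(1/N)): the shift of the maximiser away from Γ has no first-order effect. Equilibrium powers tend
to 0, so I tends to the noise σ², each received power hSP j · p j tends to Γσ², and I = σ²(1 +
Γ(K-1)μ/N + o(1/N)). Thus utility / hSP is a constant common to both receivers times 1 - Γ((K-1)μ +
ν)/N + o(1/N) (`IsLargeSystem.expansion_utility`), and the quotient of two such expansions agrees
with the interference factor up to o(1/N).

The limits of the gains come from `sum_lag_sq`, which splits a sum of squared lagged correlations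
into a diagonal part, built from products of path energies, and an off-diagonal part. The means of
the diagonal part are Riemann sums of an exponential profile. The fluctuations and the off-diagonal
part are written through martingale transforms, with cruder bounds for terms of lower order. After
normalisation their fourth moments are O(1/L²) (`HasFourthMoment.transform`), hence summable over L,
which gives almost sure convergence whatever the joint law for different L.

The limits are ratios of integrals that are continuous in (log Ψ, ρ). This settles both the
extension to Ψ = 1 and the limit ρ → 1. The five cases of ν come from min(β, c) for c = ρ, 1 and 1 -
ρ (`nuFormula_eq`). -/

namespace UWB

/-! ### Efficiency functions -/

section Efficiency

variable {f : ℝ → ℝ} {Γ : ℝ}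

lemma IsEfficiency.nonneg (hf : IsEfficiency f) {x : ℝ} (hx : 0 ≤ x) : 0 ≤ f x := by
  rw [← hf.map_zero]
  exact hf.monotoneOn (Set.mem_Ici.2 le_rfl) (Set.mem_Ici.2 hx) hx

lemma IsEfficiency.le_one (hf : IsEfficiency f) {x : ℝ} (hx : 0 ≤ x) : f x ≤ 1 := by
  refine ge_of_tendsto hf.tendsto_one ?_
  filter_upwards [eventually_ge_atTop x] with y hy
  exact hf.monotoneOn (Set.mem_Ici.2 hx) (Set.mem_Ici.2 (hx.trans hy)) hy

lemma IsEfficiency.continuousAt (hf : IsEfficiency f) {x : ℝ} (hx : 0 < x) : ContinuousAt f x :=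
  hf.contDiffOn.continuousOn.continuousAt (Ici_mem_nhds hx)

lemma IsEfficiency.differentiableAt (hf : IsEfficiency f) {x : ℝ} (hx : 0 < x) :
    DifferentiableAt ℝ f x :=
  (hf.contDiffOn.differentiableOn (by norm_num)).differentiableAt (Ici_mem_nhds hx)

lemma IsEfficiency.tendsto_div_zero (hf : IsEfficiency f) :
    Tendsto (fun x => f x / x) (𝓝[>] 0) (𝓝 0) := by
  have hd : HasDerivWithinAt f 0 (Set.Ici 0) 0 := by
    have h := ((hf.contDiffOn.differentiableOn (by norm_num)) 0
      (Set.mem_Ici.2 le_rfl)).hasDerivWithinAt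
    rwa [hf.deriv_zero] at h
  have h := (hasDerivWithinAt_iff_tendsto_slope.1 hd)
  have h2 : Set.Ici (0 : ℝ) \ {0} = Set.Ioi 0 := Set.Ici_sdiff_left
  rw [h2] at h
  refine h.congr fun x => ?_
  simp [slope_def_field, hf.map_zero]

lemma IsEfficiency.tendsto_div_atTop (hf : IsEfficiency f) :
    Tendsto (fun x => f x / x) atTop (𝓝 0) := hf.tendsto_one.div_atTop tendsto_id

/-- At 0 the quotient is 0 / 0 = 0 by convention, which is also its limit f' 0. Compactness can
therefore be used on closed intervals starting at 0. -/
lemma IsEfficiency.continuousOn_div (hf : IsEfficiency f) :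
    ContinuousOn (fun x => f x / x) (Set.Ici 0) := by
  intro x hx
  rcases (Set.mem_Ici.1 hx).eq_or_lt with rfl | hx
  · rw [← Set.Ioi_insert, continuousWithinAt_insert_self]
    have := hf.tendsto_div_zero
    simpa [ContinuousWithinAt] using this
  · exact ((hf.continuousAt hx).div continuousAt_id hx.ne').continuousWithinAt

lemma IsEfficiency.exists_pos (hf : IsEfficiency f) : ∃ x, 0 < x ∧ 0 < f x := by
  have h := (hf.tendsto_one.eventually (lt_mem_nhds (show (0 : ℝ) < 1 by norm_num))).and
    (eventually_gt_atTop (0 : ℝ))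
  obtain ⟨x, h1, h2⟩ := h.exists
  exact ⟨x, h2, h1⟩

/-- The derivative of f x / x vanishes exactly where f' x · x = f x, and Γ is the only positive such
point. -/
lemma IsEfficiency.eq_target_of_isMax (hf : IsEfficiency f) (hΓ : IsTargetSINR f Γ) {y : ℝ}
    (hy : 0 < y) (hmax : ∀ x, 0 < x → f x / x ≤ f y / y) : y = Γ := by
  have hloc : IsLocalMax (fun x => f x / x) y := by
    filter_upwards [lt_mem_nhds hy] with x hx using hmax x hx
  have hd := (hf.differentiableAt hy).hasDerivAt.div (hasDerivAt_id y) hy.ne'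
  have h0 := hloc.hasDerivAt_eq_zero hd
  rw [← hΓ.2 y hy]
  simp only [id, mul_one] at h0
  rcases div_eq_zero_iff.1 h0 with h | h
  · linarith
  · exact absurd h (by positivity)

/-- The quotient is 0 at 0, tends to 0 at infinity and is positive somewhere, so it attains its
supremum at a positive point. The first-order condition identifies that point as Γ. -/
lemma IsEfficiency.div_le_target (hf : IsEfficiency f) (hΓ : IsTargetSINR f Γ) {x : ℝ}
    (hx : 0 < x) : f x / x ≤ f Γ / Γ := by
  obtain ⟨z, hz, hfz⟩ := hf.exists_pos
  have hpos : 0 < f z / z := by positivity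
  have hev := (hf.tendsto_div_atTop.eventually (gt_mem_nhds hpos)).and (eventually_ge_atTop z)
  obtain ⟨M, hM⟩ := eventually_atTop.1 hev
  have hzM : z ≤ max M z := le_max_right _ _
  obtain ⟨y, hy, hymax⟩ := (isCompact_Icc (a := (0 : ℝ)) (b := max M z)).exists_isMaxOn
    ⟨z, hz.le, hzM⟩ (hf.continuousOn_div.mono Set.Icc_subset_Ici_self)
  have hyz : f z / z ≤ f y / y := hymax ⟨hz.le, hzM⟩
  have hy0 : 0 < y := by
    rcases hy.1.eq_or_lt with h | h
    · rw [← h, div_zero] at hyz; linarith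
    · exact h
  have hall : ∀ x, 0 < x → f x / x ≤ f y / y := by
    intro x hx
    rcases le_total x (max M z) with h | h
    · exact hymax ⟨hx.le, h⟩
    · exact ((hM x ((le_max_left _ _).trans h)).1.le).trans hyz
  rw [← hf.eq_target_of_isMax hΓ hy0 hall]
  exact hall x hx

lemma IsEfficiency.target_pos (hf : IsEfficiency f) (hΓ : IsTargetSINR f Γ) : 0 < f Γ := by
  obtain ⟨z, hz, hfz⟩ := hf.exists_pos
  have h := hf.div_le_target hΓ hz
  have : 0 < f Γ / Γ := lt_of_lt_of_le (by positivity) h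
  exact (div_pos_iff_of_pos_right hΓ.1).1 this

/-- `y` maximises `f x * (1 / x - ε)` over the positive reals. -/
def IsOptSINR (f : ℝ → ℝ) (ε y : ℝ) : Prop :=
  0 < y ∧ ∀ x, 0 < x → f x * (1 / x - ε) ≤ f y * (1 / y - ε)

/-- A bound on the optimal SINR for small self-interference. -/
noncomputable def sinrCap (f : ℝ → ℝ) (Γ : ℝ) : ℝ := 2 * Γ / f Γ

lemma IsEfficiency.sinrCap_pos (hf : IsEfficiency f) (hΓ : IsTargetSINR f Γ) :
    0 < sinrCap f Γ := by
  have := hf.target_pos hΓ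
  have := hΓ.1
  unfold sinrCap; positivity

lemma IsEfficiency.target_le_sinrCap (hf : IsEfficiency f) (hΓ : IsTargetSINR f Γ) :
    2 * Γ ≤ sinrCap f Γ := by
  have h1 := hf.target_pos hΓ
  have h2 := hf.le_one hΓ.1.le
  have := hΓ.1
  unfold sinrCap
  rw [le_div_iff₀ h1]; nlinarith

/-- The cap is chosen so that its inverse is half of f Γ / Γ. Since f ≤ 1, the value beyond the cap
is below that half, while ε ≤ 1 / (2Γ) leaves at least that half at Γ. -/
lemma IsEfficiency.value_le_of_cap_lt (hf : IsEfficiency f) (hΓ : IsTargetSINR f Γ) {ε x : ℝ}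
    (hε : 0 ≤ ε) (hε1 : ε * sinrCap f Γ ≤ 1) (hx : sinrCap f Γ < x) :
    f x * (1 / x - ε) < f Γ * (1 / Γ - ε) := by
  have h1 := hf.target_pos hΓ
  have hM := hf.sinrCap_pos hΓ
  have hMG := hf.target_le_sinrCap hΓ
  have hG := hΓ.1
  have hx0 : 0 < x := hM.trans hx
  have hfx := hf.nonneg hx0.le
  have hfx1 := hf.le_one hx0.le
  have a1 : f x * (1 / x - ε) ≤ 1 / x := by
    have : 0 ≤ 1 / x := by positivity
    nlinarith [mul_nonneg hfx hε]
  have a2 : 1 / x < 1 / sinrCap f Γ := one_div_lt_one_div_of_lt hM hx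
  have a3 : 1 / sinrCap f Γ = f Γ / (2 * Γ) := by unfold sinrCap; rw [one_div_div]
  have a4 : f Γ / (2 * Γ) ≤ f Γ * (1 / Γ - ε) := by
    have : ε ≤ 1 / (2 * Γ) := by
      rw [le_div_iff₀ (by positivity)]
      exact (mul_le_mul_of_nonneg_left hMG hε).trans hε1
    have e : f Γ / (2 * Γ) = f Γ * (1 / Γ - 1 / (2 * Γ)) := by field_simp; norm_num
    rw [e]
    exact mul_le_mul_of_nonneg_left (by linarith) h1.le
  linarith

lemma IsEfficiency.exists_isOptSINR (hf : IsEfficiency f) (hΓ : IsTargetSINR f Γ) {ε : ℝ}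
    (hε : 0 ≤ ε) (hε1 : ε * sinrCap f Γ ≤ 1 / 2) :
    ∃ y, y ≤ sinrCap f Γ ∧ IsOptSINR f ε y := by
  have h1 := hf.target_pos hΓ
  have hM := hf.sinrCap_pos hΓ
  have hMG := hf.target_le_sinrCap hΓ
  have hG := hΓ.1
  have hc : ContinuousOn (fun x => f x / x - f x * ε) (Set.Icc 0 (sinrCap f Γ)) :=
    (hf.continuousOn_div.sub (hf.contDiffOn.continuousOn.mul continuousOn_const)).mono
      Set.Icc_subset_Ici_self
  have hGm : Γ ∈ Set.Icc 0 (sinrCap f Γ) := ⟨hG.le, by linarith⟩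
  obtain ⟨y, hy, hymax⟩ := isCompact_Icc.exists_isMaxOn ⟨Γ, hGm⟩ hc
  have hyG : f Γ / Γ - f Γ * ε ≤ f y / y - f y * ε := hymax hGm
  have hpos : 0 < f Γ / Γ - f Γ * ε := by
    have : ε * (2 * Γ) ≤ 1 / 2 := (mul_le_mul_of_nonneg_left hMG hε).trans hε1
    have e : f Γ / Γ - f Γ * ε = f Γ / Γ * (1 - ε * Γ) := by field_simp
    rw [e]
    have : 0 < 1 - ε * Γ := by linarith
    positivity
  have hy0 : 0 < y := by
    rcases hy.1.eq_or_lt with h | h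
    · rw [← h, hf.map_zero, zero_div, zero_mul] at hyG; linarith
    · exact h
  have conv : ∀ x, f x * (1 / x - ε) = f x / x - f x * ε := fun x => by ring
  refine ⟨y, hy.2, hy0, fun x hx => ?_⟩
  rcases le_or_gt x (sinrCap f Γ) with h | h
  · rw [conv, conv]; exact hymax ⟨hx.le, h⟩
  · have := hf.value_le_of_cap_lt hΓ hε (by linarith) h
    rw [conv Γ] at this
    rw [conv y]; linarith

/-- Optimal SINRs tend to the target as the self-interference vanishes. -/
lemma IsEfficiency.tendsto_of_isOptSINR (hf : IsEfficiency f) (hΓ : IsTargetSINR f Γ)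
    {ε y : ℕ → ℝ} (hε0 : ∀ᶠ n in atTop, 0 ≤ ε n) (hε : Tendsto ε atTop (𝓝 0))
    (hy : ∀ᶠ n in atTop, IsOptSINR f (ε n) (y n)) : Tendsto y atTop (𝓝 Γ) := by
  have hM := hf.sinrCap_pos hΓ
  have hG := hΓ.1
  have hfG := hf.target_pos hΓ
  have hcap : ∀ᶠ n in atTop, ε n * sinrCap f Γ ≤ 1 := by
    have : Tendsto (fun n => ε n * sinrCap f Γ) atTop (𝓝 (0 * sinrCap f Γ)) :=
      hε.mul_const _
    rw [zero_mul] at this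
    exact (this.eventually (gt_mem_nhds (by norm_num : (0 : ℝ) < 1))).mono fun n h => h.le
  have hbd : ∀ᶠ n in atTop, y n ∈ Set.Icc 0 (sinrCap f Γ) := by
    filter_upwards [hε0, hcap, hy] with n h0 h1 h2
    refine ⟨h2.1.le, ?_⟩
    by_contra h
    exact absurd (h2.2 Γ hG) (not_le.2 (hf.value_le_of_cap_lt hΓ h0 h1 (not_le.1 h)))
  -- Every subsequence has a further one converging to some z in [0, cap]. Passing to the limit in
  -- the comparison with Γ shows that z maximises f x / x, so z = Γ; the point z = 0 is excluded
  -- because the quotient vanishes there.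
  refine tendsto_of_subseq_tendsto fun ns hns => ?_
  obtain ⟨z, hz, φ, hφ, hlim⟩ := isCompact_Icc.tendsto_subseq' (x := y ∘ ns)
    ((hns.eventually hbd).frequently)
  refine ⟨φ, ?_⟩
  have hsub : Tendsto (fun n => ns (φ n)) atTop atTop := hns.comp hφ.tendsto_atTop
  have key : ∀ᶠ n in atTop, f Γ / Γ - f Γ * ε (ns (φ n)) ≤ f (y (ns (φ n))) / y (ns (φ n)) := by
    filter_upwards [hsub.eventually hy, hsub.eventually hε0] with n h1 h2
    have a := h1.2 Γ hG
    have b := mul_nonneg (hf.nonneg h1.1.le) h2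
    have e : ∀ x, f x * (1 / x - ε (ns (φ n))) = f x / x - f x * ε (ns (φ n)) := fun x => by ring
    rw [e, e] at a
    linarith
  have hlimy : Tendsto (fun n => f (y (ns (φ n))) / y (ns (φ n))) atTop (𝓝 (f z / z)) := by
    have h1 : Tendsto (fun n => y (ns (φ n))) atTop (𝓝[Set.Ici 0] z) :=
      tendsto_nhdsWithin_iff.2 ⟨hlim, (hsub.eventually hbd).mono fun n h => h.1⟩
    exact (hf.continuousOn_div z hz.1).tendsto.comp h1
  have hliml : Tendsto (fun n => f Γ / Γ - f Γ * ε (ns (φ n))) atTop (𝓝 (f Γ / Γ - f Γ * 0)) :=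
    tendsto_const_nhds.sub ((hε.comp hsub).const_mul _)
  have hge : f Γ / Γ ≤ f z / z := by
    have := le_of_tendsto_of_tendsto hliml hlimy key
    simpa using this
  have hz0 : 0 < z := by
    rcases hz.1.eq_or_lt with h | h
    · rw [← h, div_zero] at hge
      have : 0 < f Γ / Γ := by positivity
      linarith
    · exact h
  have : z = Γ := hf.eq_target_of_isMax hΓ hz0
    fun x hx => (hf.div_le_target hΓ hx).trans hge
  rw [← this]
  exact hlim

/-- First order expansion of the optimal value in the self-interference: by optimality the
displacement of the maximiser has no first-order effect. -/
lemma IsEfficiency.tendsto_value (hf : IsEfficiency f) (hΓ : IsTargetSINR f Γ)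
    {ε y N : ℕ → ℝ} {ν : ℝ} (hε0 : ∀ᶠ n in atTop, 0 ≤ ε n) (hε : Tendsto ε atTop (𝓝 0))
    (hN : ∀ᶠ n in atTop, 0 ≤ N n)
    (hNε : Tendsto (fun n => N n * ε n) atTop (𝓝 ν))
    (hy : ∀ᶠ n in atTop, IsOptSINR f (ε n) (y n)) :
    Tendsto (fun n => N n * (f (y n) * (1 / y n - ε n) / (f Γ / Γ) - 1)) atTop (𝓝 (-(Γ * ν))) := by
  have hG := hΓ.1
  have hfG := hf.target_pos hΓ
  have hlim := hf.tendsto_of_isOptSINR hΓ hε0 hε hy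
  have hflim : Tendsto (fun n => f (y n)) atTop (𝓝 (f Γ)) := (hf.continuousAt hG).tendsto.comp hlim
  -- The optimal value is at least the value at Γ and at most f Γ / Γ - f(y) ε. As f(y) → f Γ, the
  -- two bounds have the same first-order term.
  have hlow : Tendsto (fun n => -(Γ * (N n * ε n))) atTop (𝓝 (-(Γ * ν))) :=
    (hNε.const_mul Γ).neg
  have hup : Tendsto (fun n => -(Γ * (N n * ε n) * (f (y n) / f Γ))) atTop (𝓝 (-(Γ * ν))) := by
    have h1 : Tendsto (fun n => f (y n) / f Γ) atTop (𝓝 1) := by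
      have := hflim.div_const (f Γ)
      rwa [div_self hfG.ne'] at this
    have := ((hNε.const_mul Γ).mul h1).neg
    rwa [mul_one] at this
  refine tendsto_of_tendsto_of_tendsto_of_le_of_le' hlow hup ?_ ?_
  · filter_upwards [hy, hN] with n h hn
    have a := h.2 Γ hG
    have e : -(Γ * (N n * ε n)) = N n * (f Γ * (1 / Γ - ε n) / (f Γ / Γ) - 1) := by
      field_simp; ring
    rw [e]
    gcongr
  · filter_upwards [hy, hN] with n h hn
    have a := hf.div_le_target hΓ h.1
    have e : -(Γ * (N n * ε n) * (f (y n) / f Γ))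
        = N n * ((f Γ / Γ - f (y n) * ε n) / (f Γ / Γ) - 1) := by
      field_simp; ring
    have e2 : f (y n) * (1 / y n - ε n) = f (y n) / y n - f (y n) * ε n := by ring
    rw [e, e2]
    gcongr

end Efficiency

/-! ### Nash equilibria -/

namespace Network

variable {K L : ℕ} (W : Network K L) (G : Game)

/-- Noise plus multiple-access interference at the receiver of user `k`. -/
noncomputable def interf (p : Fin K → ℝ) (k : Fin K) : ℝ :=
  ∑ j ∈ Finset.univ.erase k, W.hMAI k j * p j + G.noise

lemma interf_update (p : Fin K → ℝ) (k : Fin K) (x : ℝ) :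
    W.interf G (Function.update p k x) k = W.interf G p k := by
  unfold interf
  congr 1
  refine Finset.sum_congr rfl fun j hj => ?_
  rw [Function.update_of_ne (Finset.ne_of_mem_erase hj)]

lemma sinr_eq (p : Fin K → ℝ) (k : Fin K) :
    W.sinr G p k = W.hSP k * p k / (W.hSI k * p k + W.interf G p k) := by
  unfold sinr interf; rw [add_assoc]

lemma noise_le_interf (hMAI : ∀ k j, 0 ≤ W.hMAI k j) {p : Fin K → ℝ} (hp : ∀ k, 0 ≤ p k)
    (k : Fin K) : G.noise ≤ W.interf G p k :=
  le_add_of_nonneg_left (Finset.sum_nonneg fun j _ => mul_nonneg (hMAI k j) (hp j))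

lemma interf_mono (hMAI : ∀ k j, 0 ≤ W.hMAI k j) {p q : Fin K → ℝ} (h : p ≤ q) (k : Fin K) :
    W.interf G p k ≤ W.interf G q k := by
  unfold interf
  gcongr with j _
  · exact hMAI k j
  · exact h j

variable {W G}

/-- In terms of the SINR `y`, the inverse power is `(hSP / I) * (1 / y - hSI / hSP)`. -/
lemma inv_power_eq {p : Fin K → ℝ} {k : Fin K} (hSP : 0 < W.hSP k) (hSI : 0 ≤ W.hSI k)
    (hp : 0 < p k) (hI : 0 < W.interf G p k) :
    1 / p k = W.hSP k / W.interf G p k * (1 / W.sinr G p k - W.hSI k / W.hSP k) := by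
  rw [sinr_eq]
  have : 0 < W.hSI k * p k + W.interf G p k := by positivity
  field_simp
  ring

lemma sinr_pos {p : Fin K → ℝ} {k : Fin K} (hSP : 0 < W.hSP k) (hSI : 0 ≤ W.hSI k)
    (hp : 0 < p k) (hI : 0 < W.interf G p k) : 0 < W.sinr G p k := by
  rw [sinr_eq]; positivity

/-- The factor in front is unaffected by the user's own power, so the game reduces for each user to
the choice of an SINR. -/
lemma utility_eq {p : Fin K → ℝ} {k : Fin K} (hSP : 0 < W.hSP k) (hSI : 0 ≤ W.hSI k)
    (hp : 0 < p k) (hI : 0 < W.interf G p k) :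
    W.utility G p k = (G.infoBits : ℝ) / G.totalBits * G.rate * (W.hSP k / W.interf G p k) *
      (G.eff (W.sinr G p k) * (1 / W.sinr G p k - W.hSI k / W.hSP k)) := by
  unfold utility
  rw [div_eq_mul_one_div (G.eff _), inv_power_eq hSP hSI hp hI]
  ring

/-- The power that achieves the SINR `y`. -/
lemma sinr_of_power_eq {p : Fin K → ℝ} {k : Fin K} {y : ℝ} (hSP : 0 < W.hSP k)
    (hI : 0 < W.interf G p k) (hy : W.hSI k / W.hSP k * y < 1)
    (hp : p k = y * W.interf G p k / (W.hSP k * (1 - W.hSI k / W.hSP k * y))) :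
    W.sinr G p k = y := by
  have h2 : 0 < W.hSP k - W.hSI k * y := by
    have : W.hSI k / W.hSP k * y = W.hSI k * y / W.hSP k := by ring
    rw [this, div_lt_one hSP] at hy; linarith
  have h1 : W.hSP k * (1 - W.hSI k / W.hSP k * y) = W.hSP k - W.hSI k * y := by
    field_simp
  rw [h1] at hp
  rw [sinr_eq, hp]
  have : W.hSI k * (y * W.interf G p k / (W.hSP k - W.hSI k * y)) + W.interf G p k
      = W.hSP k * W.interf G p k / (W.hSP k - W.hSI k * y) := by
    field_simp; ring
  rw [this]
  have h4 : W.hSP k - y * W.hSI k ≠ 0 := by rw [mul_comm]; exact h2.ne'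
  field_simp

lemma power_of_sinr {p : Fin K → ℝ} {k : Fin K} (hSP : 0 < W.hSP k) (hSI : 0 ≤ W.hSI k)
    (hp : 0 < p k) (hI : 0 < W.interf G p k) :
    W.hSP k * p k * (1 - W.hSI k / W.hSP k * W.sinr G p k) = W.sinr G p k * W.interf G p k := by
  have := inv_power_eq hSP hSI hp hI
  have h3 := sinr_pos hSP hSI hp hI
  have e : 1 / W.sinr G p k - W.hSI k / W.hSP k
      = (1 - W.hSI k / W.hSP k * W.sinr G p k) / W.sinr G p k := by
    field_simp
  rw [e] at this
  field_simp at this ⊢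
  linarith

/-- A system whose gains are in the regime where equilibria are governed by the first-order
conditions: small self-interference, and power constraints that are not active. -/
structure IsRegular (W : Network K L) (G : Game) (Γ : ℝ) : Prop where
  hSP_pos : ∀ k, 0 < W.hSP k
  hSI_nonneg : ∀ k, 0 ≤ W.hSI k
  hMAI_nonneg : ∀ k j, 0 ≤ W.hMAI k j
  small : ∀ k, W.hSI k / W.hSP k * sinrCap G.eff Γ ≤ 1 / 2
  power : ∀ k, 2 * sinrCap G.eff Γ * W.interf G (fun _ => G.pmax) k ≤ W.hSP k * G.pmax

variable {Γ : ℝ} (hnoise : 0 < G.noise) (hpmax : 0 < G.pmax)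
  (hf : IsEfficiency G.eff) (hΓ : IsTargetSINR G.eff Γ)
  (hc : 0 < (G.infoBits : ℝ) / G.totalBits * G.rate)

/-! ### Existence and characterisation of equilibria in regular systems -/

section

variable (hW : W.IsRegular G Γ)
include hW hnoise hpmax hf hΓ

/-- SINRs up to the cap are feasible: there 1 - εy ≥ 1/2, so the required power is at most 2 · cap /
hSP times the interference at full power, which regularity bounds by `G.pmax`. -/
lemma IsRegular.power_le {p : Fin K → ℝ} (hp : ∀ k, p k ∈ Set.Icc 0 G.pmax) (k : Fin K)
    {y : ℝ} (hy : 0 < y) (hyc : y ≤ sinrCap G.eff Γ) :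
    0 < y * W.interf G p k / (W.hSP k * (1 - W.hSI k / W.hSP k * y)) ∧
    y * W.interf G p k / (W.hSP k * (1 - W.hSI k / W.hSP k * y)) ≤ G.pmax := by
  have h1 : W.hSI k / W.hSP k * y ≤ 1 / 2 :=
    (mul_le_mul_of_nonneg_left hyc (div_nonneg (hW.hSI_nonneg k) (hW.hSP_pos k).le)).trans
      (hW.small k)
  have hI : 0 < W.interf G p k :=
    hnoise.trans_le (W.noise_le_interf G hW.hMAI_nonneg (fun k => (hp k).1) k)
  have h2 : 0 < 1 - W.hSI k / W.hSP k * y := by linarith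
  have h3 := hW.hSP_pos k
  refine ⟨by positivity, ?_⟩
  rw [div_le_iff₀ (by positivity)]
  have h4 : W.interf G p k ≤ W.interf G (fun _ => G.pmax) k :=
    W.interf_mono G hW.hMAI_nonneg (fun k => (hp k).2) k
  have h5 : y * W.interf G p k ≤ sinrCap G.eff Γ * W.interf G (fun _ => G.pmax) k := by
    have := hf.sinrCap_pos hΓ
    gcongr
  have h6 := hW.power k
  have h7 : W.hSP k * G.pmax * (1 / 2) ≤ W.hSP k * G.pmax * (1 - W.hSI k / W.hSP k * y) :=
    mul_le_mul_of_nonneg_left (by linarith) (by positivity)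
  linarith

include hc

/-- The optimal SINR of each user depends on its ε only. The map sending a power vector to the
powers that achieve these SINRs against it is monotone on a product of intervals, a complete
lattice, so it has a least fixed point, where every user plays a best response. -/
lemma IsRegular.exists_isNash : ∃ p, W.IsNash G p := by
  have hex : ∀ k, ∃ y, y ≤ sinrCap G.eff Γ ∧ IsOptSINR G.eff (W.hSI k / W.hSP k) y := fun k =>
    hf.exists_isOptSINR hΓ (div_nonneg (hW.hSI_nonneg k) (hW.hSP_pos k).le) (hW.small k)
  choose y hyc hy using hex
  let : Fact ((0 : ℝ) ≤ G.pmax) := ⟨hpmax.le⟩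
  let T : (Fin K → Set.Icc (0 : ℝ) G.pmax) →o (Fin K → Set.Icc (0 : ℝ) G.pmax) :=
    { toFun := fun q k => ⟨y k * W.interf G (fun j => (q j : ℝ)) k /
          (W.hSP k * (1 - W.hSI k / W.hSP k * y k)),
          (hW.power_le hnoise hpmax hf hΓ (fun j => (q j).2) k (hy k).1 (hyc k)).1.le,
          (hW.power_le hnoise hpmax hf hΓ (fun j => (q j).2) k (hy k).1 (hyc k)).2⟩
      monotone' := by
        intro q q' hq k
        have h1 : W.hSI k / W.hSP k * y k ≤ 1 / 2 :=
          (mul_le_mul_of_nonneg_left (hyc k)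
            (div_nonneg (hW.hSI_nonneg k) (hW.hSP_pos k).le)).trans (hW.small k)
        have h3 := hW.hSP_pos k
        have h4 : 0 < W.hSP k * (1 - W.hSI k / W.hSP k * y k) := mul_pos h3 (by linarith)
        have h5 := W.interf_mono G hW.hMAI_nonneg (p := fun j => (q j : ℝ))
          (q := fun j => (q' j : ℝ)) (fun j => hq j) k
        have h6 := (hy k).1
        change y k * W.interf G (fun j => (q j : ℝ)) k / _ ≤
          y k * W.interf G (fun j => (q' j : ℝ)) k / _
        gcongr }
  have hfix := T.map_lfp
  set q := OrderHom.lfp T with hq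
  set p : Fin K → ℝ := fun k => (q k : ℝ) with hpdef
  have hpIcc : ∀ k, p k ∈ Set.Icc 0 G.pmax := fun k => (q k).2
  have hpk : ∀ k, p k = y k * W.interf G p k / (W.hSP k * (1 - W.hSI k / W.hSP k * y k)) := by
    intro k
    have := congrArg (fun r => ((r k : Set.Icc (0 : ℝ) G.pmax) : ℝ)) hfix
    exact this.symm
  have hpos : ∀ k, 0 < p k := fun k => by
    rw [hpk k]
    exact (hW.power_le hnoise hpmax hf hΓ hpIcc k (hy k).1 (hyc k)).1
  have hI : ∀ k, 0 < W.interf G p k := fun k =>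
    hnoise.trans_le (W.noise_le_interf G hW.hMAI_nonneg (fun k => (hpIcc k).1) k)
  have hsinr : ∀ k, W.sinr G p k = y k := fun k => by
    refine sinr_of_power_eq (hW.hSP_pos k) (hI k) ?_ (hpk k)
    have := (mul_le_mul_of_nonneg_left (hyc k)
            (div_nonneg (hW.hSI_nonneg k) (hW.hSP_pos k).le)).trans (hW.small k)
    linarith
  refine ⟨p, hpIcc, fun k x hx => ?_⟩
  have hUk := utility_eq (hW.hSP_pos k) (hW.hSI_nonneg k) (hpos k) (hI k)
  rw [hsinr k] at hUk
  rcases hx.1.eq_or_lt with h0 | h0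
  · have : W.utility G (Function.update p k x) k = 0 := by
      unfold utility; rw [Function.update_self, ← h0]; simp
    rw [this]
    unfold utility
    have h1 := hf.nonneg (sinr_pos (hW.hSP_pos k) (hW.hSI_nonneg k) (hpos k) (hI k)).le
    have h2 := hpos k
    positivity
  · have hxp : 0 < Function.update p k x k := by rwa [Function.update_self]
    have hIx : 0 < W.interf G (Function.update p k x) k := by rw [interf_update]; exact hI k
    rw [utility_eq (hW.hSP_pos k) (hW.hSI_nonneg k) hxp hIx, hUk, interf_update]
    have h3 := hW.hSP_pos k
    have h4 := hI k
    exact mul_le_mul_of_nonneg_left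
      ((hy k).2 _ (sinr_pos (hW.hSP_pos k) (hW.hSI_nonneg k) hxp hIx)) (by positivity)

/-- Deviations to any SINR up to the cap are feasible, so an equilibrium beats all of them; beyond
the cap the value is below that at Γ. Zero power is ruled out because a deviation to the SINR Γ
yields a positive utility. -/
lemma IsRegular.isOptSINR_of_isNash {p : Fin K → ℝ} (hp : W.IsNash G p) (k : Fin K) :
    0 < p k ∧ IsOptSINR G.eff (W.hSI k / W.hSP k) (W.sinr G p k) := by
  have hI : 0 < W.interf G p k :=
    hnoise.trans_le (W.noise_le_interf G hW.hMAI_nonneg (fun k => (hp.1 k).1) k)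
  have h3 := hW.hSP_pos k
  have hε := div_nonneg (hW.hSI_nonneg k) (hW.hSP_pos k).le
  have hcap := hf.target_le_sinrCap hΓ
  have hG := hΓ.1
  have hfG := hf.target_pos hΓ
  have key : ∀ z, 0 < z → z ≤ sinrCap G.eff Γ →
      (G.infoBits : ℝ) / G.totalBits * G.rate * (W.hSP k / W.interf G p k) *
        (G.eff z * (1 / z - W.hSI k / W.hSP k)) ≤ W.utility G p k := by
    intro z hz hzc
    obtain ⟨hx0, hx1⟩ := hW.power_le hnoise hpmax hf hΓ hp.1 k hz hzc
    set x := z * W.interf G p k / (W.hSP k * (1 - W.hSI k / W.hSP k * z)) with hx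
    have h := hp.2 k x ⟨hx0.le, hx1⟩
    have hxp : 0 < Function.update p k x k := by rwa [Function.update_self]
    have hIx : 0 < W.interf G (Function.update p k x) k := by rwa [interf_update]
    rw [utility_eq (hW.hSP_pos k) (hW.hSI_nonneg k) hxp hIx, interf_update] at h
    have hs : W.sinr G (Function.update p k x) k = z := by
      refine sinr_of_power_eq h3 hIx ?_ ?_
      · have := (mul_le_mul_of_nonneg_left hzc hε).trans (hW.small k)
        linarith
      · rw [interf_update, Function.update_self]
    rwa [hs] at h
  have hpos : 0 < p k := by
    rcases (hp.1 k).1.eq_or_lt with h0 | h0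
    · have h1 := key Γ hG (by linarith)
      have h2 : W.utility G p k = 0 := by unfold utility; rw [← h0]; simp
      have h5 : 0 < 1 / Γ - W.hSI k / W.hSP k := by
        have : W.hSI k / W.hSP k * (2 * Γ) ≤ 1 / 2 :=
          (mul_le_mul_of_nonneg_left hcap hε).trans (hW.small k)
        rw [sub_pos, lt_div_iff₀ hG]; linarith
      rw [h2] at h1
      have : 0 < (G.infoBits : ℝ) / G.totalBits * G.rate * (W.hSP k / W.interf G p k) *
        (G.eff Γ * (1 / Γ - W.hSI k / W.hSP k)) := by positivity
      linarith
    · exact h0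
  have hle : ∀ z, 0 < z → z ≤ sinrCap G.eff Γ → G.eff z * (1 / z - W.hSI k / W.hSP k) ≤
      G.eff (W.sinr G p k) * (1 / W.sinr G p k - W.hSI k / W.hSP k) := by
    intro z hz hzc
    have h := key z hz hzc
    rw [utility_eq h3 (hW.hSI_nonneg k) hpos hI] at h
    exact le_of_mul_le_mul_left h (by positivity)
  refine ⟨hpos, sinr_pos h3 (hW.hSI_nonneg k) hpos hI, fun z hz => ?_⟩
  rcases le_or_gt z (sinrCap G.eff Γ) with h | h
  · exact hle z hz h
  · have h1 := hf.value_le_of_cap_lt hΓ hε (by linarith [hW.small k]) h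
    exact h1.le.trans (hle Γ hG (by linarith))

end

end Network

/-! ### First-order expansions in `1 / N` -/

section Expansion

variable {N a b : ℕ → ℝ} {A B : ℝ}

lemma tendsto_one_of_expansion (hN : Tendsto N atTop atTop)
    (ha : Tendsto (fun n => N n * (a n - 1)) atTop (𝓝 A)) : Tendsto a atTop (𝓝 1) := by
  have h := (ha.div_atTop hN).add_const 1
  rw [zero_add] at h
  refine h.congr' ?_
  filter_upwards [hN.eventually_gt_atTop 0] with n hn
  field_simp; ring

/-- This rests on N(a/b - 1) = (N(a - 1) - N(b - 1)) / b together with b → 1. -/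
lemma expansion_div (hN : Tendsto N atTop atTop)
    (ha : Tendsto (fun n => N n * (a n - 1)) atTop (𝓝 A))
    (hb : Tendsto (fun n => N n * (b n - 1)) atTop (𝓝 B)) :
    Tendsto (fun n => N n * (a n / b n - 1)) atTop (𝓝 (A - B)) := by
  have hb1 := tendsto_one_of_expansion hN hb
  have h := (ha.sub hb).div hb1 one_ne_zero
  rw [div_one] at h
  refine h.congr' ?_
  filter_upwards [hb1.eventually_ne one_ne_zero] with n hn
  simp only [Pi.div_apply]
  field_simp; ring

lemma expansion_interferenceFactor (hN : Tendsto N atTop atTop) (K : ℕ) (Γ Ψ ρ β : ℝ) :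
    Tendsto (fun n => N n * (interferenceFactor K Γ Ψ ρ β (N n) - 1)) atTop
      (𝓝 (-(Γ * (((K : ℝ) - 1) * muA Ψ + nuA Ψ β)) - -(Γ * (((K : ℝ) - 1) * mu Ψ ρ + nu Ψ ρ β)))) := by
  have key : ∀ c : ℝ, Tendsto (fun n => N n * ((1 - c / N n) - 1)) atTop (𝓝 (-c)) := by
    intro c
    refine tendsto_const_nhds.congr' ?_
    filter_upwards [hN.eventually_gt_atTop 0] with n hn
    field_simp; ring
  refine (expansion_div hN (key _) (key _)).congr' ?_
  filter_upwards [hN.eventually_gt_atTop 0] with n hn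
  unfold interferenceFactor
  generalize Γ * (((K : ℝ) - 1) * muA Ψ + nuA Ψ β) = c
  generalize Γ * (((K : ℝ) - 1) * mu Ψ ρ + nu Ψ ρ β) = d
  have e : ∀ x, 1 - x / N n = (N n - x) / N n := fun x => by field_simp
  rw [e, e, div_div_div_cancel_right₀ hn.ne']

end Expansion

/-! ### Equilibria of large systems -/

/-- The behaviour of the gains in the large system limit, `N` being the processing gain. -/
structure IsLargeSystem {K : ℕ} {L : ℕ → ℕ} (W : (n : ℕ) → Network K (L n)) (N : ℕ → ℝ)
    (μ ν : ℝ) : Prop where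
  tendsto_gain : Tendsto N atTop atTop
  signal : ∀ k, ∃ s : ℝ, 0 < s ∧ Tendsto (fun n => (W n).hSP k / N n) atTop (𝓝 s)
  hSI_nonneg : ∀ n k, 0 ≤ (W n).hSI k
  hMAI_nonneg : ∀ n k j, 0 ≤ (W n).hMAI k j
  self : ∀ k, Tendsto (fun n => N n * ((W n).hSI k / (W n).hSP k)) atTop (𝓝 ν)
  cross : ∀ k j, j ≠ k → Tendsto (fun n => N n * ((W n).hMAI k j / (W n).hSP j)) atTop (𝓝 μ)

namespace IsLargeSystem

variable {K : ℕ} {L : ℕ → ℕ} {W : (n : ℕ) → Network K (L n)} {N : ℕ → ℝ} {μ ν : ℝ}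
  {G : Game} {Γ : ℝ}

lemma tendsto_hSP (h : IsLargeSystem W N μ ν) (k : Fin K) :
    Tendsto (fun n => (W n).hSP k) atTop atTop := by
  obtain ⟨s, hs, hlim⟩ := h.signal k
  refine (hlim.pos_mul_atTop hs h.tendsto_gain).congr' ?_
  filter_upwards [h.tendsto_gain.eventually_gt_atTop 0] with n hn
  field_simp

lemma tendsto_self_zero (h : IsLargeSystem W N μ ν) (k : Fin K) :
    Tendsto (fun n => (W n).hSI k / (W n).hSP k) atTop (𝓝 0) := by
  refine ((h.self k).div_atTop h.tendsto_gain).congr' ?_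
  filter_upwards [h.tendsto_gain.eventually_gt_atTop 0] with n hn
  field_simp

/-- The factor 1 / N in the limit of hMAI / hSP is compensated by the linear growth of hSP, so the
cross gains stay bounded. -/
lemma exists_tendsto_hMAI (h : IsLargeSystem W N μ ν) (k j : Fin K) (hj : j ≠ k) :
    ∃ c, Tendsto (fun n => (W n).hMAI k j) atTop (𝓝 c) := by
  obtain ⟨s, hs, hlim⟩ := h.signal j
  refine ⟨_, ((h.cross k j hj).mul hlim).congr' ?_⟩
  filter_upwards [h.tendsto_gain.eventually_gt_atTop 0,
    (h.tendsto_hSP j).eventually_gt_atTop 0] with n hn hn2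
  field_simp

lemma exists_tendsto_interf (h : IsLargeSystem W N μ ν) (k : Fin K) :
    ∃ c, Tendsto (fun n => (W n).interf G (fun _ => G.pmax) k) atTop (𝓝 c) := by
  choose! c hc using fun j => h.exists_tendsto_hMAI k j
  refine ⟨∑ j ∈ Finset.univ.erase k, c j * G.pmax + G.noise, ?_⟩
  unfold Network.interf
  exact (tendsto_finsetSum _ fun j hj =>
    (hc j (Finset.ne_of_mem_erase hj)).mul_const _).add_const _

lemma eventually_isRegular (h : IsLargeSystem W N μ ν) (hpmax : 0 < G.pmax) :
    ∀ᶠ n in atTop, (W n).IsRegular G Γ := by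
  have h1 : ∀ᶠ n in atTop, ∀ k, 0 < (W n).hSP k :=
    eventually_all.2 fun k => (h.tendsto_hSP k).eventually_gt_atTop 0
  have h2 : ∀ᶠ n in atTop, ∀ k, (W n).hSI k / (W n).hSP k * sinrCap G.eff Γ ≤ 1 / 2 := by
    refine eventually_all.2 fun k => ?_
    have := (h.tendsto_self_zero k).mul_const (sinrCap G.eff Γ)
    rw [zero_mul] at this
    exact (this.eventually (gt_mem_nhds (by norm_num : (0 : ℝ) < 1 / 2))).mono fun n h => h.le
  have h3 : ∀ᶠ n in atTop, ∀ k, 2 * sinrCap G.eff Γ * (W n).interf G (fun _ => G.pmax) k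
      ≤ (W n).hSP k * G.pmax := by
    refine eventually_all.2 fun k => ?_
    obtain ⟨c, hc⟩ := h.exists_tendsto_interf (G := G) k
    have hc' := hc.const_mul (2 * sinrCap G.eff Γ)
    filter_upwards [hc'.eventually (gt_mem_nhds (lt_add_one _)),
      ((h.tendsto_hSP k).atTop_mul_const hpmax).eventually_ge_atTop
        (2 * sinrCap G.eff Γ * c + 1)] with n a b
    linarith
  filter_upwards [h1, h2, h3] with n a b c
  exact ⟨a, h.hSI_nonneg n, h.hMAI_nonneg n, b, c⟩

variable (h : IsLargeSystem W N μ ν) (hnoise : 0 < G.noise) (hpmax : 0 < G.pmax)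
  (hf : IsEfficiency G.eff) (hΓ : IsTargetSINR G.eff Γ)
  (hc : 0 < (G.infoBits : ℝ) / G.totalBits * G.rate)
include h hnoise hpmax hf hΓ hc

lemma eventually_exists_isNash : ∀ᶠ n in atTop, ∃ p, (W n).IsNash G p :=
  (h.eventually_isRegular (Γ := Γ) hpmax).mono fun _ hn => hn.exists_isNash hnoise hpmax hf hΓ hc

variable {p : ℕ → Fin K → ℝ} (hp : ∀ᶠ n in atTop, (W n).IsNash G (p n))
include hp

lemma eventually_isOptSINR (k : Fin K) :
    ∀ᶠ n in atTop, (W n).IsRegular G Γ ∧ (∀ j, p n j ∈ Set.Icc 0 G.pmax) ∧ 0 < p n k ∧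
      0 < (W n).interf G (p n) k ∧
      IsOptSINR G.eff ((W n).hSI k / (W n).hSP k) ((W n).sinr G (p n) k) := by
  filter_upwards [hp, h.eventually_isRegular (Γ := Γ) hpmax] with n h1 h2
  obtain ⟨a, b⟩ := h2.isOptSINR_of_isNash hnoise hpmax hf hΓ hc h1 k
  exact ⟨h2, h1.1, a, hnoise.trans_le
    ((W n).noise_le_interf G h2.hMAI_nonneg (fun k => (h1.1 k).1) k), b⟩

lemma tendsto_sinr (k : Fin K) : Tendsto (fun n => (W n).sinr G (p n) k) atTop (𝓝 Γ) := by
  have hev := h.eventually_isOptSINR hnoise hpmax hf hΓ hc hp k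
  refine hf.tendsto_of_isOptSINR hΓ ?_ (h.tendsto_self_zero k) (hev.mono fun n hn => hn.2.2.2.2)
  filter_upwards [hev] with n hn
  exact div_nonneg (hn.1.hSI_nonneg k) (hn.1.hSP_pos k).le

lemma tendsto_sinr_div (k : Fin K) : Tendsto (fun n => (W n).sinr G (p n) k /
    (1 - (W n).hSI k / (W n).hSP k * (W n).sinr G (p n) k)) atTop (𝓝 Γ) := by
  have hs := h.tendsto_sinr hnoise hpmax hf hΓ hc hp k
  have h1 := (tendsto_const_nhds (x := (1 : ℝ))).sub ((h.tendsto_self_zero k).mul hs)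
  rw [zero_mul, sub_zero] at h1
  have h2 := hs.div h1 one_ne_zero
  rwa [div_one] at h2

lemma eventually_received_power_eq (k : Fin K) : ∀ᶠ n in atTop,
    (W n).hSP k * p n k = (W n).sinr G (p n) k /
      (1 - (W n).hSI k / (W n).hSP k * (W n).sinr G (p n) k) * (W n).interf G (p n) k := by
  have hs := h.tendsto_sinr hnoise hpmax hf hΓ hc hp k
  have h1 := (tendsto_const_nhds (x := (1 : ℝ))).sub ((h.tendsto_self_zero k).mul hs)
  rw [zero_mul, sub_zero] at h1
  filter_upwards [h.eventually_isOptSINR hnoise hpmax hf hΓ hc hp k,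
    h1.eventually (lt_mem_nhds one_pos)] with n hn h0
  have := Network.power_of_sinr (hn.1.hSP_pos k) (hn.1.hSI_nonneg k) hn.2.2.1 hn.2.2.2.1
  rw [div_mul_eq_mul_div, eq_div_iff h0.ne', this]

/-- An a priori estimate: the interference is at most its value at full power, which converges, so
hSP · p stays bounded while hSP tends to infinity. -/
lemma tendsto_power_zero (k : Fin K) : Tendsto (fun n => p n k) atTop (𝓝 0) := by
  obtain ⟨c, hcI⟩ := h.exists_tendsto_interf (G := G) k
  have h1 := h.tendsto_sinr_div hnoise hpmax hf hΓ hc hp k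
  have hup := (h1.mul hcI).div_atTop (h.tendsto_hSP k)
  refine tendsto_of_tendsto_of_tendsto_of_le_of_le' tendsto_const_nhds hup ?_ ?_
  · filter_upwards [h.eventually_isOptSINR hnoise hpmax hf hΓ hc hp k] with n hn using hn.2.2.1.le
  · filter_upwards [h.eventually_isOptSINR hnoise hpmax hf hΓ hc hp k,
      h.eventually_received_power_eq hnoise hpmax hf hΓ hc hp k,
      h1.eventually (lt_mem_nhds hΓ.1)] with n hn he h0
    rw [le_div_iff₀ (hn.1.hSP_pos k), mul_comm, he]
    exact mul_le_mul_of_nonneg_left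
      ((W n).interf_mono G hn.1.hMAI_nonneg (fun j => (hn.2.1 j).2) k) h0.le

lemma tendsto_interf (k : Fin K) :
    Tendsto (fun n => (W n).interf G (p n) k) atTop (𝓝 G.noise) := by
  choose! c hcM using fun j => h.exists_tendsto_hMAI k j
  have : Tendsto (fun n => (W n).interf G (p n) k) atTop
      (𝓝 (∑ j ∈ Finset.univ.erase k, c j * 0 + G.noise)) := by
    unfold Network.interf
    exact (tendsto_finsetSum _ fun j hj => (hcM j (Finset.ne_of_mem_erase hj)).mul
      (h.tendsto_power_zero hnoise hpmax hf hΓ hc hp j)).add_const _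
  simpa using this

lemma tendsto_received_power (k : Fin K) :
    Tendsto (fun n => (W n).hSP k * p n k) atTop (𝓝 (Γ * G.noise)) :=
  ((h.tendsto_sinr_div hnoise hpmax hf hΓ hc hp k).mul
    (h.tendsto_interf hnoise hpmax hf hΓ hc hp k)).congr'
    ((h.eventually_received_power_eq hnoise hpmax hf hΓ hc hp k).mono fun _ hn => hn.symm)

/-- Each interferer contributes (N hMAI k j / hSP j) · (hSP j · p j) / σ², where the first factor
tends to μ and the received power tends to Γσ². There are K - 1 interferers. -/
lemma expansion_interf (k : Fin K) :
    Tendsto (fun n => N n * ((W n).interf G (p n) k / G.noise - 1)) atTop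
      (𝓝 (Γ * (((K : ℝ) - 1) * μ))) := by
  have h1 : Tendsto (fun n => ∑ j ∈ Finset.univ.erase k,
      N n * ((W n).hMAI k j / (W n).hSP j) * ((W n).hSP j * p n j) / G.noise) atTop
      (𝓝 (∑ j ∈ Finset.univ.erase k, μ * (Γ * G.noise) / G.noise)) :=
    tendsto_finsetSum _ fun j hj => ((h.cross k j (Finset.ne_of_mem_erase hj)).mul
      (h.tendsto_received_power hnoise hpmax hf hΓ hc hp j)).div_const _
  have e : ∑ j ∈ Finset.univ.erase k, μ * (Γ * G.noise) / G.noise = Γ * (((K : ℝ) - 1) * μ) := by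
    rw [Finset.sum_const, Finset.card_erase_of_mem (Finset.mem_univ k), Finset.card_univ,
      Fintype.card_fin, nsmul_eq_mul, Nat.cast_sub (by have := k.pos; omega)]
    field_simp
    rw [Nat.cast_one]; ring
  rw [e] at h1
  refine h1.congr' ?_
  filter_upwards [h.eventually_isOptSINR hnoise hpmax hf hΓ hc hp k] with n hn
  have : (W n).interf G (p n) k / G.noise - 1
      = (∑ j ∈ Finset.univ.erase k, (W n).hMAI k j * p n j) / G.noise := by
    unfold Network.interf; field_simp; ring
  rw [this, Finset.sum_div, Finset.mul_sum]
  refine Finset.sum_congr rfl fun j _ => ?_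
  have := hn.1.hSP_pos j
  field_simp

/-- First order expansion of the utility at equilibrium. -/
lemma expansion_utility (k : Fin K) :
    Tendsto (fun n => N n * ((W n).utility G (p n) k / (W n).hSP k /
      ((G.infoBits : ℝ) / G.totalBits * G.rate * (G.eff Γ / Γ) / G.noise) - 1)) atTop
      (𝓝 (-(Γ * (((K : ℝ) - 1) * μ + ν)))) := by
  have hev := h.eventually_isOptSINR hnoise hpmax hf hΓ hc hp k
  have h1 := hf.tendsto_value hΓ (N := N) (hev.mono fun n hn => div_nonneg (hn.1.hSI_nonneg k)
    (hn.1.hSP_pos k).le) (h.tendsto_self_zero k)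
    (h.tendsto_gain.eventually_ge_atTop 0) (h.self k) (hev.mono fun n hn => hn.2.2.2.2)
  have h2 := expansion_div h.tendsto_gain h1 (h.expansion_interf hnoise hpmax hf hΓ hc hp k)
  have e : -(Γ * ν) - Γ * (((K : ℝ) - 1) * μ) = -(Γ * (((K : ℝ) - 1) * μ + ν)) := by ring
  rw [e] at h2
  refine h2.congr' ?_
  filter_upwards [hev] with n hn
  congr 2
  rw [Network.utility_eq (hn.1.hSP_pos k) (hn.1.hSI_nonneg k) hn.2.2.1 hn.2.2.2.1]
  have a1 := hn.1.hSP_pos k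
  have a2 := hn.2.2.2.1
  have a3 := hf.target_pos hΓ
  have a4 := hΓ.1
  have a5 := hc.ne'
  generalize G.eff ((W n).sinr G (p n) k) * (1 / (W n).sinr G (p n) k - (W n).hSI k / (W n).hSP k)
    = V
  generalize (G.infoBits : ℝ) / G.totalBits * G.rate = c at *
  field_simp

end IsLargeSystem

/-- Comparison of the equilibria of two large systems with the same processing gain. -/
lemma tendsto_loss {K : ℕ} {L : ℕ → ℕ} {W WA : (n : ℕ) → Network K (L n)} {N : ℕ → ℝ}
    {Ψ ρ β m : ℝ} {G : Game} {Γ : ℝ}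
    (h : IsLargeSystem W N (mu Ψ ρ) (nu Ψ ρ β)) (hA : IsLargeSystem WA N (muA Ψ) (nuA Ψ β))
    (hnoise : 0 < G.noise) (hpmax : 0 < G.pmax)
    (hf : IsEfficiency G.eff) (hΓ : IsTargetSINR G.eff Γ)
    (hc : 0 < (G.infoBits : ℝ) / G.totalBits * G.rate)
    {p pA : ℕ → Fin K → ℝ} (hp : ∀ᶠ n in atTop, (W n).IsNash G (p n))
    (hpA : ∀ᶠ n in atTop, (WA n).IsNash G (pA n)) (k : Fin K)
    (hm : Tendsto (fun n => (WA n).hSP k / (W n).hSP k) atTop (𝓝 m)) :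
    Tendsto (fun n => (WA n).utility G (pA n) k / (W n).utility G (p n) k
      - m * interferenceFactor K Γ Ψ ρ β (N n)) atTop (𝓝 0) ∧
    Tendsto (fun n => N n * ((WA n).utility G (pA n) k / (W n).utility G (p n) k
      / ((WA n).hSP k / (W n).hSP k) - interferenceFactor K Γ Ψ ρ β (N n))) atTop (𝓝 0) := by
  have hN := h.tendsto_gain
  have e1 := expansion_div hN (hA.expansion_utility hnoise hpmax hf hΓ hc hpA k)
    (h.expansion_utility hnoise hpmax hf hΓ hc hp k)
  have e2 := expansion_interferenceFactor hN K Γ Ψ ρ β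
  have key : ∀ᶠ n in atTop, (WA n).utility G (pA n) k / (WA n).hSP k /
      ((G.infoBits : ℝ) / G.totalBits * G.rate * (G.eff Γ / Γ) / G.noise) /
      ((W n).utility G (p n) k / (W n).hSP k /
      ((G.infoBits : ℝ) / G.totalBits * G.rate * (G.eff Γ / Γ) / G.noise))
      = (WA n).utility G (pA n) k / (W n).utility G (p n) k / ((WA n).hSP k / (W n).hSP k) := by
    filter_upwards [(h.tendsto_hSP k).eventually_gt_atTop 0,
      (hA.tendsto_hSP k).eventually_gt_atTop 0] with n h1 h2
    have a3 := hf.target_pos hΓ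
    have a4 := hΓ.1
    have : 0 < (G.infoBits : ℝ) / G.totalBits * G.rate * (G.eff Γ / Γ) / G.noise := by positivity
    rw [div_div_div_cancel_right₀ this.ne']
    rw [div_div_div_eq, div_div_div_eq]
    congr 1; ring
  have h3 : Tendsto (fun n => N n * ((WA n).utility G (pA n) k / (W n).utility G (p n) k
      / ((WA n).hSP k / (W n).hSP k) - interferenceFactor K Γ Ψ ρ β (N n))) atTop (𝓝 0) := by
    have h4 := e1.sub e2
    rw [sub_self] at h4
    refine h4.congr' ?_
    filter_upwards [key] with n hn
    rw [hn]; ring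
  refine ⟨?_, h3⟩
  have h5 : Tendsto (fun n => (WA n).utility G (pA n) k / (W n).utility G (p n) k
      / ((WA n).hSP k / (W n).hSP k)) atTop (𝓝 1) :=
    (tendsto_one_of_expansion hN e1).congr' key
  have h6 := tendsto_one_of_expansion hN e2
  have h7 := (hm.mul h5).sub (h6.const_mul m)
  rw [sub_self] at h7
  refine h7.congr' ?_
  filter_upwards [(h.tendsto_hSP k).eventually_gt_atTop 0,
      (hA.tendsto_hSP k).eventually_gt_atTop 0] with n h1 h2
  congr 1
  rw [mul_div_cancel₀]
  positivity

/-! ### Riemann sums -/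

section Riemann

/-- The integrand is constant on each interval (k / l, (k + 1) / l), of length 1 / l. Sums thus
become integrals, to which dominated convergence applies. -/
lemma integral_floor_step (g : ℕ → ℝ) {l : ℝ} (hl : 0 < l) (m : ℕ) :
    ∫ y in (0 : ℝ)..(m : ℝ) / l, g ⌊l * y⌋₊ = (∑ b ∈ Finset.range m, g b) / l := by
  have hpiece : ∀ k : ℕ, ∀ y ∈ Set.Ioo ((k : ℝ) / l) (((k + 1 : ℕ) : ℝ) / l),
      g ⌊l * y⌋₊ = g k := by
    intro k y hy
    congr 1
    rw [Nat.floor_eq_iff]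
    · have h1 := hy.1; have h2 := hy.2
      rw [div_lt_iff₀ hl] at h1; rw [lt_div_iff₀ hl] at h2
      push_cast at h2
      constructor <;> nlinarith
    · have : 0 ≤ (k : ℝ) / l := by positivity
      exact mul_nonneg hl.le (this.trans hy.1.le)
  have hle : ∀ k : ℕ, (k : ℝ) / l ≤ ((k + 1 : ℕ) : ℝ) / l := fun k => by
    push_cast; gcongr; linarith
  have hint : ∀ k : ℕ, IntervalIntegrable (fun y => g ⌊l * y⌋₊) volume ((k : ℝ) / l)
      (((k + 1 : ℕ) : ℝ) / l) := by
    intro k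
    rw [intervalIntegrable_iff_integrableOn_Ioo_of_le (hle k)]
    exact (integrableOn_const (by simp) (C := g k)).congr_fun
      (fun y hy => (hpiece k y hy).symm) measurableSet_Ioo
  have h := intervalIntegral.sum_integral_adjacent_intervals (μ := volume)
    (f := fun y => g ⌊l * y⌋₊) (a := fun k : ℕ => (k : ℝ) / l) (n := m) (fun k _ => hint k)
  simp only [Nat.cast_zero, zero_div] at h
  rw [← h, Finset.sum_div]
  refine Finset.sum_congr rfl fun k _ => ?_
  rw [intervalIntegral.integral_of_le (hle k), integral_Ioc_eq_integral_Ioo,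
    setIntegral_congr_fun measurableSet_Ioo (hpiece k)]
  simp only [setIntegral_const, smul_eq_mul]
  rw [Measure.real, Real.volume_Ioo, ENNReal.toReal_ofReal (by linarith [hle k])]
  push_cast; field_simp; ring

/-- Convergence of Riemann sums of varying bounded functions. -/
lemma tendsto_riemann {L m : ℕ → ℕ} {c C : ℝ} {g : ℕ → ℕ → ℝ} {g' : ℝ → ℝ}
    (hL : Tendsto L atTop atTop) (hc : 0 ≤ c)
    (hm : Tendsto (fun n => (m n : ℝ) / L n) atTop (𝓝 c))
    (hC : ∀ᶠ n in atTop, ∀ b < m n, |g n b| ≤ C)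
    (hg : ∀ y, 0 < y → y < c → Tendsto (fun n => g n ⌊(L n : ℝ) * y⌋₊) atTop (𝓝 (g' y))) :
    Tendsto (fun n => (∑ b ∈ Finset.range (m n), g n b) / L n) atTop
      (𝓝 (∫ y in (0 : ℝ)..c, g' y)) := by
  have hL0 : ∀ᶠ n in atTop, (0 : ℝ) < L n :=
    (hL.eventually_gt_atTop 0).mono fun n h => by exact_mod_cast h
  -- The upper limit m / L varies with n. The fixed interval [0, c + 1] eventually contains it, and
  -- indicators encode the truncation.
  have hlim : Tendsto (fun n => ∫ y in (0 : ℝ)..(c + 1), {y | y ≤ (m n : ℝ) / L n}.indicator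
      (fun y => g n ⌊(L n : ℝ) * y⌋₊) y) atTop
      (𝓝 (∫ y in (0 : ℝ)..(c + 1), {y | y ≤ c}.indicator g' y)) := by
    refine intervalIntegral.tendsto_integral_filter_of_dominated_convergence (fun _ => max C 0)
      ?_ ?_ (by simp) ?_
    · refine Eventually.of_forall fun n => Measurable.aestronglyMeasurable ?_
      refine Measurable.indicator ?_ measurableSet_Iic
      exact measurable_from_nat.comp (Nat.measurable_floor.comp (measurable_const_mul _))
    · filter_upwards [hC, hL0] with n hn hl
      -- At y = m / L the floor is m itself, where no bound on `g` is available; this single point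
      -- is negligible.
      have hne : ∀ᵐ y : ℝ, y ≠ (m n : ℝ) / L n := by
        simp [ae_iff, measure_singleton]
      filter_upwards [hne] with y hy1 hy2
      rw [Set.uIoc_of_le (by linarith)] at hy2
      by_cases h : y ≤ (m n : ℝ) / L n
      · rw [Set.indicator_of_mem (show y ∈ {y | y ≤ (m n : ℝ) / L n} from h)]
        refine (hn _ ?_).trans (le_max_left _ _)
        rw [Nat.floor_lt (mul_nonneg hl.le hy2.1.le)]
        have := lt_of_le_of_ne h hy1
        rw [lt_div_iff₀ hl] at this
        linarith
      · rw [Set.indicator_of_notMem (show y ∉ {y | y ≤ (m n : ℝ) / L n} from h)]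
        simp
    · have hne : ∀ᵐ y : ℝ, y ≠ c := by simp [ae_iff, measure_singleton]
      filter_upwards [hne] with y hy1 hy2
      rw [Set.uIoc_of_le (by linarith)] at hy2
      rcases lt_or_gt_of_ne hy1 with h | h
      · rw [Set.indicator_of_mem (show y ∈ {y | y ≤ c} from h.le)]
        refine (hg y hy2.1 h).congr' ?_
        filter_upwards [hm.eventually (lt_mem_nhds h)] with n hn
        rw [Set.indicator_of_mem (show y ∈ {y | y ≤ (m n : ℝ) / L n} from hn.le)]
      · rw [Set.indicator_of_notMem (show y ∉ {y | y ≤ c} from not_le.2 h)]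
        refine tendsto_const_nhds.congr' ?_
        filter_upwards [hm.eventually (gt_mem_nhds h)] with n hn
        rw [Set.indicator_of_notMem (show y ∉ {y | y ≤ (m n : ℝ) / L n} from not_le.2 hn)]
  rw [intervalIntegral.integral_indicator ⟨hc, by linarith⟩] at hlim
  refine hlim.congr' ?_
  filter_upwards [hL0, hm.eventually (gt_mem_nhds (lt_add_one c))] with n hl hn
  rw [intervalIntegral.integral_indicator ⟨by positivity, hn.le⟩, integral_floor_step _ hl]

end Riemann

/-! ### Sums over an exponential power delay profile -/

section Profile

/-- The variance `Ψ ^ (-l / (L - 1))` of path `l + 1`, up to the factor of the user. -/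
noncomputable def profile (Ψ : ℝ) (L l : ℕ) : ℝ := Ψ ^ (-(l : ℝ) / ((L : ℝ) - 1))

lemma profile_pos {Ψ : ℝ} (hΨ : 0 < Ψ) (L l : ℕ) : 0 < profile Ψ L l := Real.rpow_pos_of_pos hΨ _

lemma profile_add {Ψ : ℝ} (hΨ : 0 < Ψ) (L a b : ℕ) :
    profile Ψ L (a + b) = profile Ψ L a * profile Ψ L b := by
  unfold profile
  rw [← Real.rpow_add hΨ]; congr 1; push_cast; ring

lemma profile_le {Ψ : ℝ} (hΨ : 0 < Ψ) {L l : ℕ} (hl : l < L) : profile Ψ L l ≤ max 1 Ψ⁻¹ := by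
  have h0 : (0 : ℝ) ≤ (l : ℝ) / ((L : ℝ) - 1) := by
    have : (1 : ℝ) ≤ L := by exact_mod_cast (by omega : 1 ≤ L)
    exact div_nonneg (by positivity) (by linarith)
  have h1 : (l : ℝ) / ((L : ℝ) - 1) ≤ 1 := by
    have : (l : ℝ) + 1 ≤ L := by exact_mod_cast hl
    exact div_le_one_of_le₀ (by linarith) (by have : (0:ℝ) ≤ l := by positivity
                                              linarith)
  unfold profile
  rw [neg_div, Real.rpow_neg hΨ.le, ← Real.inv_rpow hΨ.le]
  rcases le_total Ψ⁻¹ 1 with h | h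
  · exact (Real.rpow_le_one (by positivity) h h0).trans (le_max_left _ _)
  · calc Ψ⁻¹ ^ ((l : ℝ) / ((L : ℝ) - 1)) ≤ Ψ⁻¹ ^ (1 : ℝ) := Real.rpow_le_rpow_of_exponent_le h h1
      _ ≤ _ := by rw [Real.rpow_one]; exact le_max_right _ _

lemma tendsto_profile {Ψ : ℝ} (hΨ : 0 < Ψ) {L a : ℕ → ℕ} {y : ℝ} (hL : Tendsto L atTop atTop)
    (ha : Tendsto (fun n => (a n : ℝ) / L n) atTop (𝓝 y)) :
    Tendsto (fun n => profile Ψ (L n) (a n)) atTop (𝓝 (Real.exp (-(Real.log Ψ * y)))) := by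
  have hLr : Tendsto (fun n => (L n : ℝ)) atTop atTop := tendsto_natCast_atTop_atTop.comp hL
  have h1 : Tendsto (fun n => 1 - 1 / (L n : ℝ)) atTop (𝓝 1) := by
    have := (tendsto_const_nhds (x := (1 : ℝ))).sub
      ((tendsto_const_nhds (x := (1 : ℝ))).div_atTop hLr)
    rwa [sub_zero] at this
  have h2 := (ha.div h1 one_ne_zero).const_mul (-(Real.log Ψ))
  rw [div_one] at h2
  have h3 := (Real.continuous_exp.tendsto _).comp h2
  rw [neg_mul] at h3
  refine h3.congr' ?_
  filter_upwards [hLr.eventually_gt_atTop 1] with n hn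
  simp only [Function.comp, Pi.div_apply]
  unfold profile
  rw [Real.rpow_def_of_pos hΨ]
  congr 1
  have : (L n : ℝ) - 1 ≠ 0 := by linarith
  have h4 : (L n : ℝ) ≠ 0 := by linarith
  have : 1 - 1 / (L n : ℝ) = (L n - 1) / L n := by field_simp
  rw [this]
  field_simp

lemma tendsto_floor_div {L : ℕ → ℕ} (hL : Tendsto L atTop atTop) {y : ℝ} (hy : 0 ≤ y) :
    Tendsto (fun n => (⌊(L n : ℝ) * y⌋₊ : ℝ) / L n) atTop (𝓝 y) := by
  have hLr : Tendsto (fun n => (L n : ℝ)) atTop atTop := tendsto_natCast_atTop_atTop.comp hL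
  have := (tendsto_nat_floor_mul_div_atTop hy).comp hLr
  refine this.congr fun n => ?_
  simp only [Function.comp, mul_comm]

/-- `∫₀ᶜ Ψ^(-y) dy` with `s = log Ψ`. -/
noncomputable def energyInt (s c : ℝ) : ℝ := ∫ y in (0 : ℝ)..c, Real.exp (-(s * y))

/-- `∬ min (t / β) 1 * Ψ^(-y) * Ψ^(-(y + t))` over `t, y ≥ 0`, `t + y ≤ c`, with `s = log Ψ`. -/
noncomputable def lagInt (s β c : ℝ) : ℝ :=
  ∫ t in (0 : ℝ)..c, min (t / β) 1 * ∫ y in (0 : ℝ)..(c - t), Real.exp (-(s * (t + 2 * y)))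

/-- The squared entries `min (d, N_c) / N_c` of `Φ` at lag `d = L - l`. -/
noncomputable def lagWeight (Nc d : ℕ) : ℝ := ((min d Nc : ℕ) : ℝ) / Nc

lemma lagWeight_nonneg (Nc d : ℕ) : 0 ≤ lagWeight Nc d := by unfold lagWeight; positivity

lemma lagWeight_le_one (Nc d : ℕ) : lagWeight Nc d ≤ 1 :=
  div_le_one_of_le₀ (by exact_mod_cast min_le_right _ _) (by positivity)

lemma tendsto_energy {Ψ : ℝ} (hΨ : 0 < Ψ) {L m : ℕ → ℕ} {c : ℝ} (hL : Tendsto L atTop atTop)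
    (hc : 0 ≤ c) (hmL : ∀ n, m n ≤ L n) (hm : Tendsto (fun n => (m n : ℝ) / L n) atTop (𝓝 c)) :
    Tendsto (fun n => (∑ a ∈ Finset.range (m n), profile Ψ (L n) a) / L n) atTop
      (𝓝 (energyInt (Real.log Ψ) c)) := by
  refine tendsto_riemann (C := max 1 Ψ⁻¹) hL hc hm (Eventually.of_forall fun n b hb => ?_) ?_
  · rw [abs_of_pos (profile_pos hΨ _ _)]
    exact profile_le hΨ (hb.trans_le (hmL n))
  · intro y hy _
    exact tendsto_profile hΨ hL (tendsto_floor_div hL hy.le)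

/-- Change of variables to the lag d = a - b. Because `w 0 = 0`, the lag 0 may be added freely. -/
lemma sum_triangle_eq (m : ℕ) (w : ℕ → ℝ) (hw : w 0 = 0) (F : ℕ → ℕ → ℝ) :
    ∑ a ∈ Finset.range m, ∑ b ∈ Finset.range a, w (a - b) * F a b =
      ∑ d ∈ Finset.range m, ∑ b ∈ Finset.range (m - d), w d * F (b + d) b := by
  rw [← Finset.sum_range_diag_flip m fun d b => w d * F (b + d) b]
  refine Finset.sum_congr rfl fun a _ => ?_
  have h1 : ∑ b ∈ Finset.range a, w (a - b) * F a b
      = ∑ b ∈ Finset.range (a + 1), w (a - b) * F a b := by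
    rw [Finset.sum_range_succ, Nat.sub_self, hw, zero_mul, add_zero]
  rw [h1, ← Finset.sum_flip (fun b => w (a - b) * F a b)]
  refine Finset.sum_congr rfl fun k hk => ?_
  have : k ≤ a := by simpa [Nat.lt_succ_iff] using hk
  rw [Nat.sub_sub_self this, Nat.sub_add_cancel this]

lemma tendsto_lag {Ψ : ℝ} (hΨ : 0 < Ψ) {L m Nc : ℕ → ℕ} {c β : ℝ} (hL : Tendsto L atTop atTop)
    (hc : 0 ≤ c) (hβ : 0 < β) (hmL : ∀ n, m n ≤ L n)
    (hm : Tendsto (fun n => (m n : ℝ) / L n) atTop (𝓝 c)) (hNc : ∀ n, (Nc n : ℝ) = β * L n) :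
    Tendsto (fun n => (∑ a ∈ Finset.range (m n), ∑ b ∈ Finset.range a,
      lagWeight (Nc n) (a - b) * (profile Ψ (L n) a * profile Ψ (L n) b)) / (L n : ℝ) ^ 2) atTop
      (𝓝 (lagInt (Real.log Ψ) β c)) := by
  set M := max 1 Ψ⁻¹ with hM
  have hM0 : 0 ≤ M := zero_le_one.trans (le_max_left _ _)
  have hL0 : ∀ᶠ n in atTop, (0 : ℝ) < L n :=
    (hL.eventually_gt_atTop 0).mono fun n h => by exact_mod_cast h
  have key : Tendsto (fun n => (∑ d ∈ Finset.range (m n), lagWeight (Nc n) d *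
      ((∑ b ∈ Finset.range (m n - d), profile Ψ (L n) (b + d) * profile Ψ (L n) b) / L n)) / L n)
      atTop (𝓝 (lagInt (Real.log Ψ) β c)) := by
    -- The outer Riemann sum runs over the lag. Its term contains an inner Riemann sum over b, which
    -- has at most L terms, each bounded by M².
    refine tendsto_riemann (C := 1 * (M * M)) hL hc hm ?_ ?_
    · filter_upwards [hL0] with n hl d hd
      have hsum : ∑ b ∈ Finset.range (m n - d), profile Ψ (L n) (b + d) * profile Ψ (L n) b
          ≤ L n * (M * M) := by
        calc _ ≤ ∑ b ∈ Finset.range (m n - d), M * M := by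
              refine Finset.sum_le_sum fun b hb => ?_
              have hb' := Finset.mem_range.1 hb
              have := hmL n
              exact mul_le_mul (profile_le hΨ (by omega)) (profile_le hΨ (by omega))
                (profile_pos hΨ _ _).le hM0
          _ = ((m n - d : ℕ) : ℝ) * (M * M) := by simp
          _ ≤ _ := by
              have : m n - d ≤ L n := (Nat.sub_le _ _).trans (hmL n)
              gcongr
      have hnn : 0 ≤ ∑ b ∈ Finset.range (m n - d), profile Ψ (L n) (b + d) * profile Ψ (L n) b :=
        Finset.sum_nonneg fun b _ => mul_nonneg (profile_pos hΨ _ _).le (profile_pos hΨ _ _).le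
      rw [abs_of_nonneg (mul_nonneg (lagWeight_nonneg _ _) (by positivity))]
      refine mul_le_mul (lagWeight_le_one _ _) ?_ (by positivity) zero_le_one
      rw [div_le_iff₀ hl]; linarith
    · intro x hx hxc
      have hfl := tendsto_floor_div hL hx.le
      refine Tendsto.mul ?_ ?_
      · have h1 : Tendsto (fun n => min ((⌊(L n : ℝ) * x⌋₊ : ℝ) / L n / β) 1) atTop
            (𝓝 (min (x / β) 1)) := (hfl.div_const β).min tendsto_const_nhds
        refine h1.congr' ?_
        filter_upwards [hL0] with n hl
        unfold lagWeight
        have hNpos : (0 : ℝ) < Nc n := by rw [hNc]; positivity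
        rw [Nat.cast_min, ← min_div_div_right hNpos.le, div_self hNpos.ne', div_div, hNc,
          mul_comm β]
      · refine tendsto_riemann (C := M * M) hL (by linarith) ?_ ?_ ?_
        · refine (hm.sub hfl).congr' ?_
          filter_upwards [hL0, (hm.sub hfl).eventually (lt_mem_nhds (sub_pos.2 hxc))] with n hl hn
          have : ⌊(L n : ℝ) * x⌋₊ ≤ m n := by
            rw [← sub_div, div_pos_iff_of_pos_right hl, sub_pos] at hn
            exact_mod_cast hn.le
          rw [Nat.cast_sub this, sub_div]
        · refine Eventually.of_forall fun n b hb => ?_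
          have := hmL n
          rw [abs_of_pos (mul_pos (profile_pos hΨ _ _) (profile_pos hΨ _ _))]
          exact mul_le_mul (profile_le hΨ (by omega)) (profile_le hΨ (by omega))
                (profile_pos hΨ _ _).le hM0
        · intro y hy _
          have hfy := tendsto_floor_div hL hy.le
          have h1 := tendsto_profile hΨ hL hfy
          have h2 : Tendsto (fun n => profile Ψ (L n) (⌊(L n : ℝ) * y⌋₊ + ⌊(L n : ℝ) * x⌋₊)) atTop
              (𝓝 (Real.exp (-(Real.log Ψ * (y + x))))) := by
            refine tendsto_profile hΨ hL ((hfy.add hfl).congr fun n => ?_)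
            push_cast; rw [add_div]
          have h3 := h2.mul h1
          rw [← Real.exp_add] at h3
          have e : -(Real.log Ψ * (y + x)) + -(Real.log Ψ * y) = -(Real.log Ψ * (x + 2 * y)) := by
            ring
          rwa [e] at h3
  refine key.congr fun n => ?_
  rw [sum_triangle_eq _ _ (by simp [lagWeight])
    (fun a b => profile Ψ (L n) a * profile Ψ (L n) b), sq, ← div_div]
  congr 1
  rw [Finset.sum_div]
  refine Finset.sum_congr rfl fun d _ => ?_
  rw [← Finset.mul_sum, mul_div_assoc]

end Profile

/-! ### The limiting functions as integrals -/

section ClosedForms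

open Real

lemma energyInt_eq {s : ℝ} (hs : s ≠ 0) (c : ℝ) : energyInt s c = (1 - exp (-(s * c))) / s := by
  unfold energyInt
  have h : ∀ y ∈ Set.uIcc 0 c, HasDerivAt (fun y => -exp (-(s * y)) / s) (exp (-(s * y))) y := by
    intro y _
    have h1 : HasDerivAt (fun y => -(s * y)) (-(s * 1)) y := ((hasDerivAt_id y).const_mul s).neg
    refine HasDerivAt.congr_deriv (h1.exp.neg.div_const s) ?_
    field_simp
  rw [intervalIntegral.integral_eq_sub_of_hasDerivAt h 
    ((by fun_prop : Continuous fun y => exp (-(s * y))).intervalIntegrable _ _)]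
  simp
  field_simp; ring

lemma energyInt_pos (s : ℝ) {c : ℝ} (hc : 0 < c) : 0 < energyInt s c :=
  intervalIntegral.intervalIntegral_pos_of_pos
    ((by fun_prop : Continuous fun y => exp (-(s * y))).intervalIntegrable _ _)
    (fun _ => exp_pos _) hc

lemma lag_inner {s : ℝ} (hs : s ≠ 0) (c t : ℝ) :
    ∫ y in (0 : ℝ)..(c - t), exp (-(s * (t + 2 * y)))
      = (exp (-(s * t)) - exp (s * t) * exp (-(s * c)) ^ 2) / (2 * s) := by
  have h : ∀ y ∈ Set.uIcc 0 (c - t),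
      HasDerivAt (fun y => -exp (-(s * (t + 2 * y))) / (2 * s)) (exp (-(s * (t + 2 * y)))) y := by
    intro y _
    have h1 : HasDerivAt (fun y => -(s * (t + 2 * y))) (-(s * (2 * 1))) y :=
      ((((hasDerivAt_id y).const_mul 2).const_add t).const_mul s).neg
    refine HasDerivAt.congr_deriv (h1.exp.neg.div_const (2 * s)) ?_
    field_simp
  rw [intervalIntegral.integral_eq_sub_of_hasDerivAt h
    ((by fun_prop : Continuous fun y => exp (-(s * (t + 2 * y)))).intervalIntegrable _ _)]
  rw [← exp_nat_mul, ← exp_add]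
  simp only [mul_zero, add_zero]
  rw [← sub_div, neg_sub_neg]
  congr 3
  push_cast; ring

/-- Antiderivative of the part of the integrand beyond the saturation of the weight. -/
lemma integral_lag_const {s : ℝ} (hs : s ≠ 0) (E a b : ℝ) :
    ∫ t in a..b, (exp (-(s * t)) - exp (s * t) * E) / (2 * s)
      = ((-exp (-(s * b)) - exp (s * b) * E) - (-exp (-(s * a)) - exp (s * a) * E))
          / (2 * s ^ 2) := by
  have h : ∀ y ∈ Set.uIcc a b,
      HasDerivAt (fun t => (-exp (-(s * t)) - exp (s * t) * E) / (2 * s ^ 2))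
        ((exp (-(s * y)) - exp (s * y) * E) / (2 * s)) y := by
    intro y _
    have h0 : HasDerivAt (fun y => s * y) (s * 1) y := (hasDerivAt_id y).const_mul s
    refine HasDerivAt.congr_deriv
      (((h0.fun_neg.exp.fun_neg).fun_sub (h0.exp.mul_const E)).div_const (2 * s ^ 2)) ?_
    field_simp
  rw [intervalIntegral.integral_eq_sub_of_hasDerivAt h
    ((by fun_prop : Continuous fun t => (exp (-(s * t)) - exp (s * t) * E) / (2 * s)).intervalIntegrable _ _)]
  ring

lemma integral_lag_linear {s : ℝ} (hs : s ≠ 0) (E b : ℝ) :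
    ∫ t in (0 : ℝ)..b, t * ((exp (-(s * t)) - exp (s * t) * E) / (2 * s))
      = ((-(s * b + 1) * exp (-(s * b)) - (s * b - 1) * exp (s * b) * E) - (-1 + E))
          / (2 * s ^ 3) := by
  have h : ∀ y ∈ Set.uIcc 0 b,
      HasDerivAt (fun t => (-(s * t + 1) * exp (-(s * t)) - (s * t - 1) * exp (s * t) * E)
        / (2 * s ^ 3)) (y * ((exp (-(s * y)) - exp (s * y) * E) / (2 * s))) y := by
    intro y _
    have h0 : HasDerivAt (fun y => s * y) (s * 1) y := (hasDerivAt_id y).const_mul s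
    refine HasDerivAt.congr_deriv (((((h0.add_const 1).fun_neg).fun_mul h0.fun_neg.exp).fun_sub
      (((h0.sub_const 1).fun_mul h0.exp).mul_const E)).div_const (2 * s ^ 3)) ?_
    field_simp; ring
  rw [intervalIntegral.integral_eq_sub_of_hasDerivAt h
    ((by fun_prop : Continuous fun t => t * ((exp (-(s * t)) - exp (s * t) * E) / (2 * s))).intervalIntegrable _ _)]
  simp
  ring

/-- The weight is t / β up to min(β, c) and 1 from there on, and both pieces have elementary
antiderivatives. Stating the result with min(β, c) covers saturation before and after c at once. -/
lemma lagInt_eq {s β c : ℝ} (hs : s ≠ 0) (hβ : 0 < β) (hc : 0 ≤ c) :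
    lagInt s β c = (1 - exp (-(s * c)) ^ 2 - 2 * min β c * s * exp (-(s * c))
      - exp (-(s * min β c)) + exp (s * min β c) * exp (-(s * c)) ^ 2) / (2 * s ^ 3 * β) := by
  unfold lagInt
  simp only [lag_inner hs]
  set E := exp (-(s * c)) ^ 2 with hE
  have hEc : exp (s * c) * E = exp (-(s * c)) := by
    rw [hE, sq, ← mul_assoc, ← exp_add]; simp
  have hb0 : 0 ≤ min β c := le_min hβ.le hc
  have hcont : Continuous fun t => min (t / β) 1 * ((exp (-(s * t)) - exp (s * t) * E) / (2 * s)) := by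
    fun_prop
  rw [← intervalIntegral.integral_add_adjacent_intervals (b := min β c)
    (hcont.intervalIntegrable _ _) (hcont.intervalIntegrable _ _)]
  have e1 : ∫ t in (0 : ℝ)..(min β c), min (t / β) 1 * ((exp (-(s * t)) - exp (s * t) * E) / (2 * s))
      = (∫ t in (0 : ℝ)..(min β c), t * ((exp (-(s * t)) - exp (s * t) * E) / (2 * s))) / β := by
    rw [← intervalIntegral.integral_div]
    refine intervalIntegral.integral_congr fun t ht => ?_
    rw [Set.uIcc_of_le hb0] at ht
    have : t / β ≤ 1 := div_le_one_of_le₀ (ht.2.trans (min_le_left _ _)) hβ.le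
    simp only [min_eq_left this]
    ring
  have e2 : ∫ t in (min β c)..c, min (t / β) 1 * ((exp (-(s * t)) - exp (s * t) * E) / (2 * s))
      = ∫ t in (min β c)..c, (exp (-(s * t)) - exp (s * t) * E) / (2 * s) := by
    refine intervalIntegral.integral_congr fun t ht => ?_
    rw [Set.uIcc_of_le (min_le_right _ _)] at ht
    rcases le_total β c with h | h
    · rw [min_eq_left h] at ht
      have : 1 ≤ t / β := by rw [le_div_iff₀ hβ]; linarith [ht.1]
      simp only [min_eq_right this, one_mul]
    -- Here the interval is the single point c, where the inner integral vanishes.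
    · rw [min_eq_right h] at ht
      have : t = c := le_antisymm ht.2 ht.1
      simp only [this, hEc, sub_self, zero_div, mul_zero]
  rw [e1, e2, integral_lag_linear hs, integral_lag_const hs, hEc]
  rcases le_total β c with h | h
  · rw [min_eq_left h]
    field_simp; ring
  · rw [min_eq_right h]
    simp only [mul_assoc, hEc]
    field_simp; ring

/-- `ν` as an integral, for every `Ψ > 0` (with `s = log Ψ`). -/
noncomputable def nuInt (s ρ β : ℝ) : ℝ :=
  (3 * lagInt s β ρ + lagInt s β 1 - exp (-(s * ρ)) ^ 2 * lagInt s β (1 - ρ)) / energyInt s ρ ^ 2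

lemma continuous_energyInt : Continuous fun q : ℝ × ℝ => energyInt q.1 q.2 := by
  unfold energyInt
  exact intervalIntegral.continuous_parametric_intervalIntegral_of_continuous
    (f := fun (q : ℝ × ℝ) y => exp (-(q.1 * y))) (by fun_prop) continuous_snd

lemma continuous_lagInt (β : ℝ) : Continuous fun q : ℝ × ℝ => lagInt q.1 β q.2 := by
  unfold lagInt
  have h : Continuous fun x : (ℝ × ℝ) × ℝ =>
      ∫ y in (0 : ℝ)..(x.1.2 - x.2), exp (-(x.1.1 * (x.2 + 2 * y))) :=
    intervalIntegral.continuous_parametric_intervalIntegral_of_continuous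
      (f := fun (x : (ℝ × ℝ) × ℝ) y => exp (-(x.1.1 * (x.2 + 2 * y)))) (by fun_prop) (by fun_prop)
  refine intervalIntegral.continuous_parametric_intervalIntegral_of_continuous
    (f := fun (q : ℝ × ℝ) t => min (t / β) 1 *
      ∫ y in (0 : ℝ)..(q.2 - t), exp (-(q.1 * (t + 2 * y)))) ?_ continuous_snd
  exact Continuous.mul (by fun_prop) h

/-- Joint continuity, including s = 0, serves twice: in s it identifies the extension to Ψ = 1, in ρ
it gives the limit ρ → 1. -/
lemma continuousAt_nuInt {s ρ : ℝ} (β : ℝ) (hρ : 0 < ρ) :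
    ContinuousAt (fun q : ℝ × ℝ => nuInt q.1 q.2 β) (s, ρ) := by
  unfold nuInt
  have h1 := continuous_lagInt β
  have h2 : Continuous fun q : ℝ × ℝ => lagInt q.1 β 1 := h1.comp (by fun_prop :
    Continuous fun q : ℝ × ℝ => (q.1, (1 : ℝ)))
  have h3 : Continuous fun q : ℝ × ℝ => lagInt q.1 β (1 - q.2) := h1.comp (by fun_prop :
    Continuous fun q : ℝ × ℝ => (q.1, 1 - q.2))
  have h4 := continuous_energyInt
  refine ContinuousAt.div ?_ ?_ (pow_pos (energyInt_pos s hρ) 2).ne'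
  · exact (by fun_prop : Continuous _).continuousAt
  · exact (by fun_prop : Continuous _).continuousAt

lemma exp_neg_log_mul {Ψ : ℝ} (hΨ : 0 < Ψ) (c : ℝ) : exp (-(log Ψ * c)) = (Ψ ^ c)⁻¹ := by
  rw [exp_neg, rpow_def_of_pos hΨ]

lemma exp_log_mul' {Ψ : ℝ} (hΨ : 0 < Ψ) (c : ℝ) : exp (log Ψ * c) = Ψ ^ c := by
  rw [rpow_def_of_pos hΨ]

lemma rpow_ne_one {Ψ ρ : ℝ} (hΨ : 0 < Ψ) (hΨ1 : Ψ ≠ 1) (hρ : 0 < ρ) : Ψ ^ ρ - 1 ≠ 0 := by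
  rw [sub_ne_zero]
  intro h
  have h2 := congrArg log h
  rw [log_rpow hΨ, log_one] at h2
  exact mul_ne_zero hρ.ne' (log_ne_zero_of_pos_of_ne_one hΨ hΨ1) h2

lemma mu_formula_eq {Ψ ρ : ℝ} (hΨ : 0 < Ψ) (hΨ1 : Ψ ≠ 1) (hρ : 0 < ρ) :
    (Ψ - 1) * Ψ ^ (ρ - 1) / (Ψ ^ ρ - 1) = energyInt (log Ψ) 1 / energyInt (log Ψ) ρ := by
  have hs : log Ψ ≠ 0 := log_ne_zero_of_pos_of_ne_one hΨ hΨ1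
  rw [energyInt_eq hs, energyInt_eq hs, exp_neg_log_mul hΨ, exp_neg_log_mul hΨ, rpow_one,
    rpow_sub hΨ, rpow_one]
  have h1 := rpow_ne_one hΨ hΨ1 hρ
  have h2 : Ψ ^ ρ ≠ 0 := (rpow_pos_of_pos hΨ ρ).ne'
  have h3 : 1 - (Ψ ^ ρ)⁻¹ ≠ 0 := by
    intro h
    apply h1
    field_simp at h
    linarith
  field_simp

/-- The integral form contains `lagInt` at ρ, 1 and 1 - ρ. The cases of ν record which of these
numbers lie below β; in each case the two sides are the same rational function of Ψ, Ψ^ρ, Ψ^β and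
log Ψ, apart from explicit factors ρ and β. -/
lemma nuFormula_eq {Ψ ρ β : ℝ} (hΨ : 0 < Ψ) (hΨ1 : Ψ ≠ 1) (hρ : 0 < ρ) (hρ1 : ρ ≤ 1)
    (hβ : 0 < β) : nuFormula Ψ ρ β = nuInt (log Ψ) ρ β := by
  have hs : log Ψ ≠ 0 := log_ne_zero_of_pos_of_ne_one hΨ hΨ1
  have h1 := rpow_ne_one hΨ hΨ1 hρ
  have hx0 : Ψ ^ ρ ≠ 0 := (rpow_pos_of_pos hΨ ρ).ne'
  have hy0 : Ψ ^ β ≠ 0 := (rpow_pos_of_pos hΨ β).ne'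
  have e1 : Ψ ^ (2 * ρ) = (Ψ ^ ρ) ^ 2 := by rw [mul_comm, rpow_mul hΨ.le, rpow_two]
  have e2 : Ψ ^ (2 * β) = (Ψ ^ β) ^ 2 := by rw [mul_comm, rpow_mul hΨ.le, rpow_two]
  have e3 : Ψ ^ (2 : ℝ) = Ψ ^ 2 := rpow_two Ψ
  unfold nuInt nuFormula
  rw [lagInt_eq hs hβ hρ.le, lagInt_eq hs hβ zero_le_one, lagInt_eq hs hβ (sub_nonneg.2 hρ1),
    energyInt_eq hs]
  simp only [exp_neg_log_mul hΨ, exp_log_mul' hΨ, mul_add, rpow_add hΨ, rpow_one, e1, e2, e3]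
  have e4 : Ψ ^ (1 - ρ) = Ψ / Ψ ^ ρ := by rw [rpow_sub hΨ, rpow_one]
  rw [e4]
  have h3 : 1 - (Ψ ^ ρ)⁻¹ ≠ 0 := by
    intro h
    apply h1
    field_simp at h
    linarith
  have key : (1 - (Ψ ^ ρ)⁻¹) = (Ψ ^ ρ - 1) / Ψ ^ ρ := by field_simp
  rw [key]
  split_ifs with c1 c2 c3 c4
  · have a1 : β ≤ ρ := c1.trans (min_le_left _ _)
    have a2 : β ≤ 1 - ρ := c1.trans (min_le_right _ _)
    rw [min_eq_left a1, min_eq_left a2, min_eq_left (by linarith : β ≤ 1)]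
    generalize Ψ ^ ρ = x at *
    generalize Ψ ^ β = y at *
    generalize log Ψ = s at *
    field_simp
    ring
  · rw [min_eq_right c2.1, min_eq_left c2.2, min_eq_left (by linarith : β ≤ 1)]
    generalize Ψ ^ ρ = x at *
    generalize Ψ ^ β = y at *
    generalize log Ψ = s at *
    field_simp
    ring
  · rw [min_eq_left c3.2, min_eq_right c3.1, min_eq_left (by linarith : β ≤ 1), e4]
    generalize Ψ ^ ρ = x at *
    generalize Ψ ^ β = y at *
    generalize log Ψ = s at *
    field_simp
    ring
  -- The failure of the first three conditions leaves only β above both ρ and 1 - ρ.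
  · have a : ρ < β ∧ 1 - ρ < β := by
      rw [le_min_iff, not_and_or, not_le, not_le] at c1
      constructor
      · by_contra h
        rw [not_lt] at h
        rcases c1 with c | c
        · linarith
        · exact c3 ⟨c.le, h⟩
      · by_contra h
        rw [not_lt] at h
        rcases c1 with c | c
        · exact c2 ⟨c.le, h⟩
        · linarith
    rw [min_eq_right a.1.le, min_eq_right a.2.le, min_eq_left c4, e4]
    generalize Ψ ^ ρ = x at *
    generalize Ψ ^ β = y at *
    generalize log Ψ = s at *
    field_simp
    ring
  · rw [not_le] at c4
    rw [min_eq_right (by linarith : ρ ≤ β), min_eq_right (by linarith : 1 - ρ ≤ β),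
      min_eq_right c4.le, e4, rpow_one]
    generalize Ψ ^ ρ = x at *
    generalize Ψ ^ β = y at *
    generalize log Ψ = s at *
    field_simp
    ring

lemma nuAFormula_eq {Ψ β : ℝ} (hΨ : 0 < Ψ) (hΨ1 : Ψ ≠ 1) (hβ : 0 < β) :
    nuAFormula Ψ β = nuInt (log Ψ) 1 β := by
  have hs : log Ψ ≠ 0 := log_ne_zero_of_pos_of_ne_one hΨ hΨ1
  have h1 : Ψ - 1 ≠ 0 := sub_ne_zero.2 hΨ1
  have hy0 : Ψ ^ β ≠ 0 := (rpow_pos_of_pos hΨ β).ne'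
  have h0 : lagInt (log Ψ) β (1 - 1) = 0 := by
    unfold lagInt; rw [sub_self, intervalIntegral.integral_same]
  unfold nuInt nuAFormula
  rw [h0, lagInt_eq hs hβ zero_le_one, energyInt_eq hs]
  simp only [exp_neg_log_mul hΨ, exp_log_mul' hΨ, rpow_sub hΨ, rpow_two, rpow_one]
  have key : (1 - Ψ⁻¹) = (Ψ - 1) / Ψ := by field_simp
  rw [key]
  split_ifs with c1
  · rw [min_eq_left c1]
    generalize Ψ ^ β = y at *
    generalize log Ψ = s at *
    field_simp
    ring
  · rw [min_eq_right (not_le.1 c1).le, rpow_one]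
    generalize log Ψ = s at *
    field_simp
    ring

lemma extendOne_eq {g h : ℝ → ℝ} (hgh : ∀ x, 0 < x → x ≠ 1 → g x = h x) (hc : ContinuousAt h 1)
    {Ψ : ℝ} (hΨ : 0 < Ψ) : extendOne g Ψ = h Ψ := by
  unfold extendOne
  split_ifs with h1
  · rw [h1]
    refine Tendsto.limUnder_eq ?_
    refine (hc.tendsto.mono_left nhdsWithin_le_nhds).congr' ?_
    filter_upwards [self_mem_nhdsWithin, nhdsWithin_le_nhds (lt_mem_nhds one_pos)] with x hx hx0
    exact (hgh x hx0 hx).symm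
  · exact hgh Ψ hΨ h1

lemma mu_eq {Ψ ρ : ℝ} (hΨ : 0 < Ψ) (hρ : 0 < ρ) :
    mu Ψ ρ = energyInt (log Ψ) 1 / energyInt (log Ψ) ρ := by
  refine extendOne_eq (h := fun Ψ => energyInt (log Ψ) 1 / energyInt (log Ψ) ρ)
    (fun x hx hx1 => mu_formula_eq hx hx1 hρ) ?_ hΨ
  have h1 : ∀ c, ContinuousAt (fun x => energyInt (log x) c) 1 := fun c =>
    (continuous_energyInt.comp (by fun_prop : Continuous fun s : ℝ => (s, c))).continuousAt.comp
      (continuousAt_log one_ne_zero)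
  exact (h1 1).div (h1 ρ) (energyInt_pos _ hρ).ne'

lemma continuousAt_nuInt_log {ρ : ℝ} (β : ℝ) (hρ : 0 < ρ) :
    ContinuousAt (fun x => nuInt (log x) ρ β) 1 :=
  ContinuousAt.comp (f := fun x => (log x, ρ)) (g := fun q : ℝ × ℝ => nuInt q.1 q.2 β)
    (continuousAt_nuInt β hρ) ((continuousAt_log one_ne_zero).prodMk continuousAt_const)

lemma nu_eq {Ψ ρ β : ℝ} (hΨ : 0 < Ψ) (hρ : 0 < ρ) (hρ1 : ρ ≤ 1) (hβ : 0 < β) :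
    nu Ψ ρ β = nuInt (log Ψ) ρ β :=
  extendOne_eq (h := fun Ψ => nuInt (log Ψ) ρ β)
    (fun _ hx hx1 => nuFormula_eq hx hx1 hρ hρ1 hβ) (continuousAt_nuInt_log β hρ) hΨ

lemma nuA_eq {Ψ β : ℝ} (hΨ : 0 < Ψ) (hβ : 0 < β) : nuA Ψ β = nuInt (log Ψ) 1 β :=
  extendOne_eq (h := fun Ψ => nuInt (log Ψ) 1 β)
    (fun _ hx hx1 => nuAFormula_eq hx hx1 hβ) (continuousAt_nuInt_log β one_pos) hΨ

lemma nu_one {Ψ β : ℝ} (hΨ : 0 < Ψ) (hβ : 0 < β) : nu Ψ 1 β = nuA Ψ β := by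
  rw [nu_eq hΨ one_pos le_rfl hβ, nuA_eq hΨ hβ]

lemma mu_one {Ψ : ℝ} (hΨ : 0 < Ψ) : mu Ψ 1 = muA Ψ := by
  rw [mu_eq hΨ one_pos, div_self (energyInt_pos _ one_pos).ne', muA]

lemma tendsto_mu {Ψ : ℝ} (hΨ : 0 < Ψ) : Tendsto (fun r => mu Ψ r) (𝓝[<] 1) (𝓝 (muA Ψ)) := by
  rw [← mu_one hΨ, mu_eq hΨ one_pos]
  have h : ContinuousAt (fun r => energyInt (log Ψ) 1 / energyInt (log Ψ) r) 1 :=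
    continuousAt_const.div (continuous_energyInt.comp
      (by fun_prop : Continuous fun r : ℝ => (log Ψ, r))).continuousAt (energyInt_pos _ one_pos).ne'
  refine (h.tendsto.mono_left nhdsWithin_le_nhds).congr' ?_
  filter_upwards [nhdsWithin_le_nhds (lt_mem_nhds one_pos)] with r hr
  exact (mu_eq hΨ hr).symm

lemma tendsto_nu {Ψ β : ℝ} (hΨ : 0 < Ψ) (hβ : 0 < β) :
    Tendsto (fun r => nu Ψ r β) (𝓝[<] 1) (𝓝 (nuA Ψ β)) := by
  rw [nuA_eq hΨ hβ]
  have h : ContinuousAt (fun r => nuInt (log Ψ) r β) 1 :=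
    ContinuousAt.comp (f := fun r => (log Ψ, r)) (g := fun q : ℝ × ℝ => nuInt q.1 q.2 β)
      (continuousAt_nuInt β one_pos) (continuousAt_const.prodMk continuousAt_id)
  refine (h.tendsto.mono_left nhdsWithin_le_nhds).congr' ?_
  filter_upwards [self_mem_nhdsWithin, nhdsWithin_le_nhds (lt_mem_nhds one_pos)] with r hr hr0
  exact (nu_eq hΨ hr0 (le_of_lt hr) hβ).symm

end ClosedForms

/-! ### Fourth moments of martingale transforms -/

section FourthMoment

variable {Ω : Type*} {mΩ : MeasurableSpace Ω} {P : Measure Ω}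

/-- `f` is measurable and `E ‖f‖ ^ 4 ≤ C`. -/
structure HasFourthMoment (P : Measure Ω) (f : Ω → ℂ) (C : ℝ) : Prop where
  meas : Measurable f
  int : Integrable (fun ω => ‖f ω‖ ^ 4) P
  le : ∫ ω, ‖f ω‖ ^ 4 ∂P ≤ C

namespace HasFourthMoment

variable {f g : Ω → ℂ} {C D : ℝ}

lemma nonneg (hf : HasFourthMoment P f C) : 0 ≤ C :=
  (integral_nonneg fun _ => by positivity).trans hf.le

lemma mono (hf : HasFourthMoment P f C) (h : C ≤ D) : HasFourthMoment P f D :=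
  ⟨hf.meas, hf.int, hf.le.trans h⟩

lemma of_norm_le (hf : HasFourthMoment P f C) (hg : Measurable g) (h : ∀ ω, ‖g ω‖ ≤ ‖f ω‖) :
    HasFourthMoment P g C := by
  have h4 : ∀ ω, ‖g ω‖ ^ 4 ≤ ‖f ω‖ ^ 4 := fun ω => pow_le_pow_left₀ (norm_nonneg _) (h ω) 4
  have hint : Integrable (fun ω => ‖g ω‖ ^ 4) P :=
    hf.int.mono' (hg.norm.pow_const 4).aestronglyMeasurable
      (Eventually.of_forall fun ω => by
        rw [Real.norm_of_nonneg (by positivity)]; exact h4 ω)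
  exact ⟨hg, hint, (integral_mono hint hf.int h4).trans hf.le⟩

lemma zero (P : Measure Ω) : HasFourthMoment P (fun _ => 0) 0 := ⟨measurable_const, by simp, by simp⟩

lemma const_mul (hf : HasFourthMoment P f C) (c : ℂ) :
    HasFourthMoment P (fun ω => c * f ω) (‖c‖ ^ 4 * C) := by
  have e : ∀ ω, ‖c * f ω‖ ^ 4 = ‖c‖ ^ 4 * ‖f ω‖ ^ 4 := fun ω => by rw [norm_mul, mul_pow]
  refine ⟨hf.meas.const_mul c, ?_, ?_⟩
  · simp only [e]; exact hf.int.const_mul _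
  · simp only [e, integral_const_mul]
    exact mul_le_mul_of_nonneg_left hf.le (by positivity)

lemma real_mul (hf : HasFourthMoment P f C) {c : ℝ} (hc : |c| ≤ 1) :
    HasFourthMoment P (fun ω => (c : ℂ) * f ω) C :=
  hf.of_norm_le (hf.meas.const_mul _) fun ω => by
    rw [norm_mul, Complex.norm_real, Real.norm_eq_abs]
    exact mul_le_of_le_one_left (norm_nonneg _) hc

lemma conj (hf : HasFourthMoment P f C) :
    HasFourthMoment P (fun ω => (starRingEnd ℂ) (f ω)) C :=
  hf.of_norm_le (Complex.continuous_conj.measurable.comp hf.meas) fun ω => by simp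

lemma sum {ι : Type*} (s : Finset ι) {f : ι → Ω → ℂ}
    (hf : ∀ i ∈ s, HasFourthMoment P (f i) C) :
    HasFourthMoment P (fun ω => ∑ i ∈ s, f i ω) ((s.card : ℝ) ^ 4 * C) := by
  have hm : Measurable fun ω => ∑ i ∈ s, f i ω := Finset.measurable_fun_sum s fun i hi => (hf i hi).meas
  have hi : Integrable (fun ω => (s.card : ℝ) ^ 3 * ∑ i ∈ s, ‖f i ω‖ ^ 4) P :=
    (integrable_finsetSum s fun i hi => (hf i hi).int).const_mul _
  have hle : ∀ ω, ‖∑ i ∈ s, f i ω‖ ^ 4 ≤ (s.card : ℝ) ^ 3 * ∑ i ∈ s, ‖f i ω‖ ^ 4 := fun ω =>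
    (pow_le_pow_left₀ (norm_nonneg _) (norm_sum_le s _) 4).trans
      (pow_sum_le_card_mul_sum_pow (fun i _ => norm_nonneg _) 3)
  have hint : Integrable (fun ω => ‖∑ i ∈ s, f i ω‖ ^ 4) P :=
    hi.mono' (hm.norm.pow_const 4).aestronglyMeasurable
      (Eventually.of_forall fun ω => by
        rw [Real.norm_of_nonneg (by positivity)]; exact hle ω)
  refine ⟨hm, hint, (integral_mono hint hi hle).trans ?_⟩
  rw [integral_const_mul, integral_finsetSum s fun i hi => (hf i hi).int]
  have e : (s.card : ℝ) ^ 4 * C = (s.card : ℝ) ^ 3 * (s.card * C) := by ring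
  rw [e]
  refine mul_le_mul_of_nonneg_left ?_ (by positivity)
  calc ∑ i ∈ s, ∫ ω, ‖f i ω‖ ^ 4 ∂P ≤ ∑ i ∈ s, C := Finset.sum_le_sum fun i hi => (hf i hi).le
    _ = s.card * C := by simp

lemma add (hf : HasFourthMoment P f C) (hg : HasFourthMoment P g D) :
    HasFourthMoment P (fun ω => f ω + g ω) (16 * max C D) := by
  have h := HasFourthMoment.sum (P := P) (C := max C D) (Finset.univ : Finset (Fin 2))
    (f := (![f, g] : Fin 2 → Ω → ℂ)) (by
      intro i _
      fin_cases i
      · exact hf.mono (le_max_left _ _)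
      · exact hg.mono (le_max_right _ _))
  simp only [Fin.sum_univ_two, Finset.card_univ, Fintype.card_fin] at h
  norm_num at h
  exact h

lemma mul_of_indepFun (hf : HasFourthMoment P f C) (hg : HasFourthMoment P g D)
    (hfg : IndepFun f g P) : HasFourthMoment P (fun ω => f ω * g ω) (C * D) := by
  have hind : IndepFun (fun ω => ‖f ω‖ ^ 4) (fun ω => ‖g ω‖ ^ 4) P :=
    hfg.comp (φ := fun z : ℂ => ‖z‖ ^ 4) (ψ := fun z : ℂ => ‖z‖ ^ 4) (by fun_prop) (by fun_prop)
  have e : ∀ ω, ‖f ω * g ω‖ ^ 4 = ‖f ω‖ ^ 4 * ‖g ω‖ ^ 4 := fun ω => by rw [norm_mul, mul_pow]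
  refine ⟨hf.meas.mul hg.meas, ?_, ?_⟩
  · simp only [e]; exact hind.integrable_mul hf.int hg.int
  · simp only [e]
    rw [hind.integral_fun_mul_eq_mul_integral hf.int.1 hg.int.1]
    exact mul_le_mul hf.le hg.le (integral_nonneg fun _ => by positivity) hf.nonneg

end HasFourthMoment

/-- The term linear in w is kept exactly, because it will have mean zero. With r = Re(z w̄), the
term 4r² is at most 4|z|²|w|², and 4r|w|² ≤ 4|z||w|³ ≤ 2|z|²|w|² + 2|w|⁴. -/
lemma norm_add_pow_four_le (z w : ℂ) : ‖z + w‖ ^ 4 ≤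
    ‖z‖ ^ 4 + 4 * (‖z‖ ^ 2 * (z * (starRingEnd ℂ) w).re) + 8 * (‖z‖ ^ 2 * ‖w‖ ^ 2)
      + 3 * ‖w‖ ^ 4 := by
  have h1 : ‖z + w‖ ^ 2 = ‖z‖ ^ 2 + ‖w‖ ^ 2 + 2 * (z * (starRingEnd ℂ) w).re := by
    rw [Complex.sq_norm, Complex.sq_norm, Complex.sq_norm, Complex.normSq_add]
  have h2 : |(z * (starRingEnd ℂ) w).re| ≤ ‖z‖ * ‖w‖ := by
    refine (Complex.abs_re_le_norm _).trans ?_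
    rw [norm_mul, RCLike.norm_conj]
  have e : ‖z + w‖ ^ 4 = (‖z + w‖ ^ 2) ^ 2 := by ring
  rw [e, h1]
  generalize (z * (starRingEnd ℂ) w).re = r at *
  have hz := norm_nonneg z
  have hw := norm_nonneg w
  generalize ‖z‖ = s at *
  generalize ‖w‖ = t at *
  have h3 : r ^ 2 ≤ (s * t) ^ 2 := sq_le_sq' (by linarith [neg_abs_le r]) ((le_abs_self r).trans h2)
  have h4 : r * t ^ 2 ≤ (s * t) * t ^ 2 :=
    mul_le_mul_of_nonneg_right ((le_abs_self r).trans h2) (by positivity)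
  nlinarith [sq_nonneg (s * t - t ^ 2)]

lemma indepFun_of_indep {F : MeasurableSpace Ω} {β γ : Type*} [MeasurableSpace β]
    [mγ : MeasurableSpace γ] {ξ : Ω → β} {g : Ω → γ}
    (hind : Indep (MeasurableSpace.comap ξ inferInstance) F P) (hg : Measurable[F] g) :
    IndepFun ξ g P :=
  (IndepFun_iff_Indep _ _ _).2 (indep_of_indep_of_le_right hind hg.comap_le)

/-- The new factor ξ is centred and independent of the pair (S, Z), though S and Z may depend on
each other. Hence the linear term of the fourth-power expansion disappears and the mixed term
factorises into E|ξ|² and E|S|²|Z|². -/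
lemma HasFourthMoment.step [IsProbabilityMeasure P] 
    {S ξ Z : Ω → ℂ} {C D : ℝ} {n : ℕ} (hC : 1 ≤ C)
    (hS : HasFourthMoment P S (16 * (n : ℝ) ^ 2 * C ^ 2 * D))
    (hind : IndepFun ξ (fun ω => (S ω, Z ω)) P) (h0 : ∫ ω, ξ ω ∂P = 0)
    (hξ : HasFourthMoment P ξ C) (hZ : HasFourthMoment P Z D) :
    HasFourthMoment P (fun ω => S ω + ξ ω * Z ω) (16 * ((n + 1 : ℕ) : ℝ) ^ 2 * C ^ 2 * D) := by
  have hD := hZ.nonneg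
  have hξZ : IndepFun ξ Z P := hind.comp measurable_id measurable_snd
  have hw := hξ.mul_of_indepFun hZ hξZ
  set w := fun ω => ξ ω * Z ω with hwdef
  have hm : Measurable fun ω => S ω + w ω := hS.meas.add hw.meas
  -- integrability of the mixed terms
  have hmix : Integrable (fun ω => ‖S ω‖ ^ 2 * ‖w ω‖ ^ 2) P := by
    refine (hS.int.add hw.int).mono'
      ((hS.meas.norm.pow_const 2).mul (hw.meas.norm.pow_const 2)).aestronglyMeasurable
      (Eventually.of_forall fun ω => ?_)
    rw [Real.norm_of_nonneg (by positivity)]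
    simp only [Pi.add_apply]
    nlinarith [sq_nonneg (‖S ω‖ ^ 2 - ‖w ω‖ ^ 2), sq_nonneg (‖S ω‖ ^ 2), sq_nonneg (‖w ω‖ ^ 2)]
  have hcm : Measurable fun ω => (((‖S ω‖ ^ 2 : ℝ) : ℂ) * S ω) * (starRingEnd ℂ) (w ω) :=
    ((Complex.measurable_ofReal.comp (hS.meas.norm.pow_const 2)).mul hS.meas).mul
      (Complex.continuous_conj.measurable.comp hw.meas)
  have hci : Integrable (fun ω => (((‖S ω‖ ^ 2 : ℝ) : ℂ) * S ω) * (starRingEnd ℂ) (w ω)) P := by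
    refine (hS.int.add hmix).mono' hcm.aestronglyMeasurable (Eventually.of_forall fun ω => ?_)
    simp only [Pi.add_apply, norm_mul, Complex.norm_real, norm_pow, norm_norm, RCLike.norm_conj]
    nlinarith [sq_nonneg (‖S ω‖ * (‖S ω‖ - ‖w ω‖)), sq_nonneg (‖S ω‖ ^ 2),
      sq_nonneg (‖S ω‖ * ‖w ω‖)]
  have hcross : ∫ ω, ‖S ω‖ ^ 2 * (S ω * (starRingEnd ℂ) (w ω)).re ∂P = 0 := by
    have e1 : ∀ ω, ‖S ω‖ ^ 2 * (S ω * (starRingEnd ℂ) (w ω)).re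
        = ((((‖S ω‖ ^ 2 : ℝ) : ℂ) * S ω) * (starRingEnd ℂ) (w ω)).re := fun ω => by
      rw [mul_assoc, Complex.re_ofReal_mul]
    have e2 : ∀ ω, (((‖S ω‖ ^ 2 : ℝ) : ℂ) * S ω) * (starRingEnd ℂ) (w ω)
        = (starRingEnd ℂ) (ξ ω) * ((((‖S ω‖ ^ 2 : ℝ) : ℂ) * S ω) * (starRingEnd ℂ) (Z ω)) :=
      fun ω => by rw [hwdef]; simp only [map_mul]; ring
    simp only [e1]
    have e3 := integral_re hci
    simp only [RCLike.re_to_complex] at e3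
    rw [e3]
    simp only [e2]
    have hψ : Measurable fun q : ℂ × ℂ =>
        (((‖q.1‖ ^ 2 : ℝ) : ℂ) * q.1) * (starRingEnd ℂ) q.2 :=
      ((Complex.measurable_ofReal.comp (measurable_fst.norm.pow_const 2)).mul measurable_fst).mul
        (Complex.continuous_conj.measurable.comp measurable_snd)
    have hi : IndepFun (fun ω => (starRingEnd ℂ) (ξ ω))
        (fun ω => (((‖S ω‖ ^ 2 : ℝ) : ℂ) * S ω) * (starRingEnd ℂ) (Z ω)) P :=
      hind.comp (φ := fun z : ℂ => (starRingEnd ℂ) z) Complex.continuous_conj.measurable hψ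
    rw [hi.integral_fun_mul_eq_mul_integral hξ.conj.meas.aestronglyMeasurable
      (hψ.comp (hS.meas.prodMk hZ.meas)).aestronglyMeasurable, integral_conj, h0]
    simp
  have hmixle : ∫ ω, ‖S ω‖ ^ 2 * ‖w ω‖ ^ 2 ∂P ≤ 4 * n * C ^ 2 * D := by
    have hξ2i : Integrable (fun ω => ‖ξ ω‖ ^ 2) P := by
      refine ((integrable_const (1 : ℝ)).add hξ.int).mono'
        (hξ.meas.norm.pow_const 2).aestronglyMeasurable (Eventually.of_forall fun ω => ?_)
      rw [Real.norm_of_nonneg (by positivity)]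
      simp only [Pi.add_apply]
      nlinarith [sq_nonneg (‖ξ ω‖ ^ 2 - 1)]
    have hξ2 : ∫ ω, ‖ξ ω‖ ^ 2 ∂P ≤ C := by
      have : ∫ ω, ‖ξ ω‖ ^ 2 ∂P ≤ ∫ ω, (1 / 2 + 1 / 2 * ‖ξ ω‖ ^ 4) ∂P :=
        integral_mono hξ2i ((integrable_const _).add (hξ.int.const_mul _)) fun ω => by
          change ‖ξ ω‖ ^ 2 ≤ 1 / 2 + 1 / 2 * ‖ξ ω‖ ^ 4
          nlinarith [sq_nonneg (‖ξ ω‖ ^ 2 - 1)]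
      rw [integral_add (integrable_const _) (hξ.int.const_mul _), integral_const_mul] at this
      simp only [integral_const, probReal_univ, smul_eq_mul, one_mul] at this
      linarith [hξ.le]
    have hSZi : Integrable (fun ω => ‖S ω‖ ^ 2 * ‖Z ω‖ ^ 2) P := by
      refine (hS.int.add hZ.int).mono'
        ((hS.meas.norm.pow_const 2).mul (hZ.meas.norm.pow_const 2)).aestronglyMeasurable
        (Eventually.of_forall fun ω => ?_)
      rw [Real.norm_of_nonneg (by positivity)]
      simp only [Pi.add_apply]
      nlinarith [sq_nonneg (‖S ω‖ ^ 2 - ‖Z ω‖ ^ 2), sq_nonneg (‖S ω‖ ^ 2), sq_nonneg (‖Z ω‖ ^ 2)]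
    have hSZ : ∫ ω, ‖S ω‖ ^ 2 * ‖Z ω‖ ^ 2 ∂P ≤ 4 * n * C * D := by
      -- For n > 0 this is a weighted arithmetic–geometric mean inequality, with weights chosen so
      -- that both halves contribute 2nCD. The weights degenerate at n = 0, where S vanishes almost
      -- surely.
      rcases Nat.eq_zero_or_pos n with hn | hn
      · have hS0 : ∫ ω, ‖S ω‖ ^ 4 ∂P = 0 := le_antisymm (by simpa [hn] using hS.le)
          (integral_nonneg fun _ => by positivity)
        rw [integral_eq_zero_iff_of_nonneg (fun _ => by positivity) hS.int] at hS0
        have : ∫ ω, ‖S ω‖ ^ 2 * ‖Z ω‖ ^ 2 ∂P = ∫ ω, (0 : ℝ) ∂P := by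
          refine integral_congr_ae ?_
          filter_upwards [hS0] with ω hω
          have : ‖S ω‖ = 0 := by simpa using hω
          simp [this]
        rw [this, hn]; simp
      · have hn' : (0 : ℝ) < n := by exact_mod_cast hn
        have hpt : ∀ ω, ‖S ω‖ ^ 2 * ‖Z ω‖ ^ 2
            ≤ 1 / (8 * n * C) * ‖S ω‖ ^ 4 + 2 * n * C * ‖Z ω‖ ^ 4 := fun ω => by
          have h := sq_nonneg (‖S ω‖ ^ 2 - 4 * n * C * ‖Z ω‖ ^ 2)
          have hpos : (0 : ℝ) < 8 * n * C := by positivity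
          rw [← sub_nonneg]
          have e : 1 / (8 * n * C) * ‖S ω‖ ^ 4 + 2 * n * C * ‖Z ω‖ ^ 4 - ‖S ω‖ ^ 2 * ‖Z ω‖ ^ 2
              = 1 / (8 * n * C) * (‖S ω‖ ^ 2 - 4 * n * C * ‖Z ω‖ ^ 2) ^ 2 := by
            field_simp; ring
          rw [e]; positivity
        have h1 := integral_mono hSZi ((hS.int.const_mul _).add (hZ.int.const_mul _)) hpt
        rw [integral_add' (hS.int.const_mul _) (hZ.int.const_mul _), integral_const_mul,
          integral_const_mul] at h1
        have h2 : 1 / (8 * n * C) * ∫ ω, ‖S ω‖ ^ 4 ∂P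
            ≤ 1 / (8 * n * C) * (16 * (n : ℝ) ^ 2 * C ^ 2 * D) :=
          mul_le_mul_of_nonneg_left hS.le (by positivity)
        have h3 : 2 * n * C * ∫ ω, ‖Z ω‖ ^ 4 ∂P ≤ 2 * n * C * D :=
          mul_le_mul_of_nonneg_left hZ.le (by positivity)
        have e : 1 / (8 * n * C) * (16 * (n : ℝ) ^ 2 * C ^ 2 * D) = 2 * n * C * D := by
          field_simp; ring
        linarith
    have hi : IndepFun (fun ω => ‖ξ ω‖ ^ 2) (fun ω => ‖S ω‖ ^ 2 * ‖Z ω‖ ^ 2) P :=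
      hind.comp (φ := fun z : ℂ => ‖z‖ ^ 2) (ψ := fun q : ℂ × ℂ => ‖q.1‖ ^ 2 * ‖q.2‖ ^ 2)
        (by fun_prop) (by fun_prop)
    have e : ∀ ω, ‖S ω‖ ^ 2 * ‖w ω‖ ^ 2 = ‖ξ ω‖ ^ 2 * (‖S ω‖ ^ 2 * ‖Z ω‖ ^ 2) := fun ω => by
      rw [hwdef]; simp only [norm_mul]; ring
    simp only [e]
    rw [hi.integral_fun_mul_eq_mul_integral hξ2i.1 hSZi.1]
    calc _ ≤ C * (4 * n * C * D) := mul_le_mul hξ2 hSZ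
          (integral_nonneg fun _ => by positivity) (by linarith)
      _ = _ := by ring
  have hreal : Integrable (fun ω => ‖S ω‖ ^ 2 * (S ω * (starRingEnd ℂ) (w ω)).re) P := by
    refine (hci.re).congr (Eventually.of_forall fun ω => ?_)
    change ((((‖S ω‖ ^ 2 : ℝ) : ℂ) * S ω) * (starRingEnd ℂ) (w ω)).re = _
    rw [mul_assoc, Complex.re_ofReal_mul]
  have hb1 := (hS.int.add (hreal.const_mul 4)).add (hmix.const_mul 8)
  have hb := hb1.add (hw.int.const_mul 3)
  have hle : ∀ ω, ‖S ω + w ω‖ ^ 4 ≤ ‖S ω‖ ^ 4 + 4 * (‖S ω‖ ^ 2 * (S ω * (starRingEnd ℂ) (w ω)).re)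
      + 8 * (‖S ω‖ ^ 2 * ‖w ω‖ ^ 2) + 3 * ‖w ω‖ ^ 4 := fun ω => norm_add_pow_four_le _ _
  have hint : Integrable (fun ω => ‖S ω + w ω‖ ^ 4) P :=
    hb.mono' (hm.norm.pow_const 4).aestronglyMeasurable
      (Eventually.of_forall fun ω => by
        rw [Real.norm_of_nonneg (by positivity)]; exact hle ω)
  refine ⟨hm, hint, (integral_mono hint hb hle).trans ?_⟩
  rw [integral_add' hb1 (hw.int.const_mul 3), integral_add' (hS.int.add (hreal.const_mul 4))
    (hmix.const_mul 8), integral_add' hS.int (hreal.const_mul 4), integral_const_mul,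
    integral_const_mul, integral_const_mul, hcross]
  -- The contributions add up to at most (16n² + 8 · 4n + 3) C²D ≤ 16(n + 1)² C²D.
  have a1 := hS.le
  have a2 := hw.le
  have a3 : C * D ≤ C ^ 2 * D := by nlinarith [mul_nonneg (sub_nonneg.2 hC) hD]
  have a4 : 0 ≤ C ^ 2 * D := by positivity
  push_cast
  nlinarith

/-- Fourth moment of the martingale transform `∑ ξ_n Z_n`. -/
lemma HasFourthMoment.transform [IsProbabilityMeasure P] {F : ℕ → MeasurableSpace Ω}
    (hmono : Monotone F) {ξ Z : ℕ → Ω → ℂ} {C D : ℝ} {m : ℕ}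
    (hC : 1 ≤ C)
    (hξm : ∀ n < m, Measurable[F (n + 1)] (ξ n))
    (hind : ∀ n < m, Indep (MeasurableSpace.comap (ξ n) inferInstance) (F n) P)
    (h0 : ∀ n < m, ∫ ω, ξ n ω ∂P = 0)
    (hξ : ∀ n < m, HasFourthMoment P (ξ n) C) (hZm : ∀ n < m, Measurable[F n] (Z n))
    (hZ : ∀ n < m, HasFourthMoment P (Z n) D) :
    HasFourthMoment P (fun ω => ∑ n ∈ Finset.range m, ξ n ω * Z n ω)
      (16 * (m : ℝ) ^ 2 * C ^ 2 * D) := by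
  -- Adaptedness of the partial sums is part of the induction: it makes the next ξ independent of
  -- the partial sum together with the next Z.
  have key : ∀ l ≤ m, Measurable[F l] (fun ω => ∑ n ∈ Finset.range l, ξ n ω * Z n ω) ∧
      HasFourthMoment P (fun ω => ∑ n ∈ Finset.range l, ξ n ω * Z n ω)
        (16 * (l : ℝ) ^ 2 * C ^ 2 * D) := by
    intro l
    induction l with
    | zero => exact fun _ => ⟨by simp, by simpa using HasFourthMoment.zero P⟩
    | succ l ih =>
      intro hl
      obtain ⟨h1, h2⟩ := ih (by omega)
      have hlm : l < m := by omega
      simp only [Finset.sum_range_succ]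
      refine ⟨(h1.mono (hmono (Nat.le_succ l)) le_rfl).add
        ((hξm l hlm).mul ((hZm l hlm).mono (hmono (Nat.le_succ l)) le_rfl)), ?_⟩
      exact HasFourthMoment.step hC h2
        (indepFun_of_indep (hind l hlm) (h1.prodMk (hZm l hlm))) (h0 l hlm) (hξ l hlm) (hZ l hlm)
  exact (key m le_rfl).2

/-- Fourth moments of order `1 / L ^ 2` are summable, whence almost sure convergence. -/
lemma ae_tendsto_zero_of_fourthMoment {Y : ℕ → Ω → ℂ} {C : ℝ}
    (h : ∀ l, 0 < l → HasFourthMoment P (Y l) (C / (l : ℝ) ^ 2)) :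
    ∀ᵐ ω ∂P, Tendsto (fun l => Y l ω) atTop (𝓝 0) := by
  have hsum : Summable fun l : ℕ => C / ((l + 1 : ℕ) : ℝ) ^ 2 := by
    have := (summable_nat_add_iff 1).2 ((Real.summable_one_div_nat_pow (p := 2)).2 one_lt_two)
    simpa [div_eq_mul_inv] using this.mul_left C
  have hnn : ∀ l : ℕ, 0 ≤ C / ((l + 1 : ℕ) : ℝ) ^ 2 := fun l => (h (l + 1) l.succ_pos).nonneg
  -- The sum of the fourth powers has finite mean, hence is almost surely finite, and so its terms
  -- tend to 0. The index is shifted because nothing is assumed at l = 0.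
  have hbd : ∫⁻ ω, ∑' l : ℕ, ENNReal.ofReal (‖Y (l + 1) ω‖ ^ 4) ∂P ≠ ⊤ := by
    rw [lintegral_tsum fun l =>
      ((h (l + 1) l.succ_pos).meas.norm.pow_const 4).ennreal_ofReal.aemeasurable]
    refine ne_top_of_le_ne_top (b := ∑' l : ℕ, ENNReal.ofReal (C / ((l + 1 : ℕ) : ℝ) ^ 2)) ?_ ?_
    · rw [← ENNReal.ofReal_tsum_of_nonneg hnn hsum]
      exact ENNReal.ofReal_ne_top
    · refine ENNReal.tsum_le_tsum fun l => ?_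
      rw [← ofReal_integral_eq_lintegral_ofReal (h (l + 1) l.succ_pos).int
        (Eventually.of_forall fun _ => by positivity)]
      exact ENNReal.ofReal_le_ofReal (h (l + 1) l.succ_pos).le
  have hmeas : Measurable fun ω => ∑' l : ℕ, ENNReal.ofReal (‖Y (l + 1) ω‖ ^ 4) :=
    Measurable.tsum fun l =>
      ((h (l + 1) l.succ_pos).meas.norm.pow_const 4).ennreal_ofReal
  filter_upwards [ae_lt_top hmeas hbd] with ω hω
  have h1 := ENNReal.tendsto_atTop_zero_of_tsum_ne_top hω.ne
  have h2 := (ENNReal.tendsto_toReal ENNReal.zero_ne_top).comp h1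
  have h3 : Tendsto (fun l => ‖Y (l + 1) ω‖ ^ 4) atTop (𝓝 0) := by
    refine h2.congr fun l => ?_
    simp only [Function.comp]
    rw [ENNReal.toReal_ofReal (by positivity)]
  rw [← tendsto_add_atTop_iff_nat 1, tendsto_zero_iff_norm_tendsto_zero]
  have h4 := (Real.continuous_sqrt.tendsto _).comp ((Real.continuous_sqrt.tendsto _).comp h3)
  simp only [Real.sqrt_zero] at h4
  refine h4.congr fun l => ?_
  simp only [Function.comp]
  have e : ‖Y (l + 1) ω‖ ^ 4 = (‖Y (l + 1) ω‖ ^ 2) ^ 2 := by ring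
  rw [e, Real.sqrt_sq (by positivity), Real.sqrt_sq (by positivity)]

end FourthMoment

/-! ### Fields of independent centred gains -/

section Field

variable {Ω : Type*} {mΩ : MeasurableSpace Ω} {P : Measure Ω} {ι : Type*}

/-- Independent centred gains with uniformly bounded moments: `σ T` is the σ-algebra of the gains
with index in `T`, and `s i` is the variance of `X i`. -/
structure IsGainField (P : Measure Ω) (X : ι → Ω → ℂ) (σ : Set ι → MeasurableSpace Ω) (s : ι → ℝ)
    (C : ℝ) : Prop where
  mono : Monotone σ
  meas : ∀ T, ∀ i ∈ T, Measurable[σ T] (X i)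
  indep : ∀ T, ∀ i ∉ T, Indep (MeasurableSpace.comap (X i) inferInstance) (σ T) P
  one_le : 1 ≤ C
  mean : ∀ i, ∫ ω, X i ω ∂P = 0
  fourth : ∀ i, HasFourthMoment P (X i) C
  fourth_sq : ∀ i, HasFourthMoment P (fun ω => X i ω ^ 2) C
  dev_mean : ∀ i, ∫ ω, ((‖X i ω‖ ^ 2 - s i : ℝ) : ℂ) ∂P = 0
  fourth_dev : ∀ i, HasFourthMoment P (fun ω => ((‖X i ω‖ ^ 2 - s i : ℝ) : ℂ)) C
  abs_le : ∀ i, |s i| ≤ C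

/-- The off-diagonal part of the squared lagged correlations of `x` and `y`. -/
noncomputable def offDiag (κ : ℕ → ℕ → ℕ → ℝ) (m : ℕ) (x y : ℕ → ℂ) : ℂ :=
  ∑ a ∈ Finset.range m, (starRingEnd ℂ) (x a) * ∑ b ∈ Finset.range a, ∑ c ∈ Finset.range a,
    (κ a b c : ℂ) * y b * x c * (starRingEnd ℂ) (y (c + b - a))

lemma sum_square_eq {M : Type*} [AddCommMonoid M] (G : ℕ → ℕ → M) (a : ℕ) :
    ∑ b ∈ Finset.range a, ∑ c ∈ Finset.range a, G b c =
      (∑ u ∈ Finset.range a, ∑ i ∈ Finset.range u, G u i +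
        ∑ u ∈ Finset.range a, ∑ i ∈ Finset.range u, G i u) + ∑ u ∈ Finset.range a, G u u := by
  induction a with
  | zero => simp
  | succ a ih =>
    simp only [Finset.sum_range_succ, Finset.sum_add_distrib]
    rw [ih]
    abel

namespace IsGainField

variable [IsProbabilityMeasure P] {X : ι → Ω → ℂ} {σ : Set ι → MeasurableSpace Ω} {s : ι → ℝ}
  {C : ℝ} (h : IsGainField P X σ s C)
include h

lemma nonneg : 0 ≤ C := zero_le_one.trans h.one_le

lemma indepFun {i : ι} {T : Set ι} (hi : i ∉ T) {β : Type*} [MeasurableSpace β] {g : Ω → β}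
    (hg : Measurable[σ T] g) : IndepFun (X i) g P :=
  indepFun_of_indep (h.indep T i hi) hg

/-- Martingale transforms of functions of successive gains. -/
lemma transform {e : ℕ → ι} (he : Function.Injective e) {T : Set ι} (hT : ∀ n, e n ∉ T)
    {φ : ℕ → ℂ → ℂ} (hφ : ∀ n, Measurable (φ n)) {Z : ℕ → Ω → ℂ} {D : ℝ} {m : ℕ}
    (h0 : ∀ n, ∫ ω, φ n (X (e n) ω) ∂P = 0)
    (h4 : ∀ n, HasFourthMoment P (fun ω => φ n (X (e n) ω)) C)
    (hZm : ∀ n < m, Measurable[σ (T ∪ e '' Set.Iio n)] (Z n))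
    (hZ : ∀ n < m, HasFourthMoment P (Z n) D) :
    HasFourthMoment P (fun ω => ∑ n ∈ Finset.range m, φ n (X (e n) ω) * Z n ω)
      (16 * (m : ℝ) ^ 2 * C ^ 2 * D) := by
  -- The gains in `T` are revealed beforehand; the sequence `e` is then revealed one gain at a time.
  refine HasFourthMoment.transform (F := fun n => σ (T ∪ e '' Set.Iio n))
    (fun n n' hn => h.mono (Set.union_subset_union_right _
      (Set.image_mono (Set.Iio_subset_Iio hn)))) h.one_le ?_ ?_ (fun n _ => h0 n)
    (fun n _ => h4 n) hZm hZ
  · intro n _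
    exact (hφ n).comp (h.meas _ _ (Or.inr ⟨n, Nat.lt_succ_self n, rfl⟩))
  · intro n _
    have hn : e n ∉ T ∪ e '' Set.Iio n := by
      rintro (hn | ⟨l, hl, hln⟩)
      · exact hT n hn
      · exact absurd (he hln) (ne_of_lt hl)
    refine indep_of_indep_of_le_left (h.indep _ _ hn) ?_
    have : (fun ω => φ n (X (e n) ω)) = φ n ∘ X (e n) := rfl
    rw [this, ← MeasurableSpace.comap_comp]
    exact MeasurableSpace.comap_mono (hφ n).comap_le

lemma transform_gain {e : ℕ → ι} (he : Function.Injective e) {T : Set ι} (hT : ∀ n, e n ∉ T)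
    {Z : ℕ → Ω → ℂ} {D : ℝ} {m : ℕ}
    (hZm : ∀ n < m, Measurable[σ (T ∪ e '' Set.Iio n)] (Z n))
    (hZ : ∀ n < m, HasFourthMoment P (Z n) D) :
    HasFourthMoment P (fun ω => ∑ n ∈ Finset.range m, X (e n) ω * Z n ω)
      (16 * (m : ℝ) ^ 2 * C ^ 2 * D) :=
  h.transform he hT (φ := fun _ z => z) (fun _ => measurable_id) (fun _ => h.mean _)
    (fun _ => h.fourth _) hZm hZ

lemma transform_conj {e : ℕ → ι} (he : Function.Injective e) {T : Set ι} (hT : ∀ n, e n ∉ T)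
    {Z : ℕ → Ω → ℂ} {D : ℝ} {m : ℕ}
    (hZm : ∀ n < m, Measurable[σ (T ∪ e '' Set.Iio n)] (Z n))
    (hZ : ∀ n < m, HasFourthMoment P (Z n) D) :
    HasFourthMoment P (fun ω => ∑ n ∈ Finset.range m, (starRingEnd ℂ) (X (e n) ω) * Z n ω)
      (16 * (m : ℝ) ^ 2 * C ^ 2 * D) :=
  h.transform he hT (φ := fun _ z => (starRingEnd ℂ) z)
    (fun _ => Complex.continuous_conj.measurable) (fun n => by rw [integral_conj, h.mean, map_zero])
    (fun n => (h.fourth _).conj) hZm hZ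

lemma transform_dev {e : ℕ → ι} (he : Function.Injective e)
    {Z : ℕ → Ω → ℂ} {D : ℝ} {m : ℕ}
    (hZm : ∀ n < m, Measurable[σ (e '' Set.Iio n)] (Z n))
    (hZ : ∀ n < m, HasFourthMoment P (Z n) D) :
    HasFourthMoment P
      (fun ω => ∑ n ∈ Finset.range m, ((‖X (e n) ω‖ ^ 2 - s (e n) : ℝ) : ℂ) * Z n ω)
      (16 * (m : ℝ) ^ 2 * C ^ 2 * D) := by
  refine h.transform he (T := ∅) (fun _ => Set.notMem_empty _)
    (φ := fun n z => ((‖z‖ ^ 2 - s (e n) : ℝ) : ℂ))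
    (fun n => Complex.measurable_ofReal.comp (by fun_prop)) (fun n => h.dev_mean _)
    (fun n => h.fourth_dev _) ?_ hZ
  intro n hn
  rw [Set.empty_union]; exact hZm n hn

lemma measurable_conj_gain {T : Set ι} {i : ι} (hi : i ∈ T) :
    Measurable[σ T] fun ω => (starRingEnd ℂ) (X i ω) :=
  Complex.continuous_conj.measurable.comp (h.meas T i hi)

/-- Truncated subtraction may produce a meaningless path index, but only where the coefficient
vanishes; the index then need not lie in `T`. -/
lemma measurable_coeff_conj {T : Set ι} {i : ι} {r : ℝ} (hi : r ≠ 0 → i ∈ T) :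
    Measurable[σ T] fun ω => (r : ℂ) * (starRingEnd ℂ) (X i ω) := by
  by_cases hr : r = 0
  · simp only [hr, Complex.ofReal_zero, zero_mul]; exact measurable_const
  · exact measurable_const.mul (h.measurable_conj_gain (hi hr))

lemma measurable_quad {T : Set ι} {e : ℕ → ι} {m : ℕ} {κ : ℕ → ℝ} {τ : ℕ → ℕ}
    (hT : ∀ b < m, e b ∈ T) (hτ : ∀ b < m, κ b ≠ 0 → τ b < b) :
    Measurable[σ T] fun ω => ∑ b ∈ Finset.range m,
      X (e b) ω * ((κ b : ℂ) * (starRingEnd ℂ) (X (e (τ b)) ω)) := by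
  refine Finset.measurable_fun_sum _ fun b hb => ?_
  have hb' := Finset.mem_range.1 hb
  exact (h.meas T _ (hT b hb')).mul
    (h.measurable_coeff_conj fun hk => hT _ ((hτ b hb' hk).trans hb'))

lemma quad {e : ℕ → ι} (he : Function.Injective e) {m : ℕ} {κ : ℕ → ℝ} {τ : ℕ → ℕ}
    (hκ : ∀ b, |κ b| ≤ 1) (hτ : ∀ b < m, κ b ≠ 0 → τ b < b) :
    HasFourthMoment P (fun ω => ∑ b ∈ Finset.range m,
      X (e b) ω * ((κ b : ℂ) * (starRingEnd ℂ) (X (e (τ b)) ω))) (16 * (m : ℝ) ^ 2 * C ^ 2 * C) := by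
  refine h.transform_gain he (T := ∅) (fun _ => Set.notMem_empty _) (fun b hb => ?_)
    (fun b _ => (h.fourth _).conj.real_mul (hκ b))
  exact h.measurable_coeff_conj fun hk => Or.inr ⟨_, hτ b hb hk, rfl⟩

lemma measurable_cubic {T : Set ι} {e e' : ℕ → ι} {m : ℕ} {l : ℕ → ℕ} {κ : ℕ → ℕ → ℝ}
    {τ : ℕ → ℕ → ℕ} (hT : ∀ u < m, e u ∈ T) (hT' : ∀ u < m, ∀ b < l u, e' b ∈ T)
    (hτ : ∀ u < m, ∀ b < l u, κ u b ≠ 0 → τ u b < b) :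
    Measurable[σ T] fun ω => ∑ u ∈ Finset.range m, X (e u) ω * ∑ b ∈ Finset.range (l u),
      X (e' b) ω * ((κ u b : ℂ) * (starRingEnd ℂ) (X (e' (τ u b)) ω)) := by
  refine Finset.measurable_fun_sum _ fun u hu => ?_
  have hu' := Finset.mem_range.1 hu
  exact (h.meas T _ (hT u hu')).mul (h.measurable_quad (hT' u hu') (hτ u hu'))

/-- A transform whose coefficients are themselves quadratic transforms. The hypothesis `hT'` covers
both uses: the second sequence belongs to another user and is already revealed, or it is the same
sequence at earlier indices. -/
lemma cubic {T : Set ι} {e e' : ℕ → ι} (he : Function.Injective e) (he' : Function.Injective e')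
    (hT : ∀ n, e n ∉ T) {m : ℕ} {l : ℕ → ℕ} {κ : ℕ → ℕ → ℝ}
    {τ : ℕ → ℕ → ℕ} (hlm : ∀ u < m, l u ≤ m)
    (hT' : ∀ u < m, ∀ b < l u, e' b ∈ T ∪ e '' Set.Iio u)
    (hκ : ∀ u b, |κ u b| ≤ 1) (hτ : ∀ u < m, ∀ b < l u, κ u b ≠ 0 → τ u b < b) :
    HasFourthMoment P (fun ω => ∑ u ∈ Finset.range m, X (e u) ω * ∑ b ∈ Finset.range (l u),
      X (e' b) ω * ((κ u b : ℂ) * (starRingEnd ℂ) (X (e' (τ u b)) ω)))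
      (256 * (m : ℝ) ^ 4 * C ^ 5) := by
  have hC := h.nonneg
  have := h.transform_gain he hT (D := 16 * (m : ℝ) ^ 2 * C ^ 2 * C) (m := m)
    (Z := fun u ω => ∑ b ∈ Finset.range (l u),
      X (e' b) ω * ((κ u b : ℂ) * (starRingEnd ℂ) (X (e' (τ u b)) ω)))
    (fun u hu => h.measurable_quad (hT' u hu) (hτ u hu))
    (fun u hu => (h.quad he' (hκ u) (hτ u hu)).mono (by
      have := hlm u hu
      gcongr))
  exact this.mono (le_of_eq (by ring))

variable {κ : ℕ → ℕ → ℕ → ℝ} (hκ : ∀ a b c, |κ a b c| ≤ 1)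
  (hκ0 : ∀ a b c, κ a b c ≠ 0 → a ≤ c + b)
include hκ hκ0

/-- Off-diagonal terms for the gains of two different users. -/
lemma offDiag_cross {e e' : ℕ → ι} (he : Function.Injective e) (he' : Function.Injective e')
    (hee' : ∀ n n', e n ≠ e' n') (m : ℕ) :
    HasFourthMoment P (fun ω => offDiag κ m (fun n => X (e n) ω) (fun n => X (e' n) ω))
      (2 ^ 20 * (m : ℝ) ^ 6 * C ^ 7) := by
  have hC := h.nonneg
  have hT : ∀ n, e n ∉ Set.range e' := by
    rintro n ⟨n', hn⟩
    exact hee' n n' hn.symm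
  -- All gains of the second user are revealed first. In the cofactor of the conjugate gain of path
  -- a, the first user's paths c satisfy c < a, and c + b - a < b orders the two paths of the second
  -- user.
  have key := h.transform_conj he hT (m := m) (D := 256 * (m : ℝ) ^ 4 * C ^ 5)
    (Z := fun a ω => ∑ c ∈ Finset.range a, X (e c) ω * ∑ b ∈ Finset.range a,
      X (e' b) ω * ((κ a b c : ℂ) * (starRingEnd ℂ) (X (e' (c + b - a)) ω)))
    (fun a _ => h.measurable_cubic (l := fun _ => a) (κ := fun c b => κ a b c)
      (τ := fun c b => c + b - a) (fun u hu => Or.inr ⟨u, hu, rfl⟩)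
      (fun u _ b _ => Or.inl ⟨b, rfl⟩)
      (fun u hu b _ hk => by have := hκ0 _ _ _ hk; omega))
    (fun a ha => (h.cubic he he' hT (l := fun _ => a) (κ := fun c b => κ a b c)
      (τ := fun c b => c + b - a) (fun _ _ => le_rfl) (fun u _ b _ => Or.inl ⟨b, rfl⟩)
      (fun u b => hκ a b u)
      (fun u hu b _ hk => by have := hκ0 _ _ _ hk; omega)).mono (by gcongr))
  have e1 : (fun ω => offDiag κ m (fun n => X (e n) ω) (fun n => X (e' n) ω)) =
      fun ω => ∑ a ∈ Finset.range m, (starRingEnd ℂ) (X (e a) ω) *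
        ∑ c ∈ Finset.range a, X (e c) ω * ∑ b ∈ Finset.range a,
      X (e' b) ω * ((κ a b c : ℂ) * (starRingEnd ℂ) (X (e' (c + b - a)) ω)) := by
    funext ω
    unfold offDiag
    refine Finset.sum_congr rfl fun a _ => ?_
    rw [Finset.sum_comm]
    congr 1
    refine Finset.sum_congr rfl fun c _ => ?_
    rw [Finset.mul_sum]
    refine Finset.sum_congr rfl fun b _ => ?_
    ring
  rw [e1]
  refine key.mono ?_
  have : (0 : ℝ) ≤ (m : ℝ) ^ 6 * C ^ 7 := by positivity
  nlinarith

/-- Off-diagonal terms for the gains of a single user. -/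
lemma offDiag_self {e : ℕ → ι} (he : Function.Injective e) (m : ℕ) :
    HasFourthMoment P (fun ω => offDiag κ m (fun n => X (e n) ω) (fun n => X (e n) ω))
      (2 ^ 20 * (m : ℝ) ^ 6 * C ^ 7) := by
  have hC := h.nonneg
  -- With b, c < a, the index c + b - a is smaller than both b and c. The four paths are thus
  -- ordered as a, max(b, c), min(b, c), c + b - a, with a tie only if b = c.
  have hτ : ∀ a u i, u < a → κ a u i ≠ 0 → i + u - a < i := fun a u i hu hk => by
    have := hκ0 _ _ _ hk; omega
  have hτ' : ∀ a u i, u < a → κ a i u ≠ 0 → u + i - a < i := fun a u i hu hk => by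
    have := hκ0 _ _ _ hk; omega
  have hdiagm : ∀ a, Measurable[σ (∅ ∪ e '' Set.Iio a)] fun ω => ∑ u ∈ Finset.range a,
      X (e u) ω ^ 2 * ((κ a u u : ℂ) * (starRingEnd ℂ) (X (e (u + u - a)) ω)) := fun a => by
    refine Finset.measurable_fun_sum _ fun u hu => ?_
    have hu' := Finset.mem_range.1 hu
    exact ((h.meas _ _ (Or.inr ⟨u, hu', rfl⟩)).pow_const 2).mul
      (h.measurable_coeff_conj fun hk => Or.inr ⟨_, (hτ a u u hu' hk).trans hu', rfl⟩)
  -- The terms b = c contain squared gains, for which no mean is prescribed. Only a of them occur,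
  -- so the triangle inequality already gives the order a⁴.
  have hdiag : ∀ a, HasFourthMoment P (fun ω => ∑ u ∈ Finset.range a,
      X (e u) ω ^ 2 * ((κ a u u : ℂ) * (starRingEnd ℂ) (X (e (u + u - a)) ω)))
      ((a : ℝ) ^ 4 * (C * C)) := fun a => by
    have := HasFourthMoment.sum (P := P) (Finset.range a) (C := C * C) (f := fun u ω =>
      X (e u) ω ^ 2 * ((κ a u u : ℂ) * (starRingEnd ℂ) (X (e (u + u - a)) ω))) (fun u hu => by
        refine (h.fourth_sq _).mul_of_indepFun ((h.fourth _).conj.real_mul (hκ a u u)) ?_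
        have hm : Measurable[σ (e '' Set.Iio u)]
            fun ω => (κ a u u : ℂ) * (starRingEnd ℂ) (X (e (u + u - a)) ω) :=
          h.measurable_coeff_conj fun hk => ⟨_, hτ a u u (Finset.mem_range.1 hu) hk, rfl⟩
        refine (h.indepFun (i := e u) ?_ hm).comp (φ := fun z : ℂ => z ^ 2) (ψ := id)
          (by fun_prop) measurable_id
        rintro ⟨l, hl, hlu⟩
        exact absurd (he hlu) (ne_of_lt hl))
    simpa using this
  -- The two additions cost a factor 16 each and the outer transform 16m²C², whence 16³ · 256 = 2²⁰.
  have key := h.transform_conj he (T := ∅) (fun _ => Set.notMem_empty _) (m := m)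
    (D := 16 * max (16 * max (256 * (m : ℝ) ^ 4 * C ^ 5) (256 * (m : ℝ) ^ 4 * C ^ 5))
      ((m : ℝ) ^ 4 * (C * C)))
    (Z := fun a ω => (∑ u ∈ Finset.range a, X (e u) ω * ∑ i ∈ Finset.range u,
        X (e i) ω * ((κ a u i : ℂ) * (starRingEnd ℂ) (X (e (i + u - a)) ω)) +
      ∑ u ∈ Finset.range a, X (e u) ω * ∑ i ∈ Finset.range u,
        X (e i) ω * ((κ a i u : ℂ) * (starRingEnd ℂ) (X (e (u + i - a)) ω))) +
      ∑ u ∈ Finset.range a,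
        X (e u) ω ^ 2 * ((κ a u u : ℂ) * (starRingEnd ℂ) (X (e (u + u - a)) ω)))
    (fun a _ => ((h.measurable_cubic (l := fun u => u) (κ := fun u i => κ a u i)
        (τ := fun u i => i + u - a) (fun u hu => Or.inr ⟨u, hu, rfl⟩)
        (fun u hu b hb => Or.inr ⟨b, lt_trans hb hu, rfl⟩)
        (fun u hu b _ hk => hτ a u b hu hk)).add
      (h.measurable_cubic (l := fun u => u) (κ := fun u i => κ a i u)
        (τ := fun u i => u + i - a) (fun u hu => Or.inr ⟨u, hu, rfl⟩)
        (fun u hu b hb => Or.inr ⟨b, lt_trans hb hu, rfl⟩)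
        (fun u hu b _ hk => hτ' a u b hu hk))).add (hdiagm a))
    (fun a ha => (((h.cubic he he (T := ∅) (fun _ => Set.notMem_empty _) (l := fun u => u)
        (κ := fun u i => κ a u i) (τ := fun u i => i + u - a) (fun u hu => hu.le)
        (fun u hu b hb => Or.inr ⟨b, hb, rfl⟩) (fun u b => hκ a u b)
        (fun u hu b _ hk => hτ a u b hu hk)).add
      (h.cubic he he (T := ∅) (fun _ => Set.notMem_empty _) (l := fun u => u)
        (κ := fun u i => κ a i u) (τ := fun u i => u + i - a) (fun u hu => hu.le)
        (fun u hu b hb => Or.inr ⟨b, hb, rfl⟩) (fun u b => hκ a b u)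
        (fun u hu b _ hk => hτ' a u b hu hk))).add (hdiag a)).mono (by gcongr))
  have e1 : (fun ω => offDiag κ m (fun n => X (e n) ω) (fun n => X (e n) ω)) =
      fun ω => ∑ a ∈ Finset.range m, (starRingEnd ℂ) (X (e a) ω) *
        ((∑ u ∈ Finset.range a, X (e u) ω * ∑ i ∈ Finset.range u,
        X (e i) ω * ((κ a u i : ℂ) * (starRingEnd ℂ) (X (e (i + u - a)) ω)) +
      ∑ u ∈ Finset.range a, X (e u) ω * ∑ i ∈ Finset.range u,
        X (e i) ω * ((κ a i u : ℂ) * (starRingEnd ℂ) (X (e (u + i - a)) ω))) +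
      ∑ u ∈ Finset.range a,
        X (e u) ω ^ 2 * ((κ a u u : ℂ) * (starRingEnd ℂ) (X (e (u + u - a)) ω))) := by
    funext ω
    unfold offDiag
    refine Finset.sum_congr rfl fun a _ => ?_
    rw [sum_square_eq]
    congr 1
    congr 1
    · congr 1
      · refine Finset.sum_congr rfl fun c _ => ?_
        rw [Finset.mul_sum]
        refine Finset.sum_congr rfl fun b _ => ?_
        ring
      · refine Finset.sum_congr rfl fun c _ => ?_
        rw [Finset.mul_sum]
        refine Finset.sum_congr rfl fun b _ => ?_
        ring
    · refine Finset.sum_congr rfl fun c _ => ?_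
      ring
  rw [e1]
  refine key.mono ?_
  rw [max_self, max_eq_left]
  · exact le_of_eq (by ring)
  · have h1 : C * C ≤ C ^ 5 := by
      have : C ^ 2 ≤ C ^ 5 := pow_le_pow_right₀ h.one_le (by norm_num)
      nlinarith
    have : (m : ℝ) ^ 4 * (C * C) ≤ (m : ℝ) ^ 4 * C ^ 5 := by gcongr
    have : (0 : ℝ) ≤ (m : ℝ) ^ 4 * C ^ 5 := by positivity
    linarith

end IsGainField

end Field

/-! ### Almost sure limits of sums of gains -/

section AlmostSure

variable {Ω : Type*} {mΩ : MeasurableSpace Ω} {P : Measure Ω} {ι : Type*}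

/-- Division by l^(p+1) turns the fourth moment into O(1/l²). The case p = 0 serves linear
normalisation, p = 1 quadratic normalisation. -/
lemma ae_tendsto_of_fourthMoment_pow {Y : ℕ → Ω → ℂ} {A : ℝ} (p : ℕ)
    (h : ∀ l, HasFourthMoment P (Y l) (A * (l : ℝ) ^ (4 * p + 2))) :
    ∀ᵐ ω ∂P, Tendsto (fun l : ℕ => Y l ω / (l : ℂ) ^ (p + 1)) atTop (𝓝 0) := by
  refine ae_tendsto_zero_of_fourthMoment (C := A) fun l hl => ?_
  have hl' : (0 : ℝ) < l := by exact_mod_cast hl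
  have h1 := (h l).const_mul (((l : ℂ) ^ (p + 1))⁻¹)
  have e : (fun ω => Y l ω / (l : ℂ) ^ (p + 1)) = fun ω => ((l : ℂ) ^ (p + 1))⁻¹ * Y l ω := by
    funext ω; rw [div_eq_inv_mul]
  rw [e]
  refine h1.mono (le_of_eq ?_)
  rw [norm_inv, norm_pow, Complex.norm_natCast]
  have : ((l : ℝ) ^ (p + 1))⁻¹ ^ 4 = ((l : ℝ) ^ (4 * p + 2) * (l : ℝ) ^ 2)⁻¹ := by
    rw [inv_pow]; congr 1; ring
  rw [this]
  field_simp

namespace IsGainField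

variable [IsProbabilityMeasure P]

/-! ### Fourth moments for a fixed number of paths -/

section Single

variable {X : ι → Ω → ℂ} {σ : Set ι → MeasurableSpace Ω} {s : ι → ℝ}
  {C : ℝ} (h : IsGainField P X σ s C)
include h

lemma fourth_energy {e : ℕ → ι} (he : Function.Injective e) {m l : ℕ} (hm : m ≤ l) :
    HasFourthMoment P (fun ω => ∑ a ∈ Finset.range m, ((‖X (e a) ω‖ ^ 2 - s (e a) : ℝ) : ℂ))
      (16 * C ^ 2 * (l : ℝ) ^ (4 * 0 + 2)) := by
  have h1 : HasFourthMoment P (fun _ => (1 : ℂ)) 1 := ⟨measurable_const, by simp, by simp⟩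
  have := h.transform_dev he (m := m) (Z := fun _ _ => 1) (fun _ _ => measurable_const)
    (fun _ _ => h1)
  simp only [mul_one] at this
  refine this.mono ?_
  have : (m : ℝ) ^ 2 ≤ (l : ℝ) ^ 2 := by gcongr
  norm_num
  nlinarith [sq_nonneg C]

lemma fourth_correlation {e e' : ℕ → ι} (he : Function.Injective e)
    (hee' : ∀ n n', e n ≠ e' n') {m l : ℕ} (hm : m ≤ l) :
    HasFourthMoment P (fun ω => ∑ a ∈ Finset.range m, (starRingEnd ℂ) (X (e a) ω) * X (e' a) ω)
      (16 * C ^ 3 * (l : ℝ) ^ (4 * 0 + 2)) := by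
  have hT : ∀ n, e n ∉ Set.range e' := by
    rintro n ⟨n', hn⟩
    exact hee' n n' hn.symm
  have := h.transform_conj he hT (m := m) (Z := fun a => X (e' a))
    (fun a _ => h.meas _ _ (Or.inl ⟨a, rfl⟩)) (fun a _ => h.fourth _)
  refine this.mono ?_
  have h1 : (m : ℝ) ^ 2 ≤ (l : ℝ) ^ 2 := by gcongr
  have h2 := pow_nonneg h.nonneg 3
  norm_num
  nlinarith

/-- No cancellation is needed: a sum of at most l terms is negligible after division by l². -/
lemma fourth_sum_energy_mul {e e' : ℕ → ι} (hee' : ∀ n n', e n ≠ e' n') {m l : ℕ} (hm : m ≤ l) :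
    HasFourthMoment P
      (fun ω => ∑ a ∈ Finset.range m, ((‖X (e a) ω‖ ^ 2 * ‖X (e' a) ω‖ ^ 2 : ℝ) : ℂ))
      (C ^ 2 * (l : ℝ) ^ (4 * 1 + 2)) := by
  have h1 := HasFourthMoment.sum (P := P) (Finset.range m) (C := C * C)
    (f := fun a ω => ((‖X (e a) ω‖ ^ 2 * ‖X (e' a) ω‖ ^ 2 : ℝ) : ℂ)) (fun a _ => by
      have hi : IndepFun (X (e a)) (X (e' a)) P :=
        h.indepFun (T := {e' a}) (hee' a a) (h.meas _ _ rfl)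
      have h2 := (h.fourth_sq (e a)).mul_of_indepFun (h.fourth_sq (e' a))
        (hi.comp (φ := fun z : ℂ => z ^ 2) (ψ := fun z : ℂ => z ^ 2) (by fun_prop) (by fun_prop))
      refine h2.of_norm_le (Complex.measurable_ofReal.comp
        (((h.fourth _).meas.norm.pow_const 2).mul ((h.fourth _).meas.norm.pow_const 2)))
        fun ω => ?_
      rw [Complex.norm_real, norm_mul, norm_pow, norm_pow, norm_mul, norm_pow, norm_pow, norm_norm,
        norm_norm])
  refine h1.mono ?_
  rw [Finset.card_range]
  have h3 : (m : ℝ) ^ 4 ≤ (l : ℝ) ^ 6 := by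
    rcases Nat.eq_zero_or_pos m with h0 | h0
    · simp [h0]
    · have a1 : (m : ℝ) ^ 4 ≤ (l : ℝ) ^ 4 := by gcongr
      have a2 : (l : ℝ) ^ 4 ≤ (l : ℝ) ^ 6 := by
        gcongr
        · exact_mod_cast (by omega : 1 ≤ l)
        · norm_num
      exact a1.trans a2
  have h2 := sq_nonneg C
  norm_num
  nlinarith

lemma fourth_diag {e : ℕ → ι} (he : Function.Injective e) {κ : ℕ → ℕ → ℝ}
    (hκ : ∀ a b, |κ a b| ≤ 1) (m : ℕ) :
    HasFourthMoment P (fun ω => ∑ a ∈ Finset.range m, ∑ b ∈ Finset.range a,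
      ((κ a b * (‖X (e a) ω‖ ^ 2 * ‖X (e b) ω‖ ^ 2 - s (e a) * s (e b)) : ℝ) : ℂ))
      (256 * C ^ 6 * (m : ℝ) ^ (4 * 1 + 2)) := by
  have hC := h.nonneg
  have hone := h.one_le
  have hpw : ∀ i : ι, HasFourthMoment P (fun ω => ((‖X i ω‖ ^ 2 : ℝ) : ℂ)) C := fun i =>
    (h.fourth_sq i).of_norm_le (Complex.measurable_ofReal.comp ((h.fourth _).meas.norm.pow_const 2))
      fun ω => by rw [Complex.norm_real, norm_pow, norm_pow, norm_norm]
  have hq : Measurable fun z : ℂ => ((‖z‖ ^ 2 : ℝ) : ℂ) :=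
    Complex.measurable_ofReal.comp (by fun_prop)
  -- With U = |X|², the decomposition U_a U_b - s_a s_b = (U_a - s_a) U_b + s_a (U_b - s_b) is used.
  -- The first part is a transform in a with coefficients from earlier paths; after exchanging the
  -- sums, the second is a transform in b with deterministic coefficients.
  have k1 := h.transform_dev he (m := m) (D := (m : ℝ) ^ 4 * C)
    (Z := fun a ω => ∑ b ∈ Finset.range a, (κ a b : ℂ) * ((‖X (e b) ω‖ ^ 2 : ℝ) : ℂ))
    (fun a _ => Finset.measurable_fun_sum _ fun b hb => measurable_const.mul
      (hq.comp (h.meas _ _ (Set.mem_image_of_mem e (Finset.mem_range.1 hb)))))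
    (fun a ha => (HasFourthMoment.sum _ fun b _ => (hpw _).real_mul (hκ a b)).mono (by
      rw [Finset.card_range]; gcongr))
  have hS : ∀ b, ‖∑ a ∈ (Finset.range m).filter (fun a => b < a), (κ a b : ℂ) * (s (e a) : ℂ)‖ ^ 4
      ≤ (m : ℝ) ^ 4 * C ^ 4 := by
    intro b
    rw [← mul_pow]
    refine pow_le_pow_left₀ (norm_nonneg _) ((norm_sum_le _ _).trans ?_) 4
    calc _ ≤ ∑ a ∈ (Finset.range m).filter (fun a => b < a), C := by
          refine Finset.sum_le_sum fun a _ => ?_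
          rw [norm_mul, Complex.norm_real, Complex.norm_real]
          calc _ ≤ 1 * C := mul_le_mul (hκ a b) (h.abs_le _) (abs_nonneg _) zero_le_one
            _ = C := one_mul C
      _ ≤ m * C := by
          rw [Finset.sum_const, nsmul_eq_mul]
          have : ((Finset.range m).filter (fun a => b < a)).card ≤ m :=
            (Finset.card_filter_le _ _).trans (by simp)
          gcongr
  have k2 := h.transform_dev he (m := m) (D := (m : ℝ) ^ 4 * C ^ 4)
    (Z := fun b _ => ∑ a ∈ (Finset.range m).filter (fun a => b < a), (κ a b : ℂ) * (s (e a) : ℂ))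
    (fun b _ => measurable_const) (fun b _ => ⟨measurable_const, by simp, by
      simpa using hS b⟩)
  have k3 := k1.add k2
  have e1 : (fun ω => ∑ a ∈ Finset.range m, ∑ b ∈ Finset.range a,
      ((κ a b * (‖X (e a) ω‖ ^ 2 * ‖X (e b) ω‖ ^ 2 - s (e a) * s (e b)) : ℝ) : ℂ)) =
      fun ω => ∑ n ∈ Finset.range m, ((‖X (e n) ω‖ ^ 2 - s (e n) : ℝ) : ℂ) *
        (∑ b ∈ Finset.range n, (κ n b : ℂ) * ((‖X (e b) ω‖ ^ 2 : ℝ) : ℂ)) +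
        ∑ n ∈ Finset.range m, ((‖X (e n) ω‖ ^ 2 - s (e n) : ℝ) : ℂ) *
        ∑ a ∈ (Finset.range m).filter (fun a => n < a), (κ a n : ℂ) * (s (e a) : ℂ) := by
    funext ω
    have e2 : ∑ n ∈ Finset.range m, ((‖X (e n) ω‖ ^ 2 - s (e n) : ℝ) : ℂ) *
        ∑ a ∈ (Finset.range m).filter (fun a => n < a), (κ a n : ℂ) * (s (e a) : ℂ)
        = ∑ a ∈ Finset.range m, ∑ b ∈ Finset.range a,
          ((‖X (e b) ω‖ ^ 2 - s (e b) : ℝ) : ℂ) * ((κ a b : ℂ) * (s (e a) : ℂ)) := by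
      simp only [Finset.mul_sum]
      refine Finset.sum_comm' fun x y => ?_
      simp only [Finset.mem_range, Finset.mem_filter]
      omega
    rw [e2, ← Finset.sum_add_distrib]
    refine Finset.sum_congr rfl fun a _ => ?_
    rw [Finset.mul_sum, ← Finset.sum_add_distrib]
    refine Finset.sum_congr rfl fun b _ => ?_
    push_cast; ring
  rw [e1]
  refine k3.mono ?_
  have h1 : 16 * (m : ℝ) ^ 2 * C ^ 2 * ((m : ℝ) ^ 4 * C) ≤ 16 * C ^ 6 * (m : ℝ) ^ 6 := by
    have : C ^ 3 ≤ C ^ 6 := pow_le_pow_right₀ hone (by norm_num)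
    have h2 : (0 : ℝ) ≤ (m : ℝ) ^ 6 := by positivity
    nlinarith [mul_le_mul_of_nonneg_left this h2]
  have h2 : 16 * (m : ℝ) ^ 2 * C ^ 2 * ((m : ℝ) ^ 4 * C ^ 4) ≤ 16 * C ^ 6 * (m : ℝ) ^ 6 :=
    le_of_eq (by ring)
  calc _ ≤ 16 * (16 * C ^ 6 * (m : ℝ) ^ 6) := by gcongr; exact max_le h1 h2
    _ = _ := by ring

end Single

/-! ### Almost sure limits as the number of paths grows -/

section Sequence

variable {X : ℕ → ι → Ω → ℂ} {σ : ℕ → Set ι → MeasurableSpace Ω} {s : ℕ → ι → ℝ} {C : ℝ}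
  (h : ∀ l, IsGainField P (X l) (σ l) (s l) C)
include h

lemma ae_tendsto_energy {e : ℕ → ι} (he : Function.Injective e) {m : ℕ → ℕ} (hm : ∀ l, m l ≤ l) :
    ∀ᵐ ω ∂P, Tendsto (fun l : ℕ => (∑ a ∈ Finset.range (m l), ‖X l (e a) ω‖ ^ 2
      - ∑ a ∈ Finset.range (m l), s l (e a)) / (l : ℝ)) atTop (𝓝 0) := by
  filter_upwards [ae_tendsto_of_fourthMoment_pow 0 fun l => (h l).fourth_energy he (hm l)] with ω hω
  have := (Complex.continuous_re.tendsto _).comp hω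
  refine this.congr fun l => ?_
  simp only [Function.comp, zero_add, pow_one]
  rw [← Complex.ofReal_sum, ← Complex.ofReal_natCast, ← Complex.ofReal_div, Complex.ofReal_re,
    Finset.sum_sub_distrib]

lemma ae_tendsto_correlation {e e' : ℕ → ι} (he : Function.Injective e)
    (hee' : ∀ n n', e n ≠ e' n') {m : ℕ → ℕ} (hm : ∀ l, m l ≤ l) :
    ∀ᵐ ω ∂P, Tendsto (fun l : ℕ => ‖∑ a ∈ Finset.range (m l),
      (starRingEnd ℂ) (X l (e a) ω) * X l (e' a) ω‖ ^ 2 / (l : ℝ) ^ 2) atTop (𝓝 0) := by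
  filter_upwards [ae_tendsto_of_fourthMoment_pow 0 fun l =>
    (h l).fourth_correlation he hee' (hm l)] with ω hω
  have := hω.norm.pow 2
  simp only [norm_zero, zero_pow two_ne_zero] at this
  refine this.congr fun l => ?_
  rw [norm_div, div_pow, zero_add, pow_one, Complex.norm_natCast]

lemma ae_tendsto_sum_energy_mul {e e' : ℕ → ι} (hee' : ∀ n n', e n ≠ e' n') {m : ℕ → ℕ}
    (hm : ∀ l, m l ≤ l) :
    ∀ᵐ ω ∂P, Tendsto (fun l : ℕ => (∑ a ∈ Finset.range (m l),
      ‖X l (e a) ω‖ ^ 2 * ‖X l (e' a) ω‖ ^ 2) / (l : ℝ) ^ 2) atTop (𝓝 0) := by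
  filter_upwards [ae_tendsto_of_fourthMoment_pow 1 fun l =>
    (h l).fourth_sum_energy_mul hee' (hm l)] with ω hω
  have := (Complex.continuous_re.tendsto _).comp hω
  refine this.congr fun l => ?_
  simp only [Function.comp]
  rw [← Complex.ofReal_sum, ← Complex.ofReal_natCast, ← Complex.ofReal_pow, ← Complex.ofReal_div,
    Complex.ofReal_re]

lemma ae_tendsto_diag {e : ℕ → ι} (he : Function.Injective e) {κ : ℕ → ℕ → ℕ → ℝ}
    (hκ : ∀ l a b, |κ l a b| ≤ 1) :
    ∀ᵐ ω ∂P, Tendsto (fun l : ℕ => (∑ a ∈ Finset.range l, ∑ b ∈ Finset.range a,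
      κ l a b * (‖X l (e a) ω‖ ^ 2 * ‖X l (e b) ω‖ ^ 2 - s l (e a) * s l (e b))) / (l : ℝ) ^ 2)
      atTop (𝓝 0) := by
  filter_upwards [ae_tendsto_of_fourthMoment_pow 1 fun l => (h l).fourth_diag he (hκ l) l]
    with ω hω
  have := (Complex.continuous_re.tendsto _).comp hω
  refine this.congr fun l => ?_
  simp only [Function.comp]
  simp only [← Complex.ofReal_sum]
  rw [← Complex.ofReal_natCast, ← Complex.ofReal_pow, ← Complex.ofReal_div, Complex.ofReal_re]

lemma ae_tendsto_offDiag {e e' : ℕ → ι} (he : Function.Injective e)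
    (he' : Function.Injective e') (hee' : e = e' ∨ ∀ n n', e n ≠ e' n') {κ : ℕ → ℕ → ℕ → ℕ → ℝ}
    (hκ : ∀ l a b c, |κ l a b c| ≤ 1) (hκ0 : ∀ l a b c, κ l a b c ≠ 0 → a ≤ c + b) :
    ∀ᵐ ω ∂P, Tendsto (fun l : ℕ =>
      (offDiag (κ l) l (fun n => X l (e n) ω) (fun n => X l (e' n) ω)).re / (l : ℝ) ^ 2)
      atTop (𝓝 0) := by
  have hm : ∀ l, HasFourthMoment P
      (fun ω => offDiag (κ l) l (fun n => X l (e n) ω) (fun n => X l (e' n) ω))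
      (2 ^ 20 * C ^ 7 * (l : ℝ) ^ (4 * 1 + 2)) := by
    intro l
    rcases hee' with rfl | hee'
    · exact ((h l).offDiag_self (hκ l) (hκ0 l) he l).mono (le_of_eq (by ring))
    · exact ((h l).offDiag_cross (hκ l) (hκ0 l) he he' hee' l).mono (le_of_eq (by ring))
  filter_upwards [ae_tendsto_of_fourthMoment_pow 1 hm] with ω hω
  have := (Complex.continuous_re.tendsto _).comp hω
  refine this.congr fun l => ?_
  simp only [Function.comp]
  rw [← Complex.ofReal_natCast, ← Complex.ofReal_pow, Complex.div_ofReal_re]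

end Sequence

end IsGainField

end AlmostSure

/-! ### The interference gains as sums over lags -/

section Algebra

/-- Extension of a finite vector by zero. -/
noncomputable def extend {L : ℕ} (x : Fin L → ℂ) (l : ℕ) : ℂ := if h : l < L then x ⟨l, h⟩ else 0

lemma extend_of_ge {L : ℕ} (x : Fin L → ℂ) {l : ℕ} (h : L ≤ l) : extend x l = 0 :=
  dif_neg (not_lt.2 h)

lemma extend_val {L : ℕ} (x : Fin L → ℂ) (l : Fin L) : extend x l = x l := dif_pos l.2

lemma norm_sum_sq (u : ℕ → ℂ) (n : ℕ) : ‖∑ r ∈ Finset.range n, u r‖ ^ 2 =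
    ∑ r ∈ Finset.range n, ‖u r‖ ^ 2 +
      2 * ∑ r ∈ Finset.range n, ∑ r' ∈ Finset.range r, (u r * (starRingEnd ℂ) (u r')).re := by
  induction n with
  | zero => simp
  | succ n ih =>
    rw [Finset.sum_range_succ, Finset.sum_range_succ, Finset.sum_range_succ, Complex.sq_norm,
      Complex.normSq_add, ← Complex.sq_norm, ← Complex.sq_norm, ih]
    have : ((∑ x ∈ Finset.range n, u x) * (starRingEnd ℂ) (u n)).re
        = ∑ i ∈ Finset.range n, (u n * (starRingEnd ℂ) (u i)).re := by
      rw [Finset.sum_mul, Complex.re_sum]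
      refine Finset.sum_congr rfl fun i _ => ?_
      simp only [Complex.mul_re, Complex.conj_re, Complex.conj_im]; ring
    rw [this]; ring

/-- Coefficients of the off-diagonal part of a weighted sum of squared lagged correlations. -/
noncomputable def lagCoeff (φ : ℕ → ℝ) (w : ℕ → ℕ → ℝ) (a b c : ℕ) : ℝ :=
  if a ≤ c + b then φ (a - b) * w a b * w c (c + b - a) else 0

/-- Expanding each square at lag d over pairs r' ≤ r, the terms r' = r give products of energies.
For r' < r, the substitution a = r + d, b = r, c = r' + d gives r' = c + b - a with b ≤ a and c < a,
and these are the terms of `offDiag`. The lag 0 has weight zero, so b < a. -/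
lemma sum_lag_sq (φ : ℕ → ℝ) (hφ : φ 0 = 0) (w : ℕ → ℕ → ℝ) (L : ℕ) (x y : ℕ → ℂ)
    (hx : ∀ l, L ≤ l → x l = 0) :
    ∑ d ∈ Finset.range L, φ d * ‖∑ r ∈ Finset.range L,
        (w (r + d) r : ℂ) * ((starRingEnd ℂ) (x (r + d)) * y r)‖ ^ 2 =
      ∑ a ∈ Finset.range L, ∑ b ∈ Finset.range a,
        φ (a - b) * w a b ^ 2 * (‖x a‖ ^ 2 * ‖y b‖ ^ 2) +
      2 * (offDiag (lagCoeff φ w) L x y).re := by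
  -- For a = b + d the coefficients vanish when c < d, and c = d + r produces the pairs with r < b.
  have hin : ∀ d b, ∑ c ∈ Finset.range (b + d), (lagCoeff φ w (b + d) b c : ℂ) * y b * x c *
        (starRingEnd ℂ) (y (c + b - (b + d)))
      = ∑ r ∈ Finset.range b, (φ d * w (b + d) b * w (r + d) r : ℝ) * y b * x (r + d) *
        (starRingEnd ℂ) (y r) := by
    intro d b
    rw [add_comm b d, Finset.sum_range_add]
    have h0 : ∑ c ∈ Finset.range d, (lagCoeff φ w (d + b) b c : ℂ) * y b * x c *
        (starRingEnd ℂ) (y (c + b - (d + b))) = 0 := by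
      refine Finset.sum_eq_zero fun c hc => ?_
      have : ¬ d + b ≤ c + b := by have := Finset.mem_range.1 hc; omega
      simp [lagCoeff, this]
    rw [h0, zero_add]
    refine Finset.sum_congr rfl fun r _ => ?_
    have h1 : d + b ≤ d + r + b := by omega
    have h2 : d + r + b - (d + b) = r := by omega
    have h3 : d + b - b = d := by omega
    rw [lagCoeff, if_pos h1, h2, h3, add_comm d r]
  have hoff : (offDiag (lagCoeff φ w) L x y).re = ∑ d ∈ Finset.range L,
      ∑ b ∈ Finset.range (L - d), φ d * ∑ r ∈ Finset.range b,
        ((w (b + d) b : ℂ) * ((starRingEnd ℂ) (x (b + d)) * y b) *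
          (starRingEnd ℂ) ((w (r + d) r : ℂ) * ((starRingEnd ℂ) (x (r + d)) * y r))).re := by
    have htri := sum_triangle_eq L φ hφ fun a b => ∑ r ∈ Finset.range b,
        ((w a b : ℂ) * ((starRingEnd ℂ) (x a) * y b) *
          (starRingEnd ℂ) ((w (r + (a - b)) r : ℂ) *
            ((starRingEnd ℂ) (x (r + (a - b))) * y r))).re
    simp only [Nat.add_sub_cancel_left] at htri
    rw [← htri]
    · unfold offDiag
      rw [Complex.re_sum]
      refine Finset.sum_congr rfl fun a _ => ?_
      rw [Finset.mul_sum, Complex.re_sum]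
      refine Finset.sum_congr rfl fun b hb => ?_
      obtain ⟨d, rfl⟩ := Nat.exists_eq_add_of_le (Finset.mem_range.1 hb).le
      rw [hin d b, Finset.mul_sum, Complex.re_sum, Finset.mul_sum, Nat.add_sub_cancel_left]
      refine Finset.sum_congr rfl fun r _ => ?_
      rw [← Complex.re_ofReal_mul]
      congr 1
      simp only [map_mul, Complex.conj_ofReal, Complex.conj_conj]
      push_cast; ring
  have hdiag := sum_triangle_eq L φ hφ fun a b => w a b ^ 2 * (‖x a‖ ^ 2 * ‖y b‖ ^ 2)
  simp only [← mul_assoc] at hdiag ⊢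
  rw [hdiag, hoff, Finset.mul_sum, ← Finset.sum_add_distrib]
  refine Finset.sum_congr rfl fun d _ => ?_
  have hres : ∑ r ∈ Finset.range L, (w (r + d) r : ℂ) * (starRingEnd ℂ) (x (r + d)) * y r
      = ∑ r ∈ Finset.range (L - d), (w (r + d) r : ℂ) * (starRingEnd ℂ) (x (r + d)) * y r := by
    symm
    refine Finset.sum_subset (Finset.range_mono (Nat.sub_le _ _)) fun r _ hr => ?_
    rw [hx (r + d) (by rw [Finset.mem_range] at hr; omega)]
    simp
  rw [hres, norm_sum_sq, mul_add, ← Finset.mul_sum (Finset.range (L - d)) _ (φ d)]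
  congr 1
  · rw [Finset.mul_sum]
    refine Finset.sum_congr rfl fun r _ => ?_
    rw [norm_mul, norm_mul, Complex.norm_real, RCLike.norm_conj, mul_pow, mul_pow,
      Real.norm_eq_abs, sq_abs]
    ring
  · simp only [← mul_assoc]
    ring

/-- Column c carries the lag L - 1 - c. The triangular shape of the matrix is the vanishing of the
extended vector beyond its last entry. -/
lemma shiftMatrix_mulVec {L : ℕ} (x y : Fin L → ℂ) (c : Fin (L - 1)) :
    (shiftMatrix x).conjTranspose.mulVec y c = ∑ r ∈ Finset.range L,
      (starRingEnd ℂ) (extend x (r + (L - 1 - c))) * extend y r := by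
  rw [Finset.sum_range]
  unfold Matrix.mulVec dotProduct
  refine Finset.sum_congr rfl fun r _ => ?_
  change star (shiftMatrix x r c) * y r = _
  rw [extend_val]
  congr 1
  unfold shiftMatrix
  rw [Matrix.of_apply]
  congr 1
  have hc := c.2
  split_ifs with h
  · rw [extend, dif_pos (by omega)]
    congr 2
    omega
  · rw [extend_of_ge _ (by omega)]

lemma sum_lags {L : ℕ} (g : ℕ → ℝ) (hg : g 0 = 0) :
    ∑ c : Fin (L - 1), g (L - 1 - c) = ∑ d ∈ Finset.range L, g d := by
  rw [Fin.sum_univ_eq_sum_range (fun c => g (L - 1 - c)) (L - 1)]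
  rcases L with _ | L
  · simp
  · rw [Nat.add_sub_cancel, Finset.sum_range_succ' g, hg, add_zero,
      ← Finset.sum_range_reflect]
    refine Finset.sum_congr rfl fun c hc => ?_
    have := Finset.mem_range.1 hc
    congr 1; omega

/-- Weights that select the strictly positive lags. -/
noncomputable def posWeight (d : ℕ) : ℝ := if d = 0 then 0 else 1

/-- Membership of the first `m` fingers. -/
noncomputable def finger (m a : ℕ) : ℝ := if a < m then 1 else 0

/-! ### Signal and interference gains in terms of path energies -/

namespace Network

variable {K L : ℕ} (W : Network K L)

lemma extend_rake (k : Fin K) (l : ℕ) :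
    extend (W.rake k) l = (finger W.fingers l : ℂ) * extend (W.gain k) l := by
  unfold extend finger rake
  split_ifs with h1 h2 <;> simp [Matrix.mulVec_diagonal, *]

lemma hSP_eq (hLP : W.fingers ≤ L) (k : Fin K) :
    W.hSP k = ∑ a ∈ Finset.range W.fingers, ‖extend (W.gain k) a‖ ^ 2 := by
  unfold hSP dotProduct
  have e : ∑ a ∈ Finset.range W.fingers, ‖extend (W.gain k) a‖ ^ 2
      = ∑ a ∈ Finset.range L, finger W.fingers a * ‖extend (W.gain k) a‖ ^ 2 := by
    rw [← Finset.sum_subset (Finset.range_mono hLP)]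
    · refine Finset.sum_congr rfl fun a ha => ?_
      rw [finger, if_pos (Finset.mem_range.1 ha), one_mul]
    · intro a _ ha
      rw [finger, if_neg (by simpa using ha), zero_mul]
  rw [e, Finset.sum_range, Complex.re_sum]
  refine Finset.sum_congr rfl fun l _ => ?_
  have h := W.extend_rake k l
  rw [extend_val, extend_val] at h
  rw [extend_val, Pi.star_apply, h, RCLike.star_def, map_mul,
    Complex.conj_ofReal, mul_assoc, mul_comm ((starRingEnd ℂ) _), Complex.mul_conj,
    Complex.re_ofReal_mul, Complex.ofReal_re, Complex.sq_norm]

lemma hSP_nonneg (hLP : W.fingers ≤ L) (k : Fin K) : 0 ≤ W.hSP k := by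
  rw [W.hSP_eq hLP]; positivity

/-- Both summands correlate the same gains at the same lag, so they merge into one correlation whose
weight is the sum of the two finger indicators. -/
lemma vecNormSq_self (k : Fin K) :
    vecNormSq ((phiMatrix L W.pulses).mulVec
        ((shiftMatrix (W.rake k)).conjTranspose.mulVec (W.gain k) +
          (shiftMatrix (W.gain k)).conjTranspose.mulVec (W.rake k))) =
    ∑ a ∈ Finset.range L, ∑ b ∈ Finset.range a,
      lagWeight W.pulses (a - b) * (finger W.fingers a + finger W.fingers b) ^ 2 *
        (‖extend (W.gain k) a‖ ^ 2 * ‖extend (W.gain k) b‖ ^ 2) +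
      2 * (offDiag (lagCoeff (lagWeight W.pulses)
        fun a b => finger W.fingers a + finger W.fingers b) L
          (extend (W.gain k)) (extend (W.gain k))).re := by
  rw [← sum_lag_sq (lagWeight W.pulses) (by simp [lagWeight])
    (fun a b => finger W.fingers a + finger W.fingers b) L _ _ fun l hl => extend_of_ge _ hl]
  rw [← sum_lags _ (by simp [lagWeight])]
  unfold vecNormSq
  refine Finset.sum_congr rfl fun c _ => ?_
  rw [phiMatrix, Matrix.mulVec_diagonal, norm_mul, mul_pow, Complex.norm_real, Real.norm_eq_abs,
    sq_abs, Real.sq_sqrt (by positivity), Pi.add_apply, shiftMatrix_mulVec, shiftMatrix_mulVec,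
    ← Finset.sum_add_distrib]
  congr 1
  · unfold lagWeight
    rw [show L - 1 - (c : ℕ) = L - ((c : ℕ) + 1) by omega]
  · congr 2
    refine Finset.sum_congr rfl fun r _ => ?_
    rw [extend_rake, extend_rake, map_mul, Complex.conj_ofReal]
    push_cast; ring

lemma vecNormSq_rake_gain (k j : Fin K) :
    vecNormSq ((shiftMatrix (W.rake k)).conjTranspose.mulVec (W.gain j)) =
    ∑ a ∈ Finset.range L, ∑ b ∈ Finset.range a,
      posWeight (a - b) * finger W.fingers a ^ 2 *
        (‖extend (W.gain k) a‖ ^ 2 * ‖extend (W.gain j) b‖ ^ 2) +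
      2 * (offDiag (lagCoeff posWeight fun a _ => finger W.fingers a) L
          (extend (W.gain k)) (extend (W.gain j))).re := by
  rw [← sum_lag_sq posWeight (by simp [posWeight]) (fun a _ => finger W.fingers a) L _ _
    fun l hl => extend_of_ge _ hl]
  rw [← sum_lags _ (by simp [posWeight])]
  unfold vecNormSq
  refine Finset.sum_congr rfl fun c _ => ?_
  rw [shiftMatrix_mulVec, posWeight, if_neg (by have := c.2; omega), one_mul]
  congr 2
  refine Finset.sum_congr rfl fun r _ => ?_
  rw [extend_rake, map_mul, Complex.conj_ofReal, mul_assoc]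

lemma vecNormSq_gain_rake (k j : Fin K) :
    vecNormSq ((shiftMatrix (W.gain j)).conjTranspose.mulVec (W.rake k)) =
    ∑ a ∈ Finset.range L, ∑ b ∈ Finset.range a,
      posWeight (a - b) * finger W.fingers b ^ 2 *
        (‖extend (W.gain j) a‖ ^ 2 * ‖extend (W.gain k) b‖ ^ 2) +
      2 * (offDiag (lagCoeff posWeight fun _ b => finger W.fingers b) L
          (extend (W.gain j)) (extend (W.gain k))).re := by
  rw [← sum_lag_sq posWeight (by simp [posWeight]) (fun _ b => finger W.fingers b) L _ _
    fun l hl => extend_of_ge _ hl]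
  rw [← sum_lags _ (by simp [posWeight])]
  unfold vecNormSq
  refine Finset.sum_congr rfl fun c _ => ?_
  rw [shiftMatrix_mulVec, posWeight, if_neg (by have := c.2; omega), one_mul]
  congr 2
  refine Finset.sum_congr rfl fun r _ => ?_
  rw [extend_rake]
  ring

lemma correlation_eq (hLP : W.fingers ≤ L) (k j : Fin K) :
    star (W.rake k) ⬝ᵥ W.gain j = ∑ a ∈ Finset.range W.fingers,
      (starRingEnd ℂ) (extend (W.gain k) a) * extend (W.gain j) a := by
  have e : ∑ a ∈ Finset.range W.fingers,
      (starRingEnd ℂ) (extend (W.gain k) a) * extend (W.gain j) a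
      = ∑ a ∈ Finset.range L, (starRingEnd ℂ) (extend (W.rake k) a) * extend (W.gain j) a := by
    rw [← Finset.sum_subset (Finset.range_mono hLP)]
    · refine Finset.sum_congr rfl fun a ha => ?_
      rw [extend_rake, finger, if_pos (Finset.mem_range.1 ha)]; simp
    · intro a _ ha
      rw [extend_rake, finger, if_neg (by simpa using ha)]; simp
  rw [e, Finset.sum_range]
  unfold dotProduct
  refine Finset.sum_congr rfl fun l _ => ?_
  rw [extend_val, extend_val, Pi.star_apply, RCLike.star_def]

/-- The diagonal parts of the cross terms add up to a product of energies. -/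
lemma cross_diag_eq (m : ℕ) (u t : ℕ → ℝ) (hm : m ≤ L) :
    ∑ a ∈ Finset.range L, ∑ b ∈ Finset.range a, posWeight (a - b) * finger m a ^ 2 * (u a * t b) +
      ∑ a ∈ Finset.range L, ∑ b ∈ Finset.range a, posWeight (a - b) * finger m b ^ 2 * (t a * u b)
    = (∑ a ∈ Finset.range m, u a) * (∑ b ∈ Finset.range L, t b)
      - ∑ a ∈ Finset.range m, u a * t a := by
  have hf : ∀ g : ℕ → ℝ, ∑ a ∈ Finset.range m, g a = ∑ a ∈ Finset.range L, finger m a ^ 2 * g a := by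
    intro g
    rw [← Finset.sum_subset (Finset.range_mono hm)]
    · refine Finset.sum_congr rfl fun a ha => ?_
      rw [finger, if_pos (Finset.mem_range.1 ha)]; ring
    · intro a _ ha
      rw [finger, if_neg (by simpa using ha)]; ring
  have hw : ∀ a, ∀ b ∈ Finset.range a, posWeight (a - b) = 1 := by
    intro a b hb
    have := Finset.mem_range.1 hb
    rw [posWeight, if_neg (by omega)]
  rw [hf, hf, Finset.sum_mul_sum, sum_square_eq]
  have e1 : ∑ a ∈ Finset.range L, ∑ b ∈ Finset.range a,
      posWeight (a - b) * finger m a ^ 2 * (u a * t b)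
      = ∑ a ∈ Finset.range L, ∑ b ∈ Finset.range a, finger m a ^ 2 * u a * t b :=
    Finset.sum_congr rfl fun a _ => Finset.sum_congr rfl fun b hb => by rw [hw a b hb]; ring
  have e2 : ∑ a ∈ Finset.range L, ∑ b ∈ Finset.range a,
      posWeight (a - b) * finger m b ^ 2 * (t a * u b)
      = ∑ a ∈ Finset.range L, ∑ b ∈ Finset.range a, finger m b ^ 2 * u b * t a :=
    Finset.sum_congr rfl fun a _ => Finset.sum_congr rfl fun b hb => by rw [hw a b hb]; ring
  rw [e1, e2]
  simp only [mul_assoc]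
  ring

end Network

end Algebra

/-! ### Moments of circularly symmetric complex Gaussian variables -/

section Gaussian

/-- The law of two independent standard real Gaussian variables. -/
noncomputable def stdPair : Measure (ℝ × ℝ) := (gaussianReal 0 1).prod (gaussianReal 0 1)

lemma measurable_mk_complex : Measurable fun q : ℝ × ℝ => (⟨q.1, q.2⟩ : ℂ) :=
  Complex.measurableEquivRealProd.symm.measurable

/-- Scaling a single standard pair makes all moment bounds uniform in the variance. For negative s
both truncations give variance 0, so the identity remains true. -/
lemma circGaussian_eq (s : ℝ) : circGaussian s =
    stdPair.map fun q : ℝ × ℝ => ((√(s / 2) : ℝ) : ℂ) * (⟨q.1, q.2⟩ : ℂ) := by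
  have h1 : gaussianReal 0 (s / 2).toNNReal = (gaussianReal 0 1).map (√(s / 2) * ·) := by
    rw [gaussianReal_map_const_mul, mul_zero, mul_one]
    congr 1
    ext
    simp only [NNReal.coe_mk, Real.coe_toNNReal']
    rcases le_total 0 (s / 2) with h | h
    · rw [Real.sq_sqrt h, max_eq_left h]
    · rw [Real.sqrt_eq_zero_of_nonpos h, max_eq_right h]; norm_num
  unfold circGaussian
  rw [h1, Measure.map_prod_map _ _ (measurable_const_mul _) (measurable_const_mul _),
    Measure.map_map measurable_mk_complex
      ((measurable_const_mul _).prodMap (measurable_const_mul _))]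
  unfold stdPair
  congr 1
  funext q
  apply Complex.ext <;> simp

lemma integrable_fst_pow (n : ℕ) : Integrable (fun q : ℝ × ℝ => ‖q.1‖ ^ n) stdPair :=
  ((memLp_id_gaussianReal' (μ := 0) (v := 1) n (by simp)).integrable_norm_pow').comp_fst _

lemma integrable_snd_pow (n : ℕ) : Integrable (fun q : ℝ × ℝ => ‖q.2‖ ^ n) stdPair :=
  ((memLp_id_gaussianReal' (μ := 0) (v := 1) n (by simp)).integrable_norm_pow').comp_snd _

lemma integrable_stdPair_pow (n : ℕ) :
    Integrable (fun q : ℝ × ℝ => ‖(⟨q.1, q.2⟩ : ℂ)‖ ^ (n + 1)) stdPair := by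
  refine (((integrable_fst_pow (n + 1)).add (integrable_snd_pow (n + 1))).const_mul (2 ^ n)).mono'
    (measurable_mk_complex.norm.pow_const _).aestronglyMeasurable
    (Eventually.of_forall fun q => ?_)
  rw [Real.norm_of_nonneg (by positivity)]
  simp only [Pi.add_apply]
  have h1 : ‖(⟨q.1, q.2⟩ : ℂ)‖ ≤ ‖q.1‖ + ‖q.2‖ := Complex.norm_le_abs_re_add_abs_im _
  exact (pow_le_pow_left₀ (norm_nonneg _) h1 _).trans
    (add_pow_le (norm_nonneg _) (norm_nonneg _) (n + 1))

lemma integral_stdPair : ∫ q : ℝ × ℝ, (⟨q.1, q.2⟩ : ℂ) ∂stdPair = 0 := by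
  have hi : Integrable (fun q : ℝ × ℝ => (⟨q.1, q.2⟩ : ℂ)) stdPair := by
    rw [← integrable_norm_iff measurable_mk_complex.aestronglyMeasurable]
    simpa using integrable_stdPair_pow 0
  apply Complex.ext
  · have := integral_re hi
    simp only [RCLike.re_to_complex] at this
    rw [← this]
    unfold stdPair
    rw [integral_fun_fst (fun x : ℝ => x)]
    simp
  · have := integral_im hi
    simp only [RCLike.im_to_complex] at this
    rw [← this]
    unfold stdPair
    rw [integral_fun_snd (fun x : ℝ => x)]
    simp

lemma integral_stdPair_sq : ∫ q : ℝ × ℝ, ‖(⟨q.1, q.2⟩ : ℂ)‖ ^ 2 ∂stdPair = 2 := by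
  have hv : ∫ x, x ^ 2 ∂(gaussianReal 0 1) = 1 := by
    have h := variance_eq_integral (μ := gaussianReal 0 1) (X := fun x : ℝ => x) (by fun_prop)
    rw [variance_fun_id_gaussianReal] at h
    simpa using h.symm
  have e : ∀ q : ℝ × ℝ, ‖(⟨q.1, q.2⟩ : ℂ)‖ ^ 2 = ‖q.1‖ ^ 2 + ‖q.2‖ ^ 2 := fun q => by
    rw [Complex.sq_norm, Complex.normSq_mk, Real.norm_eq_abs, Real.norm_eq_abs, sq_abs, sq_abs]
    ring
  simp only [e]
  rw [integral_add (integrable_fst_pow 2) (integrable_snd_pow 2)]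
  simp only [Real.norm_eq_abs, sq_abs]
  unfold stdPair
  rw [integral_fun_fst (fun x : ℝ => x ^ 2), integral_fun_snd (fun x : ℝ => x ^ 2), hv]
  norm_num

/-- The eighth moment of the modulus of a pair of standard Gaussian variables. -/
noncomputable def eighthMoment : ℝ := ∫ q : ℝ × ℝ, ‖(⟨q.1, q.2⟩ : ℂ)‖ ^ 8 ∂stdPair

lemma eighthMoment_nonneg : 0 ≤ eighthMoment := integral_nonneg fun _ => by positivity

/-- A common bound on the moments of gains of variance at most `S`. -/
noncomputable def momentBound (S : ℝ) : ℝ := 1 + S + 8 * (S ^ 4 * eighthMoment) + 8 * S ^ 4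

variable {Ω : Type*} {mΩ : MeasurableSpace Ω} {P : Measure Ω} {Z : Ω → ℂ} {s S : ℝ}

section

variable (hZ : Measurable Z) (hlaw : P.map Z = circGaussian s)
include hZ hlaw

lemma integral_comp_gain {E : Type*} [NormedAddCommGroup E] [NormedSpace ℝ E]
    {g : ℂ → E} (hg : StronglyMeasurable g) : ∫ ω, g (Z ω) ∂P =
      ∫ q, g (((√(s / 2) : ℝ) : ℂ) * (⟨q.1, q.2⟩ : ℂ)) ∂stdPair := by
  rw [← integral_map hZ.aemeasurable hg.aestronglyMeasurable, hlaw, circGaussian_eq,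
    integral_map (measurable_mk_complex.const_mul _).aemeasurable hg.aestronglyMeasurable]

lemma integrable_comp_gain {E : Type*} [NormedAddCommGroup E]
    {g : ℂ → E} (hg : StronglyMeasurable g) : Integrable (fun ω => g (Z ω)) P ↔
      Integrable (fun q : ℝ × ℝ => g (((√(s / 2) : ℝ) : ℂ) * (⟨q.1, q.2⟩ : ℂ))) stdPair := by
  have h1 := integrable_map_measure (μ := P) (f := Z) (g := g) hg.aestronglyMeasurable
    hZ.aemeasurable
  rw [hlaw, circGaussian_eq, integrable_map_measure hg.aestronglyMeasurable
    (measurable_mk_complex.const_mul _).aemeasurable] at h1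
  exact h1.symm

lemma integral_gain : ∫ ω, Z ω ∂P = 0 := by
  rw [integral_comp_gain hZ hlaw (g := fun z => z) stronglyMeasurable_id, integral_const_mul,
    integral_stdPair, mul_zero]

lemma integral_gain_sq (hs : 0 ≤ s) : ∫ ω, ‖Z ω‖ ^ 2 ∂P = s := by
  rw [integral_comp_gain hZ hlaw (g := fun z => ‖z‖ ^ 2) (by fun_prop : Continuous fun z : ℂ => ‖z‖ ^ 2).stronglyMeasurable]
  simp only [norm_mul, mul_pow]
  rw [integral_const_mul, integral_stdPair_sq, Complex.norm_real, Real.norm_eq_abs, sq_abs,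
    Real.sq_sqrt (by linarith)]
  ring

lemma integrable_gain_pow (n : ℕ) : Integrable (fun ω => ‖Z ω‖ ^ (n + 1)) P := by
  rw [integrable_comp_gain hZ hlaw (g := fun z => ‖z‖ ^ (n + 1)) (by fun_prop : Continuous fun z : ℂ => ‖z‖ ^ (n + 1)).stronglyMeasurable]
  simp only [norm_mul, mul_pow]
  exact (integrable_stdPair_pow n).const_mul _

lemma integral_gain_eight_le (hs : 0 ≤ s) (hS : s ≤ S) :
    ∫ ω, ‖Z ω‖ ^ 8 ∂P ≤ S ^ 4 * eighthMoment := by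
  rw [integral_comp_gain hZ hlaw (g := fun z => ‖z‖ ^ 8) (by fun_prop : Continuous fun z : ℂ => ‖z‖ ^ 8).stronglyMeasurable]
  simp only [norm_mul, mul_pow]
  rw [integral_const_mul, Complex.norm_real, Real.norm_eq_abs]
  refine mul_le_mul_of_nonneg_right ?_ eighthMoment_nonneg
  have : |√(s / 2)| ^ 8 = (√(s / 2) ^ 2) ^ 4 := by
    rw [abs_of_nonneg (Real.sqrt_nonneg _)]; ring
  rw [this, Real.sq_sqrt (by linarith)]
  exact pow_le_pow_left₀ (by linarith) (by linarith) 4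

variable [IsProbabilityMeasure P]

lemma fourth_gain (hs : 0 ≤ s) (hS : s ≤ S) : HasFourthMoment P Z (momentBound S) := by
  have h4 := integrable_gain_pow hZ hlaw 3
  have h8 := integrable_gain_pow hZ hlaw 7
  refine ⟨hZ, h4, ?_⟩
  have h1 := integral_gain_eight_le hZ hlaw hs hS
  have h2 : ∫ ω, ‖Z ω‖ ^ 4 ∂P ≤ ∫ ω, (1 + ‖Z ω‖ ^ 8) ∂P :=
    integral_mono h4 ((integrable_const _).add h8) fun ω => by
      change ‖Z ω‖ ^ 4 ≤ 1 + ‖Z ω‖ ^ 8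
      nlinarith [sq_nonneg (‖Z ω‖ ^ 4 - 1)]
  rw [integral_add (integrable_const _) h8] at h2
  simp only [integral_const, probReal_univ, smul_eq_mul, one_mul] at h2
  have h3 : 0 ≤ S ^ 4 * eighthMoment := mul_nonneg (by positivity) eighthMoment_nonneg
  have h5 : 0 ≤ S ^ 4 := by positivity
  unfold momentBound
  linarith

lemma fourth_gain_sq (hs : 0 ≤ s) (hS : s ≤ S) :
    HasFourthMoment P (fun ω => Z ω ^ 2) (momentBound S) := by
  have e : ∀ ω, ‖Z ω ^ 2‖ ^ 4 = ‖Z ω‖ ^ 8 := fun ω => by rw [norm_pow]; ring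
  refine ⟨hZ.pow_const 2, ?_, ?_⟩
  · simp only [e]; exact integrable_gain_pow hZ hlaw 7
  · simp only [e]
    have h1 := integral_gain_eight_le hZ hlaw hs hS
    have h3 : 0 ≤ S ^ 4 * eighthMoment := mul_nonneg (by positivity) eighthMoment_nonneg
    have h5 : 0 ≤ S ^ 4 := by positivity
    unfold momentBound
    linarith

lemma integral_gain_dev (hs : 0 ≤ s) : ∫ ω, ((‖Z ω‖ ^ 2 - s : ℝ) : ℂ) ∂P = 0 := by
  rw [integral_complex_ofReal, integral_sub (integrable_gain_pow hZ hlaw 1) (integrable_const _),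
    integral_gain_sq hZ hlaw hs]
  simp

lemma fourth_gain_dev (hs : 0 ≤ s) (hS : s ≤ S) :
    HasFourthMoment P (fun ω => ((‖Z ω‖ ^ 2 - s : ℝ) : ℂ)) (momentBound S) := by
  have h8 := integrable_gain_pow hZ hlaw 7
  have hm : Measurable fun ω => ((‖Z ω‖ ^ 2 - s : ℝ) : ℂ) :=
    Complex.measurable_ofReal.comp ((hZ.norm.pow_const 2).sub_const s)
  have hle : ∀ ω, ‖((‖Z ω‖ ^ 2 - s : ℝ) : ℂ)‖ ^ 4 ≤ 8 * ‖Z ω‖ ^ 8 + 8 * S ^ 4 := fun ω => by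
    rw [Complex.norm_real, Real.norm_eq_abs]
    have h0 : 0 ≤ ‖Z ω‖ ^ 2 := by positivity
    have h1 : |‖Z ω‖ ^ 2 - s| ≤ ‖Z ω‖ ^ 2 + S := by rw [abs_le]; constructor <;> linarith
    have h2 := (pow_le_pow_left₀ (abs_nonneg _) h1 4).trans (add_pow_le h0 (hs.trans hS) 4)
    have e : (‖Z ω‖ ^ 2) ^ 4 = ‖Z ω‖ ^ 8 := by ring
    rw [e] at h2
    norm_num at h2
    linarith
  have hb : Integrable (fun ω => 8 * ‖Z ω‖ ^ 8 + 8 * S ^ 4) P :=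
    (h8.const_mul 8).add (integrable_const _)
  have hint : Integrable (fun ω => ‖((‖Z ω‖ ^ 2 - s : ℝ) : ℂ)‖ ^ 4) P :=
    hb.mono' (hm.norm.pow_const 4).aestronglyMeasurable (Eventually.of_forall fun ω => by
      rw [Real.norm_of_nonneg (by positivity)]; exact hle ω)
  refine ⟨hm, hint, (integral_mono hint hb hle).trans ?_⟩
  rw [integral_add (h8.const_mul 8) (integrable_const _), integral_const_mul]
  simp only [integral_const, probReal_univ, smul_eq_mul, one_mul]
  have h1 := integral_gain_eight_le hZ hlaw hs hS
  unfold momentBound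
  linarith [hs.trans hS]

end

end Gaussian

/-! ### The channel as a field of independent gains -/

section Channel

variable {Ω : Type*} {mΩ : MeasurableSpace Ω} {P : Measure Ω} [IsProbabilityMeasure P] {K : ℕ}
  {v : Fin K → ℝ} {Ψ : ℝ} {α : (L : ℕ) → Fin K → Fin L → Ω → ℂ}

/-- The gains of all users, extended by zero. -/
noncomputable def gains {Ω : Type*} {K : ℕ} (α : (L : ℕ) → Fin K → Fin L → Ω → ℂ) (L : ℕ)
    (i : Fin K × ℕ) (ω : Ω) : ℂ := extend (fun l => α L i.1 l ω) i.2

/-- The variances of `gains`. -/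
noncomputable def gainVar {K : ℕ} (v : Fin K → ℝ) (Ψ : ℝ) (L : ℕ) (i : Fin K × ℕ) : ℝ :=
  if i.2 < L then v i.1 * profile Ψ L i.2 else 0

/-- The σ-algebra generated by the gains with index in `T`. -/
@[reducible] noncomputable def gainAlgebra {Ω : Type*} {K : ℕ} (α : (L : ℕ) → Fin K → Fin L → Ω → ℂ) (L : ℕ)
    (T : Set (Fin K × ℕ)) : MeasurableSpace Ω :=
  ⨆ i ∈ {i : Fin K × Fin L | (i.1, (i.2 : ℕ)) ∈ T},
    MeasurableSpace.comap (α L i.1 i.2) inferInstance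

/-- A measurable version of the channel. -/
lemma IsChannel.exists_measurable (hα : IsChannel P v Ψ α) :
    ∃ α' : (L : ℕ) → Fin K → Fin L → Ω → ℂ, IsChannel P v Ψ α' ∧
      (∀ L k l, Measurable (α' L k l)) ∧ ∀ᵐ ω ∂P, ∀ L k l, α L k l ω = α' L k l ω := by
  have hae : ∀ L k l, α L k l =ᵐ[P] (hα.law L k l).aemeasurable.mk (α L k l) := fun L k l =>
    (hα.law L k l).aemeasurable.ae_eq_mk
  refine ⟨fun L k l => (hα.law L k l).aemeasurable.mk (α L k l), ⟨fun L => ?_, fun L k l => ?_⟩,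
    fun L k l => (hα.law L k l).aemeasurable.measurable_mk, ?_⟩
  · exact (hα.indep L).congr fun i => hae L i.1 i.2
  · exact (hα.law L k l).congr (hae L k l).symm
  -- There are only countably many gains over all L, so the exceptional sets add up to a null set.
  · rw [ae_all_iff]; intro L
    rw [ae_all_iff]; intro k
    rw [ae_all_iff]; intro l
    exact hae L k l

/-- A bound on the variances. -/
noncomputable def varBound {K : ℕ} (v : Fin K → ℝ) (Ψ : ℝ) : ℝ := (∑ k, v k) * max 1 Ψ⁻¹

lemma varBound_nonneg (hv : ∀ k, 0 < v k) : 0 ≤ varBound v Ψ :=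
  mul_nonneg (Finset.sum_nonneg fun k _ => (hv k).le) (zero_le_one.trans (le_max_left _ _))

lemma gainVar_nonneg (hΨ : 0 < Ψ) (hv : ∀ k, 0 < v k) (L : ℕ) (i : Fin K × ℕ) :
    0 ≤ gainVar v Ψ L i := by
  unfold gainVar
  split_ifs
  · exact mul_nonneg (hv _).le (profile_pos hΨ _ _).le
  · exact le_rfl

lemma gainVar_le (hΨ : 0 < Ψ) (hv : ∀ k, 0 < v k) (L : ℕ) (i : Fin K × ℕ) :
    gainVar v Ψ L i ≤ varBound v Ψ := by
  unfold gainVar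
  split_ifs with h
  · exact mul_le_mul (Finset.single_le_sum (fun k _ => (hv k).le) (Finset.mem_univ i.1))
      (profile_le hΨ h) (profile_pos hΨ _ _).le (Finset.sum_nonneg fun k _ => (hv k).le)
  · exact varBound_nonneg hv

/-- Paths beyond L have gain and variance 0 and satisfy every condition trivially. For the others,
independence from a set of gains is that of families over disjoint index sets, and the moments come
from the Gaussian law with variances bounded uniformly in L. -/
lemma IsChannel.isGainField (hα : IsChannel P v Ψ α) (hm : ∀ L k l, Measurable (α L k l))
    (hΨ : 0 < Ψ) (hv : ∀ k, 0 < v k) (L : ℕ) :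
    IsGainField P (gains α L) (gainAlgebra α L) (gainVar v Ψ L) (momentBound (varBound v Ψ)) := by
  have hS := varBound_nonneg (Ψ := Ψ) hv
  have hS4 : 0 ≤ varBound v Ψ ^ 4 := by positivity
  have hC1 : 1 + varBound v Ψ ≤ momentBound (varBound v Ψ) := by
    have := mul_nonneg hS4 eighthMoment_nonneg
    unfold momentBound; linarith
  have hC0 : 0 ≤ momentBound (varBound v Ψ) := by linarith
  have hin : ∀ i : Fin K × ℕ, ∀ h : i.2 < L, gains α L i = α L i.1 ⟨i.2, h⟩ ∧
      P.map (α L i.1 ⟨i.2, h⟩) = circGaussian (gainVar v Ψ L i) := fun i h => by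
    refine ⟨?_, ?_⟩
    · funext ω; exact dif_pos h
    · rw [(hα.law L i.1 ⟨i.2, h⟩).map_eq, gainVar, if_pos h]; rfl
  have hout : ∀ i : Fin K × ℕ, ¬ i.2 < L → gains α L i = fun _ => 0 := fun i h => by
    funext ω; exact dif_neg h
  have hout' : ∀ i : Fin K × ℕ, ¬ i.2 < L → gainVar v Ψ L i = 0 := fun i h => if_neg h
  have hs := gainVar_nonneg hΨ hv L
  have hs' := gainVar_le hΨ hv L
  refine ⟨?_, ?_, ?_, by linarith, ?_, ?_, ?_, ?_, ?_, ?_⟩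
  · intro T T' hT
    exact biSup_mono fun i hi => hT hi
  · intro T i hi
    by_cases h : i.2 < L
    · rw [(hin i h).1]
      refine Measurable.mono (comap_measurable _) ?_ le_rfl
      exact le_biSup (fun i : Fin K × Fin L =>
        MeasurableSpace.comap (α L i.1 i.2) inferInstance)
        (show (i.1, (⟨i.2, h⟩ : Fin L)) ∈ {i : Fin K × Fin L | (i.1, (i.2 : ℕ)) ∈ T} from hi)
    · rw [hout i h]; exact measurable_const
  · intro T i hi
    by_cases h : i.2 < L
    · rw [(hin i h).1]
      have h1 := indep_iSup_of_disjoint (fun i : Fin K × Fin L => (hm L i.1 i.2).comap_le)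
        (hα.indep L).iIndep (S := {(i.1, (⟨i.2, h⟩ : Fin L))})
        (T := {i : Fin K × Fin L | (i.1, (i.2 : ℕ)) ∈ T})
        (Set.disjoint_singleton_left.2 hi)
      rw [iSup_singleton] at h1
      exact h1
    · rw [hout i h, MeasurableSpace.comap_const]
      exact indep_bot_left _
  · intro i
    by_cases h : i.2 < L
    · rw [(hin i h).1]; exact integral_gain (hm _ _ _) (hin i h).2
    · rw [hout i h]; simp
  · intro i
    by_cases h : i.2 < L
    · rw [(hin i h).1]; exact fourth_gain (hm _ _ _) (hin i h).2 (hs i) (hs' i)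
    · rw [hout i h]; exact (HasFourthMoment.zero P).mono hC0
  · intro i
    by_cases h : i.2 < L
    · rw [(hin i h).1]; exact fourth_gain_sq (hm _ _ _) (hin i h).2 (hs i) (hs' i)
    · rw [hout i h]
      simpa using (HasFourthMoment.zero P).mono hC0
  · intro i
    by_cases h : i.2 < L
    · rw [(hin i h).1]; exact integral_gain_dev (hm _ _ _) (hin i h).2 (hs i)
    · rw [hout i h, hout' i h]; simp
  · intro i
    by_cases h : i.2 < L
    · rw [(hin i h).1]; exact fourth_gain_dev (hm _ _ _) (hin i h).2 (hs i) (hs' i)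
    · rw [hout i h, hout' i h]
      simpa using (HasFourthMoment.zero P).mono hC0
  · intro i
    rw [abs_of_nonneg (hs i)]
    linarith [hs' i]

end Channel

/-! ### Typical outcomes of the channel -/

section Typical

lemma finger_nonneg (m a : ℕ) : 0 ≤ finger m a := by unfold finger; split_ifs <;> norm_num

lemma finger_le_one (m a : ℕ) : finger m a ≤ 1 := by unfold finger; split_ifs <;> norm_num

lemma abs_lagCoeff_le {φ : ℕ → ℝ} {w : ℕ → ℕ → ℝ} (hφ : ∀ d, |φ d| ≤ 1) (hw : ∀ a b, |w a b| ≤ 1)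
    (a b c : ℕ) : |lagCoeff φ w a b c| ≤ 1 := by
  unfold lagCoeff
  split_ifs
  · rw [abs_mul, abs_mul]
    exact mul_le_one₀ (mul_le_one₀ (hφ _) (abs_nonneg _) (hw _ _)) (abs_nonneg _) (hw _ _)
  · simp

lemma le_of_lagCoeff_ne_zero {φ : ℕ → ℝ} {w : ℕ → ℕ → ℝ} {a b c : ℕ}
    (h : lagCoeff φ w a b c ≠ 0) : a ≤ c + b := by
  by_contra hc
  exact h (if_neg hc)

lemma abs_posWeight_le (d : ℕ) : |posWeight d| ≤ 1 := by unfold posWeight; split_ifs <;> simp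

lemma abs_lagWeight_le (Nc d : ℕ) : |lagWeight Nc d| ≤ 1 := by
  rw [abs_of_nonneg (lagWeight_nonneg _ _)]; exact lagWeight_le_one _ _

/-- The mean of the finger indicators of two paths. -/
noncomputable def fingerMean (m a b : ℕ) : ℝ := (finger m a + finger m b) / 2

lemma abs_finger_le (m a : ℕ) : |finger m a| ≤ 1 := by
  rw [abs_of_nonneg (finger_nonneg _ _)]; exact finger_le_one _ _

lemma abs_fingerMean_le (m a b : ℕ) : |fingerMean m a b| ≤ 1 := by
  have h1 := finger_nonneg m a
  have h2 := finger_nonneg m b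
  have h3 := finger_le_one m a
  have h4 := finger_le_one m b
  unfold fingerMean
  rw [abs_of_nonneg (by linarith)]; linarith

/-- The weights of the self-interference can reach 2, while the moment bounds want coefficients at
most 1; halving the two weights costs the factor 4. -/
lemma offDiag_finger (φ : ℕ → ℝ) (m L : ℕ) (x y : ℕ → ℂ) :
    offDiag (lagCoeff φ fun a b => finger m a + finger m b) L x y
      = ((4 : ℝ) : ℂ) * offDiag (lagCoeff φ (fingerMean m)) L x y := by
  have e : ∀ a b c, lagCoeff φ (fun a b => finger m a + finger m b) a b c
      = 4 * lagCoeff φ (fingerMean m) a b c := fun a b c => by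
    unfold lagCoeff fingerMean
    split_ifs <;> ring
  unfold offDiag
  simp only [e, Finset.mul_sum]
  refine Finset.sum_congr rfl fun a _ => Finset.sum_congr rfl fun b _ =>
    Finset.sum_congr rfl fun c _ => ?_
  push_cast; ring

/-- Outcomes for which all the laws of large numbers used below hold; for `l` paths there are
`lp l` fingers and `nc l` pulse positions. -/
structure IsTypical {K : ℕ} (lp nc : ℕ → ℕ) (s : ℕ → Fin K × ℕ → ℝ) (g : ℕ → Fin K × ℕ → ℂ) :
    Prop where
  energy : ∀ k, Tendsto (fun l : ℕ => (∑ a ∈ Finset.range (lp l), ‖g l (k, a)‖ ^ 2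
    - ∑ a ∈ Finset.range (lp l), s l (k, a)) / (l : ℝ)) atTop (𝓝 0)
  energy_all : ∀ k, Tendsto (fun l : ℕ => (∑ a ∈ Finset.range l, ‖g l (k, a)‖ ^ 2
    - ∑ a ∈ Finset.range l, s l (k, a)) / (l : ℝ)) atTop (𝓝 0)
  correlation : ∀ k j, j ≠ k → Tendsto (fun l : ℕ => ‖∑ a ∈ Finset.range (lp l),
      (starRingEnd ℂ) (g l (k, a)) * g l (j, a)‖ ^ 2 / (l : ℝ) ^ 2) atTop (𝓝 0)
  product : ∀ k j, j ≠ k → Tendsto (fun l : ℕ => (∑ a ∈ Finset.range (lp l),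
      ‖g l (k, a)‖ ^ 2 * ‖g l (j, a)‖ ^ 2) / (l : ℝ) ^ 2) atTop (𝓝 0)
  diag : ∀ k, Tendsto (fun l : ℕ => (∑ a ∈ Finset.range l, ∑ b ∈ Finset.range a,
      lagWeight (nc l) (a - b) * fingerMean (lp l) a b ^ 2 *
        (‖g l (k, a)‖ ^ 2 * ‖g l (k, b)‖ ^ 2 - s l (k, a) * s l (k, b))) / (l : ℝ) ^ 2)
      atTop (𝓝 0)
  off_self : ∀ k, Tendsto (fun l : ℕ => (offDiag (lagCoeff (lagWeight (nc l)) (fingerMean (lp l))) l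
      (fun n => g l (k, n)) (fun n => g l (k, n))).re / (l : ℝ) ^ 2) atTop (𝓝 0)
  off_rake_gain : ∀ k j, j ≠ k → Tendsto (fun l : ℕ =>
      (offDiag (lagCoeff posWeight fun a _ => finger (lp l) a) l
      (fun n => g l (k, n)) (fun n => g l (j, n))).re / (l : ℝ) ^ 2) atTop (𝓝 0)
  off_gain_rake : ∀ k j, j ≠ k → Tendsto (fun l : ℕ =>
      (offDiag (lagCoeff posWeight fun _ b => finger (lp l) b) l
      (fun n => g l (j, n)) (fun n => g l (k, n))).re / (l : ℝ) ^ 2) atTop (𝓝 0)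

lemma ae_isTypical {Ω : Type*} {mΩ : MeasurableSpace Ω} {P : Measure Ω} [IsProbabilityMeasure P]
    {K : ℕ} {X : ℕ → Fin K × ℕ → Ω → ℂ} {σ : ℕ → Set (Fin K × ℕ) → MeasurableSpace Ω}
    {s : ℕ → Fin K × ℕ → ℝ} {C : ℝ} (h : ∀ l, IsGainField P (X l) (σ l) (s l) C)
    {lp nc : ℕ → ℕ} (hlp : ∀ l, lp l ≤ l) :
    ∀ᵐ ω ∂P, IsTypical lp nc s fun l i => X l i ω := by
  have he : ∀ k : Fin K, Function.Injective fun n : ℕ => (k, n) := fun k n n' hn =>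
    (Prod.mk.inj hn).2
  have hne : ∀ k j : Fin K, j ≠ k → ∀ n n' : ℕ, (k, n) ≠ (j, n') := fun k j hjk n n' hn =>
    hjk (Prod.mk.inj hn).1.symm
  have h1 := ae_all_iff.2 fun k => IsGainField.ae_tendsto_energy h (he k) hlp
  have h2 := ae_all_iff.2 fun k => IsGainField.ae_tendsto_energy h (he k) (m := fun l => l)
    fun l => le_rfl
  have h3 := ae_all_iff.2 fun k => ae_all_iff.2 fun j => ae_all_iff.2 fun hjk : j ≠ k =>
    IsGainField.ae_tendsto_correlation h (he k) (hne k j hjk) hlp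
  have h4 := ae_all_iff.2 fun k => ae_all_iff.2 fun j => ae_all_iff.2 fun hjk : j ≠ k =>
    IsGainField.ae_tendsto_sum_energy_mul h (hne k j hjk) hlp
  have h5 := ae_all_iff.2 fun k => IsGainField.ae_tendsto_diag h (he k)
    (κ := fun l a b => lagWeight (nc l) (a - b) * fingerMean (lp l) a b ^ 2) fun l a b => by
      rw [abs_mul, abs_pow]
      exact mul_le_one₀ (abs_lagWeight_le _ _) (by positivity)
        (pow_le_one₀ (abs_nonneg _) (abs_fingerMean_le _ _ _))
  have h6 := ae_all_iff.2 fun k => IsGainField.ae_tendsto_offDiag h (he k) (he k) (Or.inl rfl)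
    (κ := fun l => lagCoeff (lagWeight (nc l)) (fingerMean (lp l)))
    (fun l => abs_lagCoeff_le (abs_lagWeight_le _) (abs_fingerMean_le _))
    (fun l a b c => le_of_lagCoeff_ne_zero)
  have h7 := ae_all_iff.2 fun k => ae_all_iff.2 fun j => ae_all_iff.2 fun hjk : j ≠ k =>
    IsGainField.ae_tendsto_offDiag h (he k) (he j) (Or.inr (hne k j hjk))
    (κ := fun l => lagCoeff posWeight fun a _ => finger (lp l) a)
    (fun l => abs_lagCoeff_le abs_posWeight_le fun a _ => abs_finger_le _ a)
    (fun l a b c => le_of_lagCoeff_ne_zero)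
  have h8 := ae_all_iff.2 fun k => ae_all_iff.2 fun j => ae_all_iff.2 fun hjk : j ≠ k =>
    IsGainField.ae_tendsto_offDiag h (he j) (he k) (Or.inr (hne j k hjk.symm))
    (κ := fun l => lagCoeff posWeight fun _ b => finger (lp l) b)
    (fun l => abs_lagCoeff_le abs_posWeight_le fun _ b => abs_finger_le _ b)
    (fun l a b c => le_of_lagCoeff_ne_zero)
  filter_upwards [h1, h2, h3, h4, h5, h6, h7, h8] with ω a1 a2 a3 a4 a5 a6 a7 a8
  exact ⟨a1, a2, a3, a4, a5, a6, a7, a8⟩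

/-- For b < a the squared weight is 4 if a < m, 1 if b < m ≤ a, and 0 if m ≤ b, that is 3 · [a < m]
+ 1 - [m ≤ b]. Multiplicativity of the profile turns the last sum into a translate on L - m paths.
This is the origin of the three terms of `nuInt`. -/
lemma sum_finger_sq (φ p : ℕ → ℝ) (hp : ∀ a b, p (a + b) = p a * p b) {L m : ℕ} (hm : m ≤ L) :
    ∑ a ∈ Finset.range L, ∑ b ∈ Finset.range a,
      φ (a - b) * (finger m a + finger m b) ^ 2 * (p a * p b) =
    3 * ∑ a ∈ Finset.range m, ∑ b ∈ Finset.range a, φ (a - b) * (p a * p b) +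
      ∑ a ∈ Finset.range L, ∑ b ∈ Finset.range a, φ (a - b) * (p a * p b) -
      p m ^ 2 * ∑ a ∈ Finset.range (L - m), ∑ b ∈ Finset.range a, φ (a - b) * (p a * p b) := by
  obtain ⟨r, rfl⟩ := Nat.exists_eq_add_of_le hm
  have h1 : ∀ a ∈ Finset.range m, ∑ b ∈ Finset.range a,
      φ (a - b) * (finger m a + finger m b) ^ 2 * (p a * p b)
      = 4 * ∑ b ∈ Finset.range a, φ (a - b) * (p a * p b) := fun a ha => by
    rw [Finset.mul_sum]
    refine Finset.sum_congr rfl fun b hb => ?_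
    have ha := Finset.mem_range.1 ha
    have hb := Finset.mem_range.1 hb
    rw [finger, finger, if_pos ha, if_pos (hb.trans ha)]; ring
  have h2 : ∀ a ∈ Finset.range r, ∑ b ∈ Finset.range (m + a),
      φ (m + a - b) * (finger m (m + a) + finger m b) ^ 2 * (p (m + a) * p b)
      = ∑ b ∈ Finset.range (m + a), φ (m + a - b) * (p (m + a) * p b)
        - p m ^ 2 * ∑ b ∈ Finset.range a, φ (a - b) * (p a * p b) := fun a _ => by
    have h0 : finger m (m + a) = 0 := if_neg (by omega)
    rw [Finset.sum_range_add, Finset.sum_range_add, h0]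
    have e1 : ∑ b ∈ Finset.range m, φ (m + a - b) * (0 + finger m b) ^ 2 * (p (m + a) * p b)
        = ∑ b ∈ Finset.range m, φ (m + a - b) * (p (m + a) * p b) := by
      refine Finset.sum_congr rfl fun b hb => ?_
      rw [finger, if_pos (Finset.mem_range.1 hb)]; ring
    have e2 : ∑ b ∈ Finset.range a,
        φ (m + a - (m + b)) * (0 + finger m (m + b)) ^ 2 * (p (m + a) * p (m + b)) = 0 := by
      refine Finset.sum_eq_zero fun b _ => ?_
      rw [finger, if_neg (by omega)]; ring
    have e3 : ∑ b ∈ Finset.range a, φ (m + a - (m + b)) * (p (m + a) * p (m + b))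
        = p m ^ 2 * ∑ b ∈ Finset.range a, φ (a - b) * (p a * p b) := by
      rw [Finset.mul_sum]
      refine Finset.sum_congr rfl fun b _ => ?_
      rw [Nat.add_sub_add_left, hp, hp]; ring
    rw [e1, e2, e3]; ring
  rw [Finset.sum_range_add, Finset.sum_range_add, Finset.sum_congr rfl h1, Finset.sum_congr rfl h2,
    Finset.sum_sub_distrib, ← Finset.mul_sum, ← Finset.mul_sum, Nat.add_sub_cancel_left]
  ring

end Typical

/-! ### Large systems at typical outcomes -/

section LargeSystem

variable {K : ℕ} {v : Fin K → ℝ} {Ψ ρ β : ℝ} {L LP Nc : ℕ → ℕ} {lp nc : ℕ → ℕ}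
  {g : ℕ → Fin K × ℕ → ℂ}

/-- The networks `W n` use `Nf` frames, `Nc n` pulse positions and `LP n = lp (L n)` fingers, and
their gains are those of the family `g` for `L n` paths. -/
structure IsRealization (W : (n : ℕ) → Network K (L n)) (Nf : ℕ) (Nc LP lp nc : ℕ → ℕ)
    (g : ℕ → Fin K × ℕ → ℂ) : Prop where
  frames : ∀ n, (W n).frames = Nf
  pulses : ∀ n, (W n).pulses = Nc n
  fingers : ∀ n, (W n).fingers = LP n
  gain : ∀ n k a, extend ((W n).gain k) a = g (L n) (k, a)
  lp_eq : ∀ n, lp (L n) = LP n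
  nc_eq : ∀ n, nc (L n) = Nc n

lemma sum_gainVar_range {m l : ℕ} (hm : m ≤ l) (k : Fin K) :
    ∑ a ∈ Finset.range m, gainVar v Ψ l (k, a) = v k * ∑ a ∈ Finset.range m, profile Ψ l a := by
  rw [Finset.mul_sum]
  refine Finset.sum_congr rfl fun a ha => ?_
  have := Finset.mem_range.1 ha
  rw [gainVar, if_pos (by dsimp only; omega)]

variable {W : (n : ℕ) → Network K (L n)} {Nf : ℕ}
  (hg : IsTypical lp nc (gainVar v Ψ) g) (hW : IsRealization W Nf Nc LP lp nc g)
  (hΨ : 0 < Ψ) (hρ : 0 < ρ) (hρ1 : ρ ≤ 1) (hβ : 0 < β) (hv : ∀ k, 0 < v k) (hNf : 0 < Nf)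
  (hL : Tendsto L atTop atTop)
  (hLP : ∀ n, (LP n : ℝ) = ρ * (L n : ℝ)) (hNc : ∀ n, (Nc n : ℝ) = β * (L n : ℝ))

include hρ1 hLP in
lemma fingers_le (n : ℕ) : LP n ≤ L n := by
  have : (LP n : ℝ) ≤ L n := by
    rw [hLP]; exact mul_le_of_le_one_left (by positivity) hρ1
  exact_mod_cast this

include hL hLP in
lemma tendsto_fingers : Tendsto (fun n => (LP n : ℝ) / L n) atTop (𝓝 ρ) := by
  refine tendsto_const_nhds.congr' ?_
  filter_upwards [hL.eventually_gt_atTop 0] with n hn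
  have : (0 : ℝ) < L n := by exact_mod_cast hn
  rw [hLP]; field_simp

include hg hW hΨ hρ hρ1 hL hLP in
lemma tendsto_hSP_div (k : Fin K) :
    Tendsto (fun n => (W n).hSP k / L n) atTop (𝓝 (v k * energyInt (Real.log Ψ) ρ)) := by
  have hle := fingers_le hρ1 hLP
  have h1 := (hg.energy k).comp hL
  have h2 := (tendsto_energy hΨ hL hρ.le hle (tendsto_fingers hL hLP)).const_mul (v k)
  have h3 := h1.add h2
  rw [zero_add] at h3
  refine h3.congr fun n => ?_
  simp only [Function.comp]
  rw [(W n).hSP_eq (by rw [hW.fingers]; exact hle n), hW.fingers, hW.lp_eq,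
    sum_gainVar_range (hle n), ← mul_div_assoc, ← add_div]
  simp only [hW.gain]
  ring

include hg hW hΨ hL in
lemma tendsto_energy_all (k : Fin K) :
    Tendsto (fun n => (∑ a ∈ Finset.range (L n), ‖extend ((W n).gain k) a‖ ^ 2) / L n) atTop
      (𝓝 (v k * energyInt (Real.log Ψ) 1)) := by
  have h0 : Tendsto (fun n => (L n : ℝ) / L n) atTop (𝓝 1) := by
    refine tendsto_const_nhds.congr' ?_
    filter_upwards [hL.eventually_gt_atTop 0] with n hn
    have : (0 : ℝ) < L n := by exact_mod_cast hn
    field_simp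
  have h1 := (hg.energy_all k).comp hL
  have h2 := (tendsto_energy hΨ hL zero_le_one (fun _ => le_rfl) h0).const_mul (v k)
  have h3 := h1.add h2
  rw [zero_add] at h3
  refine h3.congr fun n => ?_
  simp only [Function.comp]
  rw [sum_gainVar_range le_rfl, ← mul_div_assoc, ← add_div]
  simp only [hW.gain]
  ring

include hg hW hΨ hρ hρ1 hβ hL hLP hNc in
lemma tendsto_vecNormSq_self (k : Fin K) :
    Tendsto (fun n => vecNormSq ((phiMatrix (L n) (W n).pulses).mulVec
        ((shiftMatrix ((W n).rake k)).conjTranspose.mulVec ((W n).gain k) +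
          (shiftMatrix ((W n).gain k)).conjTranspose.mulVec ((W n).rake k))) / (L n : ℝ) ^ 2) atTop
      (𝓝 (v k ^ 2 * (3 * lagInt (Real.log Ψ) β ρ + lagInt (Real.log Ψ) β 1
        - Real.exp (-(Real.log Ψ * ρ)) ^ 2 * lagInt (Real.log Ψ) β (1 - ρ)))) := by
  have hle := fingers_le hρ1 hLP
  have hfin := tendsto_fingers hL hLP
  have h0 : Tendsto (fun n => (L n : ℝ) / L n) atTop (𝓝 1) := by
    refine tendsto_const_nhds.congr' ?_
    filter_upwards [hL.eventually_gt_atTop 0] with n hn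
    have : (0 : ℝ) < L n := by exact_mod_cast hn
    field_simp
  have hsub : Tendsto (fun n => ((L n - LP n : ℕ) : ℝ) / L n) atTop (𝓝 (1 - ρ)) := by
    refine (h0.sub hfin).congr fun n => ?_
    rw [Nat.cast_sub (hle n), sub_div]
  have l1 := (tendsto_lag hΨ hL hρ.le hβ hle hfin hNc).const_mul 3
  have l2 := tendsto_lag hΨ hL zero_le_one hβ (fun _ => le_rfl) h0 hNc
  have l3 := ((tendsto_profile hΨ hL hfin).pow 2).mul
    (tendsto_lag hΨ hL (sub_nonneg.2 hρ1) hβ (fun n => Nat.sub_le _ _) hsub hNc)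
  have l4 := ((l1.add l2).sub l3).const_mul (v k ^ 2)
  -- The mean weight enters squared, whence 4; the off-diagonal part already carries a factor 2,
  -- whence 8.
  have d := ((hg.diag k).comp hL).const_mul 4
  have o := ((hg.off_self k).comp hL).const_mul 8
  have h := (d.add l4).add o
  simp only [mul_zero, zero_add, add_zero] at h
  refine h.congr fun n => ?_
  simp only [Function.comp]
  rw [(W n).vecNormSq_self k, offDiag_finger, Complex.re_ofReal_mul, hW.fingers, hW.pulses,
    hW.lp_eq, hW.nc_eq]
  simp only [hW.gain]
  have hs : ∑ a ∈ Finset.range (L n), ∑ b ∈ Finset.range a,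
        lagWeight (Nc n) (a - b) * (finger (LP n) a + finger (LP n) b) ^ 2 *
          (‖g (L n) (k, a)‖ ^ 2 * ‖g (L n) (k, b)‖ ^ 2) =
      4 * ∑ a ∈ Finset.range (L n), ∑ b ∈ Finset.range a,
        lagWeight (Nc n) (a - b) * fingerMean (LP n) a b ^ 2 *
          (‖g (L n) (k, a)‖ ^ 2 * ‖g (L n) (k, b)‖ ^ 2
            - gainVar v Ψ (L n) (k, a) * gainVar v Ψ (L n) (k, b)) +
      v k ^ 2 * ∑ a ∈ Finset.range (L n), ∑ b ∈ Finset.range a,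
        lagWeight (Nc n) (a - b) * (finger (LP n) a + finger (LP n) b) ^ 2 *
          (profile Ψ (L n) a * profile Ψ (L n) b) := by
    rw [Finset.mul_sum, Finset.mul_sum, ← Finset.sum_add_distrib]
    refine Finset.sum_congr rfl fun a ha => ?_
    rw [Finset.mul_sum, Finset.mul_sum, ← Finset.sum_add_distrib]
    refine Finset.sum_congr rfl fun b hb => ?_
    have ha' := Finset.mem_range.1 ha
    have hb' := Finset.mem_range.1 hb
    rw [gainVar, gainVar, if_pos ha', if_pos (hb'.trans ha'), fingerMean]
    ring
  have e : extend ((W n).gain k) = fun a => g (L n) (k, a) := by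
    funext a
    exact hW.gain n k a
  rw [hs, e, sum_finger_sq _ _ (profile_add hΨ (L n)) (hle n)]
  ring

include hW hρ1 hLP in
lemma hSP_nonneg_of_realization (n : ℕ) (k : Fin K) : 0 ≤ (W n).hSP k :=
  (W n).hSP_nonneg (by rw [hW.fingers]; exact fingers_le hρ1 hLP n) k

include hg hW hΨ hρ hρ1 hv hL hLP in
lemma eventually_hSP_pos (k : Fin K) : ∀ᶠ n in atTop, 0 < (L n : ℝ) ∧ 0 < (W n).hSP k := by
  have h := tendsto_hSP_div hg hW hΨ hρ hρ1 hL hLP k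
  filter_upwards [hL.eventually_gt_atTop 0, h.eventually (lt_mem_nhds
    (mul_pos (hv k) (energyInt_pos (Real.log Ψ) hρ)))] with n hn h1
  have h2 : (0 : ℝ) < L n := by exact_mod_cast hn
  exact ⟨h2, (div_pos_iff_of_pos_right h2).1 h1⟩

lemma vecNormSq_nonneg {n : ℕ} (x : Fin n → ℂ) : 0 ≤ vecNormSq x :=
  Finset.sum_nonneg fun _ _ => by positivity

include hg hW hΨ hρ hρ1 hL hLP in
-- The two diagonal parts together form the product of the energy collected from user k and the
-- total energy of user j, up to the terms of equal path index. Those terms, the off-diagonal parts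
-- and the squared correlation are all o(L²).
lemma tendsto_cross_sum {k j : Fin K} (hjk : j ≠ k) :
    Tendsto (fun n => (vecNormSq ((shiftMatrix ((W n).rake k)).conjTranspose.mulVec ((W n).gain j)) +
        vecNormSq ((shiftMatrix ((W n).gain j)).conjTranspose.mulVec ((W n).rake k)) +
        ‖star ((W n).rake k) ⬝ᵥ (W n).gain j‖ ^ 2) / (L n : ℝ) ^ 2) atTop
      (𝓝 (v k * energyInt (Real.log Ψ) ρ * (v j * energyInt (Real.log Ψ) 1))) := by
  have hle := fingers_le hρ1 hLP
  have p := (tendsto_hSP_div hg hW hΨ hρ hρ1 hL hLP k).mul (tendsto_energy_all hg hW hΨ hL j)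
  have q := (hg.product k j hjk).comp hL
  have o1 := ((hg.off_rake_gain k j hjk).comp hL).const_mul 2
  have o2 := ((hg.off_gain_rake k j hjk).comp hL).const_mul 2
  have c := (hg.correlation k j hjk).comp hL
  have h := (((p.sub q).add o1).add o2).add c
  simp only [mul_zero, add_zero, sub_zero] at h
  refine h.congr fun n => ?_
  simp only [Function.comp]
  have hleW : (W n).fingers ≤ L n := by rw [hW.fingers]; exact hle n
  have hd := Network.cross_diag_eq (W n).fingers (fun a => ‖extend ((W n).gain k) a‖ ^ 2)
    (fun a => ‖extend ((W n).gain j) a‖ ^ 2) hleW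
  rw [(W n).vecNormSq_rake_gain, (W n).vecNormSq_gain_rake, (W n).correlation_eq hleW,
    (W n).hSP_eq hleW]
  have e : ∀ A B C D E F : ℝ, (A + 2 * B) + (C + 2 * D) + E = A + C + 2 * B + 2 * D + E :=
    fun A B C D E _ => by ring
  rw [e _ _ _ _ _ 0, hd]
  simp only [hW.gain, hW.fingers, hW.lp_eq]
  have e2 : ∀ f : Fin K, extend ((W n).gain f) = fun a => g (L n) (f, a) := fun f => by
    funext a; exact hW.gain n f a
  rw [e2, e2]
  ring

include hg hW hΨ hρ hρ1 hβ hv hNf hL hLP hNc in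
lemma isLargeSystem : IsLargeSystem W (fun n => (Nf : ℝ) * (Nc n : ℝ)) (mu Ψ ρ) (nu Ψ ρ β) := by
  have hNf' : (0 : ℝ) < Nf := by exact_mod_cast hNf
  have hLr : Tendsto (fun n => (L n : ℝ)) atTop atTop := tendsto_natCast_atTop_atTop.comp hL
  have hproc : ∀ n, (W n).procGain = (Nf : ℝ) * (Nc n : ℝ) := fun n => by
    rw [Network.procGain, hW.frames, hW.pulses]
  refine ⟨?_, fun k => ?_, fun n k => ?_, fun n k j => ?_, fun k => ?_, fun k j hjk => ?_⟩
  · refine Tendsto.const_mul_atTop hNf' ?_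
    simp only [hNc]
    exact hLr.const_mul_atTop hβ
  · refine ⟨v k * energyInt (Real.log Ψ) ρ / (Nf * β), div_pos (mul_pos (hv k)
      (energyInt_pos _ hρ)) (by positivity), ?_⟩
    refine ((tendsto_hSP_div hg hW hΨ hρ hρ1 hL hLP k).div_const (Nf * β)).congr fun n => ?_
    rw [hNc, div_div]
    congr 1; ring
  · have h1 := hSP_nonneg_of_realization hW hρ1 hLP n k
    have h2 := vecNormSq_nonneg ((phiMatrix (L n) (W n).pulses).mulVec
        ((shiftMatrix ((W n).rake k)).conjTranspose.mulVec ((W n).gain k) +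
          (shiftMatrix ((W n).gain k)).conjTranspose.mulVec ((W n).rake k)))
    unfold Network.hSI
    rw [hproc]
    positivity
  · have h1 := hSP_nonneg_of_realization hW hρ1 hLP n k
    have h2 := vecNormSq_nonneg ((shiftMatrix ((W n).rake k)).conjTranspose.mulVec ((W n).gain j))
    have h3 := vecNormSq_nonneg ((shiftMatrix ((W n).gain j)).conjTranspose.mulVec ((W n).rake k))
    unfold Network.hMAI
    rw [hproc]
    positivity
  -- The processing gain cancels in N hSI / hSP, leaving the squared norm over hSP². Both are of
  -- order L², and the user's variance cancels in the limit; the same happens for the cross gains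
  -- below.
  · have hlim := (tendsto_vecNormSq_self hg hW hΨ hρ hρ1 hβ hL hLP hNc k).div
      ((tendsto_hSP_div hg hW hΨ hρ hρ1 hL hLP k).pow 2)
      (pow_pos (mul_pos (hv k) (energyInt_pos (Real.log Ψ) hρ)) 2).ne'
    rw [mul_pow, mul_div_mul_left _ _ (pow_pos (hv k) 2).ne'] at hlim
    rw [nu_eq hΨ hρ hρ1 hβ]
    refine hlim.congr' ?_
    filter_upwards [eventually_hSP_pos hg hW hΨ hρ hρ1 hv hL hLP k] with n hn
    obtain ⟨hl, hs⟩ := hn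
    have hNcpos : (0 : ℝ) < Nc n := by rw [hNc]; positivity
    simp only [Pi.div_apply]
    unfold Network.hSI
    rw [hproc]
    field_simp
  · have hlim := (tendsto_cross_sum hg hW hΨ hρ hρ1 hL hLP hjk).div
      ((tendsto_hSP_div hg hW hΨ hρ hρ1 hL hLP k).mul (tendsto_hSP_div hg hW hΨ hρ hρ1 hL hLP j))
      (mul_pos (mul_pos (hv k) (energyInt_pos (Real.log Ψ) hρ))
        (mul_pos (hv j) (energyInt_pos (Real.log Ψ) hρ))).ne'
    rw [mul_div_mul_left _ _ (mul_pos (hv k) (energyInt_pos (Real.log Ψ) hρ)).ne',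
      mul_div_mul_left _ _ (hv j).ne', ← mu_eq hΨ hρ] at hlim
    refine hlim.congr' ?_
    filter_upwards [eventually_hSP_pos hg hW hΨ hρ hρ1 hv hL hLP k,
      eventually_hSP_pos hg hW hΨ hρ hρ1 hv hL hLP j] with n hn hn'
    obtain ⟨hl, hs⟩ := hn
    have hs' := hn'.2
    have hNcpos : (0 : ℝ) < Nc n := by rw [hNc]; positivity
    simp only [Pi.div_apply]
    unfold Network.hMAI
    rw [hproc]
    field_simp

end LargeSystem

end UWB

/-! ### The asymptotic loss of the partial-Rake receiver -/

theorem proposition2 {Ω : Type*} [MeasurableSpace Ω] (P : Measure Ω) [IsProbabilityMeasure P]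
    (K Nf : ℕ) (hNf : 0 < Nf)
    (Ψ ρ β : ℝ) (hΨ : 0 < Ψ) (hρ : 0 < ρ) (hρ1 : ρ ≤ 1) (hβ : 0 < β)
    -- channel model
    (v : Fin K → ℝ) (hv : ∀ k, 0 < v k)
    (α : (L : ℕ) → Fin K → Fin L → Ω → ℂ) (hα : UWB.IsChannel P v Ψ α)
    -- the game
    (G : UWB.Game) (hD : 0 < G.infoBits) (hM : 0 < G.totalBits) (hR : 0 < G.rate)
    (hnoise : 0 < G.noise) (hpmax : 0 < G.pmax) (hf : UWB.IsEfficiency G.eff)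
    (Γ : ℝ) (hΓ : UWB.IsTargetSINR G.eff Γ)
    -- asymptotic regime: numbers of paths, of pulse positions per frame, of Rake fingers
    (L Nc LP : ℕ → ℕ) (hL : Tendsto L atTop atTop)
    (hLP : ∀ n, (LP n : ℝ) = ρ * (L n : ℝ)) (hNc : ∀ n, (Nc n : ℝ) = β * (L n : ℝ)) :
    -- the constants of the all-Rake receiver are the limits as `ρ → 1`
    (Tendsto (fun r => UWB.mu Ψ r) (𝓝[<] 1) (𝓝 (UWB.muA Ψ)) ∧
      Tendsto (fun r => UWB.nu Ψ r β) (𝓝[<] 1) (𝓝 (UWB.nuA Ψ β))) ∧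
    ∀ᵐ ω ∂P,
      -- Nash equilibria exist for all large systems
      (∀ᶠ n in atTop, (∃ p, (UWB.networkAt Nf L Nc LP α ω n).IsNash G p) ∧
          ∃ p, (UWB.networkAt Nf L Nc LP α ω n).allRake.IsNash G p) ∧
      ∀ p pA : ℕ → Fin K → ℝ,
        (∀ᶠ n in atTop, (UWB.networkAt Nf L Nc LP α ω n).IsNash G (p n)) →
        (∀ᶠ n in atTop, (UWB.networkAt Nf L Nc LP α ω n).allRake.IsNash G (pA n)) →
        ∀ k : Fin K,
          -- the loss is asymptotically `μ` times the interference factor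
          Tendsto (fun n =>
              (UWB.networkAt Nf L Nc LP α ω n).allRake.utility G (pA n) k /
                  (UWB.networkAt Nf L Nc LP α ω n).utility G (p n) k
                - UWB.mu Ψ ρ * UWB.interferenceFactor K Γ Ψ ρ β ((Nf : ℝ) * (Nc n : ℝ)))
            atTop (𝓝 0) ∧
          -- and the interference factor is exact up to `o (1 / N)` once the ratio of the
          -- collected signal energies, whose limit is `μ`, is divided out
          Tendsto (fun n => (UWB.networkAt Nf L Nc LP α ω n).allRake.hSP k /
              (UWB.networkAt Nf L Nc LP α ω n).hSP k) atTop (𝓝 (UWB.mu Ψ ρ)) ∧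
          Tendsto (fun n =>
              ((Nf : ℝ) * (Nc n : ℝ)) *
                ((UWB.networkAt Nf L Nc LP α ω n).allRake.utility G (pA n) k /
                  (UWB.networkAt Nf L Nc LP α ω n).utility G (p n) k
                    / ((UWB.networkAt Nf L Nc LP α ω n).allRake.hSP k /
                        (UWB.networkAt Nf L Nc LP α ω n).hSP k)
                  - UWB.interferenceFactor K Γ Ψ ρ β ((Nf : ℝ) * (Nc n : ℝ))))
            atTop (𝓝 0) := by
  refine ⟨⟨UWB.tendsto_mu hΨ, UWB.tendsto_nu hΨ hβ⟩, ?_⟩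
  obtain ⟨α', hα', hmeas, hae⟩ := hα.exists_measurable
  have hfield := fun l => hα'.isGainField hmeas hΨ hv l
  have hle : ∀ l : ℕ, ⌊ρ * (l : ℝ)⌋₊ ≤ l := fun l => by
    have : ρ * (l : ℝ) ≤ l := mul_le_of_le_one_left (by positivity) hρ1
    simpa using Nat.floor_mono this
  -- The limit laws are stated along all numbers l of paths and then composed with L, which need be
  -- neither injective nor monotone. Fingers and pulse positions must therefore be functions of l;
  -- the floors recover `LP n` and `Nc n` at l = `L n`.
  filter_upwards [hae, UWB.ae_isTypical hfield (lp := fun l => ⌊ρ * (l : ℝ)⌋₊)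
    (nc := fun l => ⌊β * (l : ℝ)⌋₊) hle, UWB.ae_isTypical hfield (lp := fun l => l)
    (nc := fun l => ⌊β * (l : ℝ)⌋₊) fun l => le_rfl] with ω hω hT hTA
  have hgain : ∀ n k a, UWB.extend ((UWB.networkAt Nf L Nc LP α ω n).gain k) a
      = UWB.gains α' (L n) (k, a) ω := fun n k a => by
    unfold UWB.gains
    congr 1
    funext l
    exact hω _ _ _
  have hnc : ∀ n, ⌊β * (L n : ℝ)⌋₊ = Nc n := fun n => by rw [← hNc, Nat.floor_natCast]
  have hW : UWB.IsRealization (UWB.networkAt Nf L Nc LP α ω) Nf Nc LP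
      (fun l => ⌊ρ * (l : ℝ)⌋₊) (fun l => ⌊β * (l : ℝ)⌋₊) (fun l i => UWB.gains α' l i ω) :=
    ⟨fun _ => rfl, fun _ => rfl, fun _ => rfl, hgain,
      fun n => by rw [← hLP, Nat.floor_natCast], hnc⟩
  -- The all-Rake system is the case ρ = 1 with the same gains, so the same limit theorem applies to
  -- it.
  have hWA : UWB.IsRealization (fun n => (UWB.networkAt Nf L Nc LP α ω n).allRake) Nf Nc L
      (fun l => l) (fun l => ⌊β * (l : ℝ)⌋₊) (fun l i => UWB.gains α' l i ω) :=
    ⟨fun _ => rfl, fun _ => rfl, fun _ => rfl, hgain, fun _ => rfl, hnc⟩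
  have hLA : ∀ n, (L n : ℝ) = 1 * (L n : ℝ) := fun n => (one_mul _).symm
  have hS := UWB.isLargeSystem hT hW hΨ hρ hρ1 hβ hv hNf hL hLP hNc
  have hSA := UWB.isLargeSystem hTA hWA hΨ one_pos le_rfl hβ hv hNf hL hLA hNc
  rw [UWB.mu_one hΨ, UWB.nu_one hΨ hβ] at hSA
  have hc : 0 < (G.infoBits : ℝ) / G.totalBits * G.rate := by positivity
  refine ⟨(hS.eventually_exists_isNash hnoise hpmax hf hΓ hc).and
    (hSA.eventually_exists_isNash hnoise hpmax hf hΓ hc), fun p pA hp hpA k => ?_⟩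
  have hm : Tendsto (fun n => (UWB.networkAt Nf L Nc LP α ω n).allRake.hSP k /
      (UWB.networkAt Nf L Nc LP α ω n).hSP k) atTop (𝓝 (UWB.mu Ψ ρ)) := by
    have hpos := UWB.energyInt_pos (Real.log Ψ) hρ
    have h := (UWB.tendsto_hSP_div hTA hWA hΨ one_pos le_rfl hL hLA k).div
      (UWB.tendsto_hSP_div hT hW hΨ hρ hρ1 hL hLP k) (mul_pos (hv k) hpos).ne'
    rw [mul_div_mul_left _ _ (hv k).ne', ← UWB.mu_eq hΨ hρ] at h
    refine h.congr' ?_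
    filter_upwards [hL.eventually_gt_atTop 0] with n hn
    have : (L n : ℝ) ≠ 0 := by exact_mod_cast hn.ne'
    simp only [Pi.div_apply]
    rw [div_div_div_cancel_right₀ this]
  obtain ⟨h1, h2⟩ := UWB.tendsto_loss hS hSA hnoise hpmax hf hΓ hc hp hpA k hm
  exact ⟨h1, hm, h2⟩
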